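/- Let ${\rm Ai}$ be the Airy function, ${\rm Ai}(z)=\frac1{2\pi}\int e^{i(tz+t^3/3)}\,dt$ along a contour from $e^{5\pi i/6}\infty$ to $e^{\pi i/6}\infty$, and put $A_0(z)={\rm Ai}(z)$, $A_1(z)=e^{2\pi i/3}{\rm Ai}(e^{2\pi i/3}z)$, $A_2(z)=e^{-2\pi i/3}{\rm Ai}(e^{-2\pi i/3}z)$. Let $$p(t)=\frac1{2\pi}\left(\int_{l_2}e^{it\sigma}\frac{A_2(\sigma)}{A_1(\sigma)}\,d\sigma-\int_{l_3}e^{it\sigma}\frac{A_0(\sigma)}{A_1(\sigma)}\,d\sigma\right)\quad(t\in\mathbb C),\qquad \hat p(t)=\frac1{2\pi i t}+p(t)\quad(t\neq0),$$ where $l_2$ and $l_3$ are the rays from $e^{2\pi i/3}\infty$ to $0$ and from $0$ to $+\infty$. For real $\hat x,\hat y$ let $\hat n=\hat y+\hat x^2/4$, let the scattered amplitude be $$A^s(\hat x,\hat y)=-e^{-i(\hat x\hat y/2+\hat x^3/12)}\int_{-\infty}^{\infty}e^{i\hat x\sigma/2}\,\frac{A_0(\sigma)}{A_1(\sigma)}\,A_1(\sigma-\hat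 n)\,d\sigma$$ (an improper integral, the limit of $\int_a^b$ as $a\to-\infty$, $b\to+\infty$), and let $A=1+A^s$ be the total amplitude. Then the integrals defining $p$ converge absolutely and $p$ is entire, so that $\hat p$ has a simple pole at $t=0$, with residue $1/(2\pi i)$. Moreover, for all real $\hat x,\hat y$ the improper integral defining $A^s$ converges, and $$A(\hat x,\hat y)=\int_{\Gamma_1^r}\hat p(t)\,e^{i(-\hat yt-\hat xt^2/2+t^3/3)}\,dt$$ for every contour $\Gamma_1^r$ going from $-i\infty$ to $e^{5\pi i/6}\infty$ and passing to the right of the origin; that is, for every piecewise $C^1$ curve $\gamma:\mathbb R\to\mathbb C\setminus\{0\}$ with $|\gamma(s)|\to\infty$ as $s\to\pm\infty$ that has a continuous argument tending to $-\pi/2$ as $s\to-\infty$ and to $5\pi/6$ as $s\to+\infty$. The contour integral is the limit of the integrals over $[a,b]$ as $a\to-\infty$, $b\to+\infty$, and this limit exists. -/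

import Mathlib

open Filter Topology MeasureTheory Set

noncomputable section

namespace TangentRay

/-- The integral of `f` along the ray from `0` to `e^{iα}∞`, oriented outwards. -/
def rayIntegral (α : ℝ) (f : ℂ → ℂ) : ℂ :=
  ∫ r in Ioi (0 : ℝ), f (r * Complex.exp (Complex.I * α)) * Complex.exp (Complex.I * α)

/-- Absolute convergence of the integral of `f` along the ray from `0` to `e^{iα}∞`. -/
def RayIntegrable (α : ℝ) (f : ℂ → ℂ) : Prop :=
  IntegrableOn
    (fun r : ℝ => f (r * Complex.exp (Complex.I * α)) * Complex.exp (Complex.I * α)) (Ioi 0)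

/-- The Airy function `Ai(z) = (1/2π) ∫ e^{i(tz + t³/3)} dt`, the contour being the ray from
`e^{5πi/6}∞` to `0` followed by the ray from `0` to `e^{πi/6}∞`. -/
def airyAi (z : ℂ) : ℂ :=
  1 / (2 * Real.pi) *
    (rayIntegral (Real.pi / 6) (fun t => Complex.exp (Complex.I * (t * z + t ^ 3 / 3)))
      - rayIntegral (5 * Real.pi / 6) (fun t => Complex.exp (Complex.I * (t * z + t ^ 3 / 3))))

/-- `A₀(z) = Ai(z)`. -/
def airyA0 (z : ℂ) : ℂ := airyAi z

/-- `A₁(z) = e^{2πi/3} Ai(e^{2πi/3} z)`. -/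
def airyA1 (z : ℂ) : ℂ :=
  Complex.exp (2 * Real.pi * Complex.I / 3) * airyAi (Complex.exp (2 * Real.pi * Complex.I / 3) * z)

/-- `A₂(z) = e^{-2πi/3} Ai(e^{-2πi/3} z)`. -/
def airyA2 (z : ℂ) : ℂ :=
  Complex.exp (-(2 * Real.pi * Complex.I / 3)) *
    airyAi (Complex.exp (-(2 * Real.pi * Complex.I / 3)) * z)

/-- The integrand `e^{itσ} A₂(σ)/A₁(σ)` on `l₂`. -/
def pekerisIntegrand₂ (t σ : ℂ) : ℂ :=
  Complex.exp (Complex.I * t * σ) * (airyA2 σ / airyA1 σ)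

/-- The integrand `e^{itσ} A₀(σ)/A₁(σ)` on `l₃`. -/
def pekerisIntegrand₃ (t σ : ℂ) : ℂ :=
  Complex.exp (Complex.I * t * σ) * (airyA0 σ / airyA1 σ)

/-- The Pekeris function
`p(t) = (1/2π) (∫_{l₂} e^{itσ} A₂(σ)/A₁(σ) dσ - ∫_{l₃} e^{itσ} A₀(σ)/A₁(σ) dσ)`,
where `l₂` goes from `e^{2πi/3}∞` to `0` (inwards, whence the sign) and `l₃` from `0` to `∞`. -/
def pekeris (t : ℂ) : ℂ :=
  1 / (2 * Real.pi) *
    (-rayIntegral (2 * Real.pi / 3) (pekerisIntegrand₂ t) - rayIntegral 0 (pekerisIntegrand₃ t))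

/-- The Pekeris caret function `p̂(t) = 1/(2πit) + p(t)`, for `t ≠ 0`. -/
def pekerisCaret (t : ℂ) : ℂ :=
  1 / (2 * Real.pi * Complex.I * t) + pekeris t

/-- The integrand `e^{ixσ/2} (A₀(σ)/A₁(σ)) A₁(σ - n)`, `n = y + x²/4`, of the Fock formula. -/
def fockIntegrand (x y σ : ℝ) : ℂ :=
  Complex.exp (Complex.I * x * σ / 2) * (airyA0 σ / airyA1 σ) *
    airyA1 ((σ - (y + x ^ 2 / 4) : ℝ) : ℂ)

/-- The Fock formula with its integral truncated to `[R.1, R.2]`: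
`-e^{-i(xy/2 + x³/12)} ∫ e^{ixσ/2} (A₀(σ)/A₁(σ)) A₁(σ - n) dσ`. -/
def fockTruncated (x y : ℝ) (R : ℝ × ℝ) : ℂ :=
  -Complex.exp (-Complex.I * (x * y / 2 + x ^ 3 / 12)) * ∫ σ in R.1..R.2, fockIntegrand x y σ

/-- The scattered amplitude `A^s(x, y)`: the classical Fourier integral over `(-∞, ∞)`, an
improper integral, i.e. the limit of the truncated ones as both ends go to infinity. -/
def scatteredAmplitude (x y : ℝ) : ℂ :=
  limUnder (atBot ×ˢ atTop) (fockTruncated x y)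

/-- The amplitude of the incident field, `A^i ≡ 1`. -/
def incidentAmplitude (_x _y : ℝ) : ℂ := 1

/-- The total amplitude `A = A^i + A^s`. -/
def totalAmplitude (x y : ℝ) : ℂ := incidentAmplitude x y + scatteredAmplitude x y

/-- `γ : ℝ → ℂ` is continuous and piecewise `C¹`, with finitely many break points in every bounded
interval: it is `C¹`, up to the end points, on each compact interval with no break point inside. -/
def IsPiecewiseC1 (γ : ℝ → ℂ) : Prop :=
  Continuous γ ∧ ∃ P : Set ℝ, (∀ a b : ℝ, (P ∩ Icc a b).Finite) ∧
    ∀ a b : ℝ, a < b → Disjoint (Ioo a b) P → ContDiffOn ℝ 1 γ (Icc a b)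

/-- `γ` is a contour going from `-i∞` to `e^{5πi/6}∞` and passing to the right of the origin: it
is piecewise `C¹`, avoids the origin, has `|γ| → ∞` at both ends, and a continuous determination of
its argument goes from `-π/2` to `5π/6`.  (For a contour passing to the left of the origin the
argument goes from `-π/2` to `-7π/6` instead.) -/
structure IsRightContour (γ : ℝ → ℂ) : Prop where
  piecewiseC1 : IsPiecewiseC1 γ
  ne_zero : ∀ s, γ s ≠ 0
  norm_atBot : Tendsto (fun s => ‖γ s‖) atBot atTop
  norm_atTop : Tendsto (fun s => ‖γ s‖) atTop atTop
  exists_arg : ∃ θ : ℝ → ℝ, Continuous θ ∧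
    (∀ s, γ s = ‖γ s‖ * Complex.exp (Complex.I * θ s)) ∧
    Tendsto θ atBot (𝓝 (-(Real.pi / 2))) ∧ Tendsto θ atTop (𝓝 (5 * Real.pi / 6))

/-- The integral of `F` along the infinite contour `γ` converges, with value `J`: `F(γ(s)) γ'(s)`
is integrable on bounded intervals and its integral over `[a, b]` tends to `J` as `a → -∞` and
`b → ∞` independently. -/
def HasContourIntegral (F : ℂ → ℂ) (γ : ℝ → ℂ) (J : ℂ) : Prop :=
  (∀ a b : ℝ, IntervalIntegrable (fun s => F (γ s) * deriv γ s) volume a b) ∧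
    Tendsto (fun R : ℝ × ℝ => ∫ s in R.1..R.2, F (γ s) * deriv γ s) (atBot ×ˢ atTop) (𝓝 J)

end TangentRay

end

/-! Put a = -x/2 and b = -y, so that the exponential in the theorem is `cubicExp a b`. Completing
the cube shows that the integral of `cubicExp a (b + σ)` from -i∞ to e^{5πi/6}∞ is A₁(σ - n) up to
an explicit factor (`cubicIntegral_eq`). Hence A^s is -1/(2π) times the improper integral of
(A₀/A₁)(σ) `cubicIntegral a (b + σ)` over the real line.

On the positive axis A₀/A₁ is O(e^{-4σ^{3/2}/3}), and Fubini gives the l₃ part of p. On the negative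
axis A₀ = -A₁ - A₂, so A₀/A₁ = -1 - A₂/A₁. The term in A₂/A₁ is turned by Cauchy's theorem onto the
ray of direction e^{2πi/3} (`exists_norm_rotation_le`), where it decays fast enough for Fubini and
gives the l₂ part.

The term -1 produces the pole. Since i∫_{-R}^0 e^{iσt} dσ = (1 - e^{-iRt})/t, the integral of
`cubicIntegral a (b + σ)` over [-R, 0] compares the contour integral of `cubicExp a b t / t` with
the same integral for b - R. For b - R there is a stationary point far to the left of the origin.
The contour to the left of the origin through that point contributes O(R^{-1/2}), so the one to the
right tends to the residue term 2πi (`IsPolarPrimitive.tendsto_integral`). After normalization this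
2πi is the incident amplitude 1.

Contours are never deformed. The integrand is c/t plus an entire function with primitive Φ, and Φ +
c log t has limits at infinity in narrow sectors around the two end directions
(`exists_tendsto_primitive`). The contour integral is the difference of these limits
(`hasContourIntegral_of_primitive`). Convergence in the sectors holds because the parts of p grow at
most like e^{4|t|³/27}, against the decay e^{-|t|³/3} along the two directions.

The inputs on the Airy function are the saddle point bounds `norm_airyAi_le` and `le_norm_airyAi`,
and the absence of zeros off the negative axis, `airyAi_ne_zero`. -/

noncomputable section

namespace TangentRay

/-! ### Primitives along a sector at infinity -/

/-- A narrow open sector around the direction `d`. -/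
def sector (d : ℂ) : Set ℂ := {t | 999 / 1000 * ‖t‖ < (starRingEnd ℂ d * t).re}

/-- The filter of neighbourhoods of infinity in the sector around `d`. -/
def sectorAtInfty (d : ℂ) : Filter ℂ := comap norm atTop ⊓ 𝓟 (sector d)

/-- `F` decays at least quadratically in the sector around `d`. -/
def SectorDecay (F : ℂ → ℂ) (d : ℂ) : Prop :=
  ∃ C R : ℝ, ∀ t ∈ sector d, R ≤ ‖t‖ → ‖F t‖ ≤ C / ‖t‖ ^ 2

lemma tendsto_sectorAtInfty {ι : Type*} {l : Filter ι} {f : ι → ℂ} {d : ℂ} :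
    Tendsto f l (sectorAtInfty d) ↔
      Tendsto (fun i => ‖f i‖) l atTop ∧ ∀ᶠ i in l, f i ∈ sector d := by
  simp [sectorAtInfty, tendsto_inf]

lemma tendsto_ray_sectorAtInfty {d : ℂ} (hd : ‖d‖ = 1) (c : ℂ) :
    Tendsto (fun v : ℝ => c + v * d) atTop (sectorAtInfty d) := by
  rw [tendsto_sectorAtInfty]
  constructor
  · refine tendsto_atTop_mono' atTop (f₁ := fun v : ℝ => v - ‖c‖) ?_
      (tendsto_atTop_add_const_right _ _ tendsto_id)
    filter_upwards [eventually_ge_atTop 0] with v hv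
    have := norm_sub_le (c + v * d) c
    simp only [add_sub_cancel_left, norm_mul, hd, Complex.norm_real, Real.norm_eq_abs,
      abs_of_nonneg hv] at this
    linarith
  -- The sector condition follows from 999/1000 (‖c‖ + v) < v - ‖c‖, that is, from v > 1999 ‖c‖.
  · filter_upwards [eventually_gt_atTop (2000 * ‖c‖), eventually_ge_atTop 0] with v hv hv0
    have h1 : ‖c + v * d‖ ≤ ‖c‖ + v := by
      refine (norm_add_le _ _).trans ?_
      simp [hd, abs_of_nonneg hv0]
    have h2 : (starRingEnd ℂ d * (c + v * d)).re = (starRingEnd ℂ d * c).re + v := by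
      have : starRingEnd ℂ d * (c + v * d) = starRingEnd ℂ d * c + v * (d * starRingEnd ℂ d) := by
        ring
      rw [this, Complex.mul_conj, Complex.normSq_eq_norm_sq, hd]
      simp
    have h3 : -‖c‖ ≤ (starRingEnd ℂ d * c).re := by
      have := Complex.abs_re_le_norm (starRingEnd ℂ d * c)
      rw [norm_mul, Complex.norm_conj, hd, one_mul] at this
      linarith [neg_abs_le (starRingEnd ℂ d * c).re]
    simp only [sector, mem_ofPred_eq, h2]
    linarith

lemma neBot_sectorAtInfty {d : ℂ} (hd : ‖d‖ = 1) : (sectorAtInfty d).NeBot :=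
  (tendsto_ray_sectorAtInfty hd 0).neBot

/-- The image of a neighbourhood of infinity in the sector under inversion. -/
def invSector (d : ℂ) (r : ℝ) : Set ℂ := {u | 999 / 1000 * ‖u‖ < (d * u).re ∧ ‖u‖ < r}

/-- This is the reason for inverting: a sector with a disc around 0 removed is not convex, but its
inverse is a convex cone cut by a ball, on which the mean value inequality applies. -/
lemma convex_invSector (d : ℂ) (r : ℝ) : Convex ℝ (invSector d r) := by
  rintro x ⟨hx1, hx2⟩ y ⟨hy1, hy2⟩ a b ha hb hab
  have h1 : ‖a • x + b • y‖ ≤ a * ‖x‖ + b * ‖y‖ := by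
    refine (norm_add_le _ _).trans ?_
    simp [abs_of_nonneg ha, abs_of_nonneg hb]
  have h2 : (d * (a • x + b • y)).re = a * (d * x).re + b * (d * y).re := by
    simp [Complex.mul_re]; ring
  obtain rfl : b = 1 - a := by linarith
  rcases ha.eq_or_lt with rfl | ha
  · simpa [invSector] using And.intro hy1 hy2
  · constructor
    · rw [h2]; nlinarith
    · nlinarith

lemma ne_zero_of_mem_invSector {d u : ℂ} {r : ℝ} (hu : u ∈ invSector d r) : u ≠ 0 := by
  rintro rfl
  simpa using hu.1

lemma re_mul_inv_eq (d u : ℂ) :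
    (starRingEnd ℂ d * u⁻¹).re = (d * u).re / ‖u‖ ^ 2 := by
  rw [Complex.inv_def, Complex.normSq_eq_norm_sq]
  have : starRingEnd ℂ d * (starRingEnd ℂ u * (((‖u‖ ^ 2)⁻¹ : ℝ) : ℂ)) =
    starRingEnd ℂ (d * u) * (((‖u‖ ^ 2)⁻¹ : ℝ) : ℂ) := by simp [mul_assoc]
  rw [this, Complex.re_mul_ofReal, Complex.conj_re]; rfl

lemma inv_mem_sector {d u : ℂ} {r : ℝ} (hu : u ∈ invSector d r) : u⁻¹ ∈ sector d := by
  have hu0 : 0 < ‖u‖ := norm_pos_iff.2 (ne_zero_of_mem_invSector hu)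
  have h1 := hu.1
  simp only [sector, mem_ofPred_eq, re_mul_inv_eq, norm_inv]
  rw [lt_div_iff₀ (by positivity)]
  calc 999 / 1000 * ‖u‖⁻¹ * ‖u‖ ^ 2 = 999 / 1000 * ‖u‖ := by field_simp
    _ < _ := h1

lemma inv_mem_invSector {d t : ℂ} {r : ℝ} (hr : 0 < r) (ht : t ∈ sector d) (htr : r⁻¹ < ‖t‖) :
    t⁻¹ ∈ invSector d r := by
  have ht0 : 0 < ‖t‖ := (inv_pos.2 hr).trans htr
  refine ⟨?_, ?_⟩
  · have := re_mul_inv_eq d t⁻¹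
    rw [inv_inv, norm_inv] at this
    simp only [sector, mem_ofPred_eq] at ht
    rw [this, lt_div_iff₀ (by positivity)] at ht
    rw [norm_inv]
    calc 999 / 1000 * ‖t‖⁻¹ = 999 / 1000 * ‖t‖ * ‖t‖⁻¹ ^ 2 := by field_simp
      _ < _ := ht
  · rw [norm_inv]
    exact inv_lt_of_inv_lt₀ hr htr

/-- A primitive of a function with quadratic decay in a sector has a limit at infinity there. -/
lemma exists_tendsto_primitive {F Φ : ℂ → ℂ} {d : ℂ} (hd : ‖d‖ = 1) (hF : SectorDecay F d)
    (hΦ : ∀ t ∈ sector d, HasDerivAt Φ (F t) t) : ∃ L, Tendsto Φ (sectorAtInfty d) (𝓝 L) := by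
  obtain ⟨C, R, hCR⟩ := hF
  set r : ℝ := (max R 1)⁻¹ with hr
  have hr0 : 0 < r := by positivity
  have hmem : ∀ᶠ t in sectorAtInfty d, t⁻¹ ∈ invSector d r := by
    rw [sectorAtInfty, eventually_inf_principal]
    filter_upwards [tendsto_comap.eventually (eventually_gt_atTop r⁻¹)] with t h1 h2
    exact inv_mem_invSector hr0 h2 h1
  set K := invSector d r
  have hinv : Tendsto (fun t : ℂ => t⁻¹) (sectorAtInfty d) (𝓝[K] 0) := by
    rw [tendsto_nhdsWithin_iff]
    refine ⟨?_, hmem⟩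
    rw [tendsto_zero_iff_norm_tendsto_zero]
    simp only [norm_inv]
    exact tendsto_inv_atTop_zero.comp (tendsto_comap.mono_left inf_le_left)
  -- In the coordinate u = 1/t quadratic decay of F becomes boundedness of the derivative. So Φ(1/u)
  -- is Lipschitz on a convex set, and Cauchy as u → 0.
  have hder : ∀ u ∈ K, HasDerivWithinAt (fun u => Φ u⁻¹) (F u⁻¹ * (-(u ^ 2)⁻¹)) K u := by
    intro u hu
    exact ((hΦ _ (inv_mem_sector hu)).comp u
      (hasDerivAt_inv (ne_zero_of_mem_invSector hu))).hasDerivWithinAt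
  have hbd : ∀ u ∈ K, ‖F u⁻¹ * (-(u ^ 2)⁻¹)‖₊ ≤ Real.toNNReal C := by
    intro u hu
    have hu0 : 0 < ‖u‖ := norm_pos_iff.2 (ne_zero_of_mem_invSector hu)
    have h1 := hCR u⁻¹ (inv_mem_sector hu) (by
      rw [norm_inv]
      refine (le_max_left R 1).trans ?_
      rw [← inv_inv (max R 1)]
      exact inv_anti₀ hu0 hu.2.le)
    rw [← NNReal.coe_le_coe, coe_nnnorm, norm_mul, norm_neg, norm_inv, norm_pow]
    refine le_trans ?_ (Real.le_coe_toNNReal C)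
    rw [norm_inv] at h1
    calc ‖F u⁻¹‖ * (‖u‖ ^ 2)⁻¹ ≤ C / ‖u‖⁻¹ ^ 2 * (‖u‖ ^ 2)⁻¹ := by gcongr
      _ = C := by field_simp
  have hlip := (convex_invSector d r).lipschitzOnWith_of_nnnorm_hasDerivWithin_le hder hbd
  have := neBot_sectorAtInfty hd
  have hne : (𝓝[K] (0 : ℂ)).NeBot := hinv.neBot
  have hc : Cauchy (map (fun u => Φ u⁻¹) (𝓝[K] (0 : ℂ))) :=
    (cauchy_nhds.mono nhdsWithin_le_nhds : Cauchy (𝓝[K] (0 : ℂ))).map_of_le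
      hlip.uniformContinuousOn inf_le_right
  obtain ⟨L, hL⟩ := CompleteSpace.complete hc
  refine ⟨L, ?_⟩
  have := (show Tendsto (fun u => Φ u⁻¹) (𝓝[K] (0 : ℂ)) (𝓝 L) from hL).comp hinv
  simpa [Function.comp_def] using this

lemma norm_exp_I_mul (α : ℝ) : ‖Complex.exp (Complex.I * α)‖ = 1 := by
  rw [mul_comm]; exact Complex.norm_exp_ofReal_mul_I α

/-- Along the ray of direction `e^{iα}`, a primitive tends to the ray integral. -/
lemma tendsto_primitive_rayIntegral {F Φ : ℂ → ℂ} {α : ℝ}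
    (hF : SectorDecay F (Complex.exp (Complex.I * α))) (hΦ : ∀ t, HasDerivAt Φ (F t) t) :
    RayIntegrable α F ∧ Tendsto Φ (sectorAtInfty (Complex.exp (Complex.I * α)))
      (𝓝 (Φ 0 + rayIntegral α F)) := by
  set d := Complex.exp (Complex.I * α) with hdef
  have hd : ‖d‖ = 1 := norm_exp_I_mul α
  have hFd : Differentiable ℂ F := by
    have h1 : Differentiable ℂ Φ := fun t => (hΦ t).differentiableAt
    have h2 : deriv Φ = F := funext fun t => (hΦ t).deriv
    rw [← h2]
    intro t
    exact (h1.analyticAt t).deriv.differentiableAt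
  have hray : Tendsto (fun v : ℝ => (v : ℂ) * d) atTop (sectorAtInfty d) := by
    simpa using tendsto_ray_sectorAtInfty hd 0
  have hint : RayIntegrable α F := by
    have hcont : Continuous fun v : ℝ => F (v * d) * d :=
      (hFd.continuous.comp (by fun_prop)).mul continuous_const
    obtain ⟨C, R, hCR⟩ := hF
    have hO : (fun v : ℝ => F (v * d) * d) =O[atTop] fun v : ℝ => v ^ (-2 : ℝ) := by
      refine Asymptotics.IsBigO.of_bound |C| ?_
      filter_upwards [(tendsto_sectorAtInfty.1 hray).2, eventually_ge_atTop R,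
        eventually_gt_atTop 0] with v h1 h2 h3
      have hn : ‖(v : ℂ) * d‖ = v := by simp [hd, abs_of_pos h3]
      have := hCR _ h1 (by rw [hn]; exact h2)
      rw [hn] at this
      rw [norm_mul, hd, mul_one, Real.rpow_neg h3.le, Real.norm_of_nonneg (by positivity)]
      refine this.trans ?_
      rw [div_eq_mul_inv]
      norm_cast
      gcongr
      exact le_abs_self C
    exact ((hcont.locallyIntegrable.locallyIntegrableOn (Ici 0)).integrableOn_of_isBigO_atTop hO
      (integrableAtFilter_rpow_atTop_iff.2 (by norm_num))).mono_set Ioi_subset_Ici_self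
  refine ⟨hint, ?_⟩
  obtain ⟨L, hL⟩ := exists_tendsto_primitive hd hF fun t _ => hΦ t
  have hder : ∀ v : ℝ, HasDerivAt (fun v : ℝ => Φ (v * d)) (F (v * d) * d) v := by
    intro v
    have h1 : HasDerivAt (fun v : ℝ => (v : ℂ) * d) d v := by
      simpa using (Complex.ofRealCLM.hasDerivAt (x := v)).mul_const d
    exact (hΦ _).comp v h1
  have := integral_Ioi_of_hasDerivAt_of_tendsto' (a := 0) (fun v _ => hder v) hint (hL.comp hray)
  have h2 : Φ 0 + rayIntegral α F = L := by
    rw [rayIntegral, this]; simp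
  rwa [h2]

/-! ### Decay of cubic exponentials -/

lemma norm_sub_le_of_mem_sector {d t : ℂ} (hd : ‖d‖ = 1) (ht : t ∈ sector d) :
    ‖t - ‖t‖ * d‖ ≤ 1 / 20 * ‖t‖ := by
  simp only [sector, mem_ofPred_eq] at ht
  set r := ‖t‖
  have hr : 0 ≤ r := norm_nonneg t
  have h2 : ‖t - r * d‖ ^ 2 = 2 * r ^ 2 - 2 * r * (starRingEnd ℂ d * t).re := by
    rw [← Complex.normSq_eq_norm_sq, Complex.normSq_sub, Complex.normSq_mul,
      Complex.normSq_ofReal, Complex.normSq_eq_norm_sq, Complex.normSq_eq_norm_sq, hd, map_mul,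
      Complex.conj_ofReal]
    have : t * (r * starRingEnd ℂ d) = r * (starRingEnd ℂ d * t) := by ring
    rw [this, Complex.re_ofReal_mul]
    simp only [r]; ring
  refine abs_le_of_sq_le_sq' ?_ (by positivity) |>.2
  -- The squared distance is at most 2r²(1 - 999/1000) = r²/500, which is below (r/20)².
  rw [h2]; nlinarith

/-- The cubic exponential decays like `e^{-7‖t‖³/25}` in the sectors where `i t³` is negative. -/
lemma norm_exp_cubic_le {d t : ℂ} (hd : ‖d‖ = 1) (hd3 : d ^ 3 = Complex.I) (ht : t ∈ sector d) :
    ‖Complex.exp (Complex.I * (t ^ 3 / 3))‖ ≤ Real.exp (-(7 / 25) * ‖t‖ ^ 3) := by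
  set r := ‖t‖
  have hr : 0 ≤ r := norm_nonneg t
  have h1 : ‖t - r * d‖ ≤ 1 / 20 * r := norm_sub_le_of_mem_sector hd ht
  have h3 : ‖t ^ 3 - (r * d) ^ 3‖ ≤ 3 / 20 * r ^ 3 := by
    have : t ^ 3 - (r * d) ^ 3 = (t - r * d) * (t ^ 2 + t * (r * d) + (r * d) ^ 2) := by ring
    rw [this, norm_mul]
    have h4 : ‖(r : ℂ) * d‖ = r := by simp [hd, abs_of_nonneg hr]
    have h5 : ‖t ^ 2 + t * (r * d) + (r * d) ^ 2‖ ≤ 3 * r ^ 2 := by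
      refine norm_add₃_le.trans ?_
      rw [norm_pow, norm_mul, norm_pow, h4]
      simp only [r]; nlinarith
    calc _ ≤ 1 / 20 * r * (3 * r ^ 2) := by gcongr
      _ = _ := by ring
  have h6 : (Complex.I * (t ^ 3 / 3)).re = -(r ^ 3 / 3) +
      (Complex.I * (t ^ 3 - (r * d) ^ 3) / 3).re := by
    rw [mul_pow, hd3]
    have : Complex.I * (t ^ 3 / 3) = ((-(r ^ 3 / 3) : ℝ) : ℂ) +
        Complex.I * (t ^ 3 - r ^ 3 * Complex.I) / 3 := by
      push_cast
      linear_combination (r : ℂ) ^ 3 / 3 * Complex.I_sq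
    rw [this, Complex.add_re, Complex.ofReal_re]
  have h7 : (Complex.I * (t ^ 3 - (r * d) ^ 3) / 3).re ≤ 1 / 20 * r ^ 3 := by
    refine (Complex.re_le_norm _).trans ?_
    rw [norm_div, norm_mul, Complex.norm_I, one_mul]
    norm_num
    linarith
  rw [Complex.norm_exp, h6]
  -- On the axis of the sector the exponent is -r³/3; leaving it costs at most r³/20, and 1/3 - 1/20
  -- = 17/60 > 7/25.
  apply Real.exp_le_exp.2
  nlinarith [pow_nonneg hr 3]

/-- A function that is `O(e^{4‖t‖³/27 + M(‖t‖² + ‖t‖)})` times the cubic exponential decays in the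
sectors where `i t³` is negative. -/
lemma sectorDecay_of_cubic {F : ℂ → ℂ} {d : ℂ} (hd : ‖d‖ = 1) (hd3 : d ^ 3 = Complex.I) {C M : ℝ}
    (hF : ∀ t, 1 ≤ ‖t‖ → ‖F t‖ ≤ C * Real.exp (4 / 27 * ‖t‖ ^ 3 + M * (‖t‖ ^ 2 + ‖t‖)) *
      ‖Complex.exp (Complex.I * (t ^ 3 / 3))‖) : SectorDecay F d := by
  refine ⟨2 * |C|, 1 + 16 * (|M| + 1), fun t ht hR => ?_⟩
  have hC : 0 ≤ |M| := abs_nonneg M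
  have h1 := norm_exp_cubic_le hd hd3 ht
  set r := ‖t‖
  have hr : 1 ≤ r := by linarith
  -- The margin 7/25 - 4/27 exceeds 1/8, and r³/8 ≥ 2(|M| + 1)r² because r ≥ 16(|M| + 1).
  have h2 : 4 / 27 * r ^ 3 + M * (r ^ 2 + r) + -(7 / 25) * r ^ 3 ≤ -r := by
    have : M * (r ^ 2 + r) ≤ |M| * (r ^ 2 + r ^ 2) := by
      refine (mul_le_mul_of_nonneg_right (le_abs_self M) (by positivity)).trans ?_
      gcongr; nlinarith
    have h3 : (16 * (|M| + 1)) * r ^ 2 ≤ r ^ 3 := by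
      nlinarith [pow_nonneg (zero_le_one.trans hr) 2]
    nlinarith
  calc ‖F t‖ ≤ |C| * Real.exp (4 / 27 * r ^ 3 + M * (r ^ 2 + r)) *
        Real.exp (-(7 / 25) * r ^ 3) := by
        refine (hF t hr).trans ?_
        gcongr
        exact le_abs_self C
    _ = |C| * Real.exp (4 / 27 * r ^ 3 + M * (r ^ 2 + r) + -(7 / 25) * r ^ 3) := by
        rw [mul_assoc, ← Real.exp_add]
    _ ≤ |C| * Real.exp (-r) := by gcongr
    _ ≤ |C| * (2 / r ^ 2) := by
        gcongr
        rw [Real.exp_neg, ← inv_div]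
        refine inv_anti₀ (by positivity) ?_
        linarith [Real.quadratic_le_exp_of_nonneg (zero_le_one.trans hr)]
    _ = _ := by ring

lemma exp_pi_six_pow : Complex.exp (Complex.I * (Real.pi / 6 : ℝ)) ^ 3 = Complex.I := by
  rw [← Complex.exp_nat_mul]
  have : ((3 : ℕ) : ℂ) * (Complex.I * (Real.pi / 6 : ℝ)) = Real.pi / 2 * Complex.I := by
    push_cast; ring
  rw [this, Complex.exp_pi_div_two_mul_I]

lemma exp_five_pi_six_pow : Complex.exp (Complex.I * (5 * Real.pi / 6 : ℝ)) ^ 3 = Complex.I := by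
  rw [← Complex.exp_nat_mul]
  have : ((3 : ℕ) : ℂ) * (Complex.I * (5 * Real.pi / 6 : ℝ)) =
      Real.pi / 2 * Complex.I + 2 * Real.pi * Complex.I := by push_cast; ring
  rw [this, Complex.exp_add, Complex.exp_pi_div_two_mul_I, Complex.exp_two_pi_mul_I, mul_one]

lemma exp_neg_pi_two : Complex.exp (Complex.I * (-(Real.pi / 2) : ℝ)) = -Complex.I := by
  have : Complex.I * (-(Real.pi / 2) : ℝ) = -(Real.pi / 2 * Complex.I) := by push_cast; ring
  rw [this, Complex.exp_neg, Complex.exp_pi_div_two_mul_I, Complex.inv_I]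

lemma exp_neg_pi_two_pow : Complex.exp (Complex.I * (-(Real.pi / 2) : ℝ)) ^ 3 = Complex.I := by
  rw [exp_neg_pi_two]
  linear_combination -Complex.I * Complex.I_sq

/-- The exponential of a cubic polynomial with leading term `i t³/3`. -/
def cubicExp (a b t : ℂ) : ℂ := Complex.exp (Complex.I * (t ^ 3 / 3 + a * t ^ 2 + b * t))

lemma cubicExp_eq (a b t : ℂ) : cubicExp a b t =
    Complex.exp (Complex.I * (a * t ^ 2 + b * t)) * Complex.exp (Complex.I * (t ^ 3 / 3)) := by
  rw [cubicExp, ← Complex.exp_add]; ring_nf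

lemma differentiable_cubicExp (a b : ℂ) : Differentiable ℂ (cubicExp a b) := by
  unfold cubicExp; fun_prop

lemma norm_exp_I_quadratic_le (a b t : ℂ) : ‖Complex.exp (Complex.I * (a * t ^ 2 + b * t))‖ ≤
    Real.exp ((‖a‖ + ‖b‖) * (‖t‖ ^ 2 + ‖t‖)) := by
  rw [Complex.norm_exp]
  apply Real.exp_le_exp.2
  refine (Complex.re_le_norm _).trans ?_
  rw [norm_mul, Complex.norm_I, one_mul]
  refine (norm_add_le _ _).trans ?_
  rw [norm_mul, norm_mul, norm_pow]
  nlinarith [mul_nonneg (norm_nonneg a) (norm_nonneg t),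
    mul_nonneg (norm_nonneg b) (sq_nonneg ‖t‖)]

/-- A function of growth `e^{4‖t‖³/27}` times a cubic exponential decays in the sectors where
`i t³` is negative. -/
lemma sectorDecay_mul_cubicExp {f : ℂ → ℂ} {d : ℂ} (hd : ‖d‖ = 1) (hd3 : d ^ 3 = Complex.I) {C : ℝ}
    (hf : ∀ t, 1 ≤ ‖t‖ → ‖f t‖ ≤ C * Real.exp (4 / 27 * ‖t‖ ^ 3)) (a b : ℂ) :
    SectorDecay (fun t => f t * cubicExp a b t) d := by
  refine sectorDecay_of_cubic hd hd3 (C := C) (M := ‖a‖ + ‖b‖) fun t ht => ?_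
  rw [cubicExp_eq, ← mul_assoc, norm_mul, norm_mul, Real.exp_add, ← mul_assoc]
  have h1 := hf t ht
  gcongr
  · exact (norm_nonneg _).trans h1
  · exact norm_exp_I_quadratic_le a b t

lemma sectorDecay_cubicExp {d : ℂ} (hd : ‖d‖ = 1) (hd3 : d ^ 3 = Complex.I) (a b : ℂ) :
    SectorDecay (cubicExp a b) d := by
  have := sectorDecay_mul_cubicExp hd hd3 (f := fun _ => 1) (C := 1) (fun t _ => by
    rw [norm_one, one_mul]; exact Real.one_le_exp (by positivity)) a b
  simpa using this

/-- On a ray where `i t³` is negative. -/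
lemma norm_cubicExp_ray_le {d : ℂ} (hd : ‖d‖ = 1) (hd3 : d ^ 3 = Complex.I) (a b : ℂ) {v : ℝ}
    (hv : 0 ≤ v) : ‖cubicExp a b (v * d)‖ ≤
      Real.exp ((‖a‖ + ‖b‖) * (v ^ 2 + v)) * Real.exp (-(v ^ 3 / 3)) := by
  have hn : ‖(v : ℂ) * d‖ = v := by simp [hd, abs_of_nonneg hv]
  rw [cubicExp_eq, norm_mul]
  have h1 := norm_exp_I_quadratic_le a b (v * d)
  rw [hn] at h1
  refine mul_le_mul h1 ?_ (norm_nonneg _) (Real.exp_nonneg _)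
  rw [mul_pow, hd3]
  have : Complex.I * (v ^ 3 * Complex.I / 3) = ((-(v ^ 3 / 3) : ℝ) : ℂ) := by
    push_cast; linear_combination (v : ℂ) ^ 3 / 3 * Complex.I_sq
  rw [this, Complex.norm_exp, Complex.ofReal_re]

/-! ### Integration along contours -/

/-- Local finiteness makes the break set closed, so a point off it has an interval free of breaks.
The result supplies what the fundamental theorem of calculus off a countable set requires. -/
lemma IsPiecewiseC1.exists_breaks {γ : ℝ → ℂ} (hγ : IsPiecewiseC1 γ) : ∃ P : Set ℝ,
    (∀ a b : ℝ, (P ∩ Icc a b).Finite) ∧ (∀ s ∉ P, DifferentiableAt ℝ γ s) ∧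
    ∀ a b : ℝ, a < b → Disjoint (Ioo a b) P → IntegrableOn (deriv γ) (Ioc a b) := by
  obtain ⟨-, P, hP, hC⟩ := hγ
  refine ⟨P, hP, fun s hs => ?_, fun a b hab hd => ?_⟩
  · have hfin := hP (s - 1) (s + 1)
    have h1 : ∀ᶠ t in 𝓝 s, t ∉ P ∩ Icc (s - 1) (s + 1) :=
      hfin.isClosed.isOpen_compl.mem_nhds fun h => hs h.1
    obtain ⟨ε, hε, hball⟩ := Metric.eventually_nhds_iff.1 h1
    set δ := min ε 1 with hδ
    have hδ0 : 0 < δ := lt_min hε one_pos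
    have hdis : Disjoint (Ioo (s - δ) (s + δ)) P := by
      rw [Set.disjoint_left]
      intro t ht htP
      have h2 : |t - s| < δ := abs_lt.2 ⟨by linarith [ht.1], by linarith [ht.2]⟩
      refine hball (by rw [Real.dist_eq]; exact h2.trans_le (min_le_left _ _)) ⟨htP, ?_⟩
      have := abs_lt.1 (h2.trans_le (min_le_right _ _))
      exact ⟨by linarith, by linarith⟩
    have := hC (s - δ) (s + δ) (by linarith) hdis
    exact (this.differentiableOn one_ne_zero).differentiableAt
      (Icc_mem_nhds (by linarith) (by linarith))
  · have h := hC a b hab hd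
    have h1 : ContinuousOn (derivWithin γ (Icc a b)) (Icc a b) :=
      h.continuousOn_derivWithin (uniqueDiffOn_Icc hab) le_rfl
    have h2 : IntegrableOn (derivWithin γ (Icc a b)) (Ioo a b) :=
      h1.integrableOn_Icc.mono_set Ioo_subset_Icc_self
    rw [integrableOn_Ioc_iff_integrableOn_Ioo]
    refine h2.congr_fun (fun s hs => ?_) measurableSet_Ioo
    exact derivWithin_of_mem_nhds (Icc_mem_nhds hs.1 hs.2)

/-- Around any `s`, itself possibly a break, there is no other break nearby, so the one-sided
intervals at `s` are treated separately. -/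
lemma IsPiecewiseC1.locallyIntegrable_deriv {γ : ℝ → ℂ} (hγ : IsPiecewiseC1 γ) :
    LocallyIntegrable (deriv γ) := by
  obtain ⟨P, hP, -, hC⟩ := hγ.exists_breaks
  intro s
  have hfin := (hP (s - 1) (s + 1)).sdiff (t := {s})
  have h1 : ∀ᶠ t in 𝓝 s, t ∉ (P ∩ Icc (s - 1) (s + 1)) \ {s} :=
    hfin.isClosed.isOpen_compl.mem_nhds fun h => h.2 rfl
  obtain ⟨ε, hε, hball⟩ := Metric.eventually_nhds_iff.1 h1
  set δ := min ε 1 with hδ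
  have hδ0 : 0 < δ := lt_min hε one_pos
  have key : ∀ t, |t - s| < δ → t ≠ s → t ∉ P := by
    intro t ht hts htP
    refine hball (by rw [Real.dist_eq]; exact ht.trans_le (min_le_left _ _)) ⟨⟨htP, ?_⟩, hts⟩
    have := abs_lt.1 (ht.trans_le (min_le_right _ _))
    exact ⟨by linarith, by linarith⟩
  have h2 := hC (s - δ) s (by linarith) (Set.disjoint_left.2 fun t ht =>
    key t (abs_lt.2 ⟨by linarith [ht.1], by linarith [ht.2]⟩) ht.2.ne)
  have h3 := hC s (s + δ) (by linarith) (Set.disjoint_left.2 fun t ht =>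
    key t (abs_lt.2 ⟨by linarith [ht.1], by linarith [ht.2]⟩) ht.1.ne')
  refine ⟨Ioc (s - δ) (s + δ), Ioc_mem_nhds (by linarith) (by linarith), ?_⟩
  rw [← Ioc_union_Ioc_eq_Ioc (b := s) (by linarith) (by linarith)]
  exact h2.union h3

lemma IsPiecewiseC1.intervalIntegrable_deriv {γ : ℝ → ℂ} (hγ : IsPiecewiseC1 γ) (a b : ℝ) :
    IntervalIntegrable (deriv γ) volume a b := by
  rw [intervalIntegrable_iff']
  exact hγ.locallyIntegrable_deriv.integrableOn_isCompact isCompact_uIcc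

/-- A continuous logarithm of a differentiable nonvanishing function is differentiable. -/
lemma hasDerivAt_of_exp_eq {γ L : ℝ → ℂ} (hL : Continuous L) (hexp : ∀ s, Complex.exp (L s) = γ s)
    {s : ℝ} {γ' : ℂ} (hγ : HasDerivAt γ γ' s) : HasDerivAt L (γ' / γ s) s := by
  have h0 : γ s ≠ 0 := by rw [← hexp]; exact Complex.exp_ne_zero _
  have h1 : HasDerivAt (fun u => γ u / γ s) (γ' / γ s) s := hγ.div_const _
  have h2 : HasDerivAt (fun u => Complex.log (γ u / γ s)) (γ' / γ s / (γ s / γ s)) s :=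
    h1.clog_real (by rw [div_self h0]; simp)
  rw [div_self h0, div_one] at h2
  refine (h2.add_const (L s)).congr_of_eventuallyEq ?_
  -- By continuity the imaginary part of L u - L s stays in (-π, π) near s, so L is there the
  -- principal logarithm of γ u / γ s plus a constant.
  have h3 : Tendsto (fun u => (L u - L s).im) (𝓝 s) (𝓝 0) := by
    have : ContinuousAt (fun u => (L u - L s).im) s := by fun_prop
    simpa [ContinuousAt] using this
  filter_upwards [h3.eventually (gt_mem_nhds Real.pi_pos),
    h3.eventually (lt_mem_nhds (neg_lt_zero.2 Real.pi_pos))] with u hu1 hu2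
  rw [← hexp u, ← hexp s, ← Complex.exp_sub, Complex.log_exp hu2 hu1.le]
  ring

lemma tendsto_sectorAtInfty_of_arg {γ : ℝ → ℂ} {θ : ℝ → ℝ} {l : Filter ℝ} {α : ℝ}
    (hγ : Tendsto (fun s => ‖γ s‖) l atTop)
    (hθ : ∀ s, γ s = ‖γ s‖ * Complex.exp (Complex.I * θ s)) (hα : Tendsto θ l (𝓝 α)) :
    Tendsto γ l (sectorAtInfty (Complex.exp (Complex.I * α))) := by
  rw [tendsto_sectorAtInfty]
  refine ⟨hγ, ?_⟩
  have h1 : Tendsto (fun s => Real.cos (θ s - α)) l (𝓝 1) := by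
    have : Tendsto (fun s => Real.cos (θ s - α)) l (𝓝 (Real.cos (α - α))) :=
      (Real.continuous_cos.tendsto _).comp (hα.sub_const α)
    simpa using this
  filter_upwards [h1.eventually (lt_mem_nhds (by norm_num : (999 / 1000 : ℝ) < 1)),
    hγ.eventually_gt_atTop 0] with s hs hs0
  have h2 : starRingEnd ℂ (Complex.exp (Complex.I * α)) * γ s =
      ‖γ s‖ * Complex.exp ((θ s - α : ℝ) * Complex.I) := by
    rw [← Complex.exp_conj, map_mul, Complex.conj_I, Complex.conj_ofReal]
    conv_lhs => rw [hθ s]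
    rw [mul_left_comm, ← Complex.exp_add]
    congr 2; push_cast; ring
  simp only [sector, mem_ofPred_eq]
  rw [h2, Complex.re_ofReal_mul, Complex.exp_ofReal_mul_I_re]
  nlinarith

/-- The contour integral of a function with a simple pole at the origin, through a primitive. -/
theorem hasContourIntegral_of_primitive {γ : ℝ → ℂ} (hγ : IsRightContour γ) {F G Φ : ℂ → ℂ} {c : ℂ}
    (hF : ∀ t ≠ 0, F t = c / t + G t) (hΦ : ∀ t, HasDerivAt Φ (G t) t) {K L : ℂ}
    (hK : Tendsto (fun t => Φ t + c * Complex.log t)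
      (sectorAtInfty (Complex.exp (Complex.I * (-(Real.pi / 2) : ℝ)))) (𝓝 K))
    (hL : Tendsto (fun t => Φ t + c * Complex.log t)
      (sectorAtInfty (Complex.exp (Complex.I * (5 * Real.pi / 6 : ℝ)))) (𝓝 L)) :
    HasContourIntegral F γ (L - K) := by
  obtain ⟨θ, hθc, hθ, hθ1, hθ2⟩ := hγ.exists_arg
  have hγc : Continuous γ := hγ.piecewiseC1.1
  have hn0 : ∀ s, ‖γ s‖ ≠ 0 := fun s => norm_ne_zero_iff.2 (hγ.ne_zero s)
  -- A logarithm continuous along the whole contour, which may cross the cut of the principal one or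
  -- wind around the origin on the way.
  set Λ : ℝ → ℂ := fun s => (Real.log ‖γ s‖ : ℝ) + Complex.I * θ s with hΛ
  have hΛc : Continuous Λ := by
    have : Continuous fun s => Real.log ‖γ s‖ := hγc.norm.log hn0
    fun_prop
  have hΛe : ∀ s, Complex.exp (Λ s) = γ s := by
    intro s
    rw [hΛ, Complex.exp_add, ← Complex.ofReal_exp, Real.exp_log (norm_pos_iff.2 (hγ.ne_zero s)),
      ← hθ s]
  set f : ℝ → ℂ := fun s => Φ (γ s) + c * Λ s with hf
  have hGc : Continuous G := by
    have h1 : Differentiable ℂ Φ := fun t => (hΦ t).differentiableAt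
    rw [← (funext fun t => (hΦ t).deriv : deriv Φ = G)]
    exact (h1.contDiff (n := 1)).continuous_deriv le_rfl
  have hΦc : Continuous Φ := continuous_iff_continuousAt.2 fun t => (hΦ t).continuousAt
  have hfc : Continuous f := by fun_prop
  have hFc : Continuous fun s => F (γ s) := by
    have : (fun s => F (γ s)) = fun s => c / γ s + G (γ s) :=
      funext fun s => hF _ (hγ.ne_zero s)
    rw [this]
    exact (continuous_const.div hγc hγ.ne_zero).add (hGc.comp hγc)
  have hint : ∀ a b : ℝ, IntervalIntegrable (fun s => F (γ s) * deriv γ s) volume a b := fun a b =>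
    (hγ.piecewiseC1.intervalIntegrable_deriv a b).continuousOn_mul hFc.continuousOn
  refine ⟨hint, ?_⟩
  obtain ⟨P, hP, hPd, -⟩ := hγ.piecewiseC1.exists_breaks
  have hftc : ∀ a b : ℝ, ∫ s in a..b, F (γ s) * deriv γ s = f b - f a := by
    intro a b
    refine integral_eq_of_hasDerivAt_off_countable f _
      (hP (min a b) (max a b)).countable hfc.continuousOn (fun s hs => ?_) (hint a b)
    have hsP : s ∉ P := fun h => hs.2 ⟨h, Ioo_subset_Icc_self hs.1⟩
    have h1 := (hPd s hsP).hasDerivAt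
    have h2 := ((hΦ (γ s)).comp s h1).add ((hasDerivAt_of_exp_eq hΛc hΛe h1).const_mul c)
    have h3 : F (γ s) * deriv γ s = G (γ s) * deriv γ s + c * (deriv γ s / γ s) := by
      rw [hF _ (hγ.ne_zero s)]; ring
    rw [h3]
    exact h2
  -- The limits of the argument lie in (-π, π), so Λ agrees with the principal logarithm at both
  -- ends. This is where passing to the right of the origin enters.
  have hend : ∀ {l : Filter ℝ} {α : ℝ} {N : ℂ}, -Real.pi < α → α < Real.pi →
      Tendsto (fun s => ‖γ s‖) l atTop → Tendsto θ l (𝓝 α) →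
      Tendsto (fun t => Φ t + c * Complex.log t) (sectorAtInfty (Complex.exp (Complex.I * α)))
        (𝓝 N) → Tendsto f l (𝓝 N) := by
    intro l α N h1 h2 h3 h4 h5
    refine (h5.comp (tendsto_sectorAtInfty_of_arg h3 hθ h4)).congr' ?_
    filter_upwards [h4.eventually (gt_mem_nhds h2), h4.eventually (lt_mem_nhds h1)] with s hs1 hs2
    have him : (Λ s).im = θ s := by simp [hΛ]
    have : Complex.log (γ s) = Λ s := by
      rw [← hΛe s, Complex.log_exp (by rw [him]; exact hs2) (by rw [him]; exact hs1.le)]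
    simp only [Function.comp_apply, hf, this]
  have hA := hend (by linarith [Real.pi_pos]) (by linarith [Real.pi_pos]) hγ.norm_atBot hθ1 hK
  have hB := hend (by linarith [Real.pi_pos]) (by linarith [Real.pi_pos]) hγ.norm_atTop hθ2 hL
  simp only [hftc]
  exact (hB.comp tendsto_snd).sub (hA.comp tendsto_fst)

/-! ### Integrals depending exponentially on a parameter -/

/-- `k e^{T‖w‖}` is integrable for all `T`. -/
def ExpIntegrable {α : Type*} [MeasurableSpace α] (μ : Measure α) (k w : α → ℂ) : Prop :=
  AEStronglyMeasurable k μ ∧ AEStronglyMeasurable w μ ∧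
    ∀ T : ℝ, Integrable (fun a => ‖k a‖ * Real.exp (T * ‖w a‖)) μ

namespace ExpIntegrable

variable {α : Type*} [MeasurableSpace α] {μ : Measure α} {k w : α → ℂ}

lemma norm_exp_mul_le (w z : ℂ) {T : ℝ} (hz : ‖z‖ ≤ T) :
    ‖Complex.exp (w * z)‖ ≤ Real.exp (T * ‖w‖) := by
  rw [Complex.norm_exp]
  apply Real.exp_le_exp.2
  refine (Complex.re_le_norm _).trans ?_
  rw [norm_mul, mul_comm]
  gcongr

lemma aestronglyMeasurable (h : ExpIntegrable μ k w) (z : ℂ) :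
    AEStronglyMeasurable (fun a => k a * Complex.exp (w a * z)) μ :=
  h.1.mul (Complex.continuous_exp.comp_aestronglyMeasurable (h.2.1.mul_const z))

lemma integrable (h : ExpIntegrable μ k w) (z : ℂ) :
    Integrable (fun a => k a * Complex.exp (w a * z)) μ := by
  refine (h.2.2 ‖z‖).mono' (h.aestronglyMeasurable z) (ae_of_all _ fun a => ?_)
  rw [norm_mul]
  gcongr
  exact norm_exp_mul_le _ _ le_rfl

lemma mul_right (h : ExpIntegrable μ k w) : ExpIntegrable μ (fun a => k a * w a) w := by
  refine ⟨h.1.mul h.2.1, h.2.1, fun T => ?_⟩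
  refine (h.2.2 (T + 1)).mono' ?_ (ae_of_all _ fun a => ?_)
  · exact (h.1.mul h.2.1).norm.mul
      (Real.continuous_exp.comp_aestronglyMeasurable (h.2.1.norm.const_mul T))
  · rw [Real.norm_of_nonneg (by positivity), norm_mul, mul_assoc]
    gcongr
    rw [add_mul, one_mul, Real.exp_add, mul_comm]
    gcongr
    linarith [Real.add_one_le_exp ‖w a‖]

lemma hasDerivAt (h : ExpIntegrable μ k w) (z : ℂ) :
    HasDerivAt (fun z => ∫ a, k a * Complex.exp (w a * z) ∂μ)
      (∫ a, k a * w a * Complex.exp (w a * z) ∂μ) z := by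
  refine (hasDerivAt_integral_of_dominated_loc_of_deriv_le
    (F' := fun z a => k a * w a * Complex.exp (w a * z))
    (bound := fun a => ‖k a * w a‖ * Real.exp ((‖z‖ + 1) * ‖w a‖))
    (Metric.ball_mem_nhds z one_pos) (Eventually.of_forall fun z => h.aestronglyMeasurable z)
    (h.integrable z) (h.mul_right.aestronglyMeasurable z) (ae_of_all _ fun a y hy => ?_)
    (h.mul_right.2.2 _) (ae_of_all _ fun a y _ => ?_)).2
  · rw [norm_mul]
    gcongr
    refine norm_exp_mul_le _ _ ?_
    rw [mem_ball_iff_norm] at hy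
    linarith [norm_sub_norm_le y z]
  · have h1 : HasDerivAt (fun x => w a * x) (w a) y := by
      simpa using (hasDerivAt_id y).const_mul (w a)
    have := (h1.cexp).const_mul (k a)
    rwa [mul_comm (Complex.exp _), ← mul_assoc] at this

end ExpIntegrable

/-! ### The Airy function -/

lemma airyAi_eq (z : ℂ) : airyAi z = 1 / (2 * Real.pi) *
    (rayIntegral (Real.pi / 6) (cubicExp 0 z) - rayIntegral (5 * Real.pi / 6) (cubicExp 0 z)) := by
  have : (fun t => Complex.exp (Complex.I * (t * z + t ^ 3 / 3))) = cubicExp 0 z := by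
    ext t; rw [cubicExp]; congr 1; ring
  rw [airyAi, this]

/-- The substitution t ↦ wt fixes t³ and turns the ray. -/
lemma rayIntegral_rotate {w z : ℂ} (hw : w ^ 3 = 1) {α β : ℝ}
    (h : Complex.exp (Complex.I * α) * w = Complex.exp (Complex.I * β)) :
    w * rayIntegral α (cubicExp 0 (w * z)) = rayIntegral β (cubicExp 0 z) := by
  rw [rayIntegral, rayIntegral, ← integral_const_mul]
  congr 1
  ext r
  rw [← h, ← mul_assoc (r : ℂ), mul_comm w, mul_assoc _ _ w]
  congr 1
  unfold cubicExp
  congr 2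
  rw [mul_pow _ w, hw]; ring

lemma exp_two_pi_div_three_pow : Complex.exp (2 * Real.pi * Complex.I / 3) ^ 3 = 1 := by
  rw [← Complex.exp_nat_mul, ← Complex.exp_two_pi_mul_I]; congr 1; push_cast; ring

lemma exp_neg_two_pi_div_three_pow : Complex.exp (-(2 * Real.pi * Complex.I / 3)) ^ 3 = 1 := by
  rw [Complex.exp_neg, inv_pow, exp_two_pi_div_three_pow, inv_one]

/-- Turning the Airy contour by 2π/3 makes it run from -i∞ to e^{5πi/6}∞, the ends of the contour in
the theorem. -/
lemma airyA1_eq (z : ℂ) : airyA1 z = 1 / (2 * Real.pi) *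
    (rayIntegral (5 * Real.pi / 6) (cubicExp 0 z) -
      rayIntegral (-(Real.pi / 2)) (cubicExp 0 z)) := by
  rw [airyA1, airyAi_eq, mul_left_comm, mul_sub,
    rayIntegral_rotate (β := 5 * Real.pi / 6) exp_two_pi_div_three_pow,
    rayIntegral_rotate (β := -(Real.pi / 2)) exp_two_pi_div_three_pow]
  · rw [← Complex.exp_add, Complex.exp_eq_exp_iff_exists_int]
    exact ⟨1, by push_cast; ring⟩
  · rw [← Complex.exp_add]; congr 1; push_cast; ring

lemma airyA2_eq (z : ℂ) : airyA2 z = 1 / (2 * Real.pi) *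
    (rayIntegral (-(Real.pi / 2)) (cubicExp 0 z) - rayIntegral (Real.pi / 6) (cubicExp 0 z)) := by
  rw [airyA2, airyAi_eq, mul_left_comm, mul_sub,
    rayIntegral_rotate (β := -(Real.pi / 2)) exp_neg_two_pi_div_three_pow,
    rayIntegral_rotate (β := Real.pi / 6) exp_neg_two_pi_div_three_pow]
  · rw [← Complex.exp_add]; congr 1; push_cast; ring
  · rw [← Complex.exp_add]; congr 1; push_cast; ring

/-- The linear relation between the three Airy functions. -/
lemma airyA0_add_airyA1_add_airyA2 (z : ℂ) : airyA0 z + airyA1 z + airyA2 z = 0 := by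
  rw [airyA0, airyAi_eq, airyA1_eq, airyA2_eq]; ring

/-- The integrand of the Airy integral along a line parallel to the real axis. -/
lemma norm_cubicExp_line (z : ℂ) (a b : ℝ) : ‖cubicExp 0 z (a + b * Complex.I)‖ =
    Real.exp (-(a ^ 2 * b) + b ^ 3 / 3 - a * z.im - b * z.re) := by
  rw [cubicExp, Complex.norm_exp]
  congr 1
  have h : Complex.I * ((a + b * Complex.I) ^ 3 / 3 + 0 * (a + b * Complex.I) ^ 2 +
      z * (a + b * Complex.I)) = ((-(a ^ 2 * b) + b ^ 3 / 3 : ℝ) : ℂ) +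
        ((a ^ 3 / 3 - a * b ^ 2 : ℝ) : ℂ) * Complex.I + z * ((a : ℂ) * Complex.I - b) := by
    push_cast
    linear_combination ((a : ℂ) ^ 2 * b + z * b + a * b ^ 2 * Complex.I +
      (b : ℂ) ^ 3 / 3 * (Complex.I ^ 2 - 1)) * Complex.I_sq
  rw [h, Complex.add_re, Complex.add_re, Complex.ofReal_re, Complex.re_ofReal_mul, Complex.mul_re]
  simp
  ring

lemma integrable_cubicExp_line (z : ℂ) {b : ℝ} (hb : 0 < b) :
    Integrable fun s : ℝ => cubicExp 0 z (s + b * Complex.I) := by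
  have h1 : Integrable fun s : ℝ => Real.exp (b ^ 3 / 3 - b * z.re + z.im ^ 2 / (2 * b)) *
      Real.exp (-(b / 2) * s ^ 2) := (integrable_exp_neg_mul_sq (by positivity)).const_mul _
  refine h1.mono' ?_ (ae_of_all _ fun s => ?_)
  · exact (((differentiable_cubicExp 0 z).continuous).comp (by fun_prop)).aestronglyMeasurable
  · rw [norm_cubicExp_line, ← Real.exp_add]
    apply Real.exp_le_exp.2
    have : 0 ≤ (b * s + z.im) ^ 2 / (2 * b) := by positivity
    have h2 : (b * s + z.im) ^ 2 / (2 * b) = b / 2 * s ^ 2 + s * z.im + z.im ^ 2 / (2 * b) := by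
      field_simp
      ring
    linarith

lemma exp_pi_six : Complex.exp (Complex.I * (Real.pi / 6 : ℝ)) =
    (√3 * (1 : ℝ) + Complex.I) / 2 := by
  rw [mul_comm, Complex.exp_mul_I, ← Complex.ofReal_cos, ← Complex.ofReal_sin, Real.cos_pi_div_six,
    Real.sin_pi_div_six]
  push_cast; ring

lemma exp_five_pi_six : Complex.exp (Complex.I * (5 * Real.pi / 6 : ℝ)) =
    (√3 * (-1 : ℝ) + Complex.I) / 2 := by
  have h : 5 * Real.pi / 6 = Real.pi - Real.pi / 6 := by ring
  rw [mul_comm, Complex.exp_mul_I, ← Complex.ofReal_cos, ← Complex.ofReal_sin, h, Real.cos_pi_sub,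
    Real.sin_pi_sub, Real.cos_pi_div_six, Real.sin_pi_div_six]
  push_cast; ring

/-- The ends of a horizontal line in the upper half plane are equivalent to those of the rays. -/
lemma tendsto_primitive_line {z : ℂ} {Φ : ℂ → ℂ} (hΦ : ∀ t, HasDerivAt Φ (cubicExp 0 z t) t)
    {ε : ℝ} (hε : ε = 1 ∨ ε = -1) {L : ℂ} {b : ℝ} (hb : 0 < b)
    (hd : ‖(√3 * ε + Complex.I : ℂ) / 2‖ = 1)
    (hL : Tendsto Φ (sectorAtInfty ((√3 * ε + Complex.I) / 2)) (𝓝 L)) :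
    Tendsto (fun s : ℝ => Φ ((ε * s : ℝ) + b * Complex.I)) atTop (𝓝 L) := by
  have h3 : (0 : ℝ) < √3 := by positivity
  have h3sq : √3 ^ 2 = 3 := Real.sq_sqrt (by norm_num)
  have h31 : 1 ≤ √3 := Real.one_le_sqrt.2 (by norm_num)
  -- The point of the ray with real part εs has height s/√3; it is compared below with the point of
  -- the line on the same vertical.
  have h1 : Tendsto (fun s : ℝ => Φ ((ε * s : ℝ) + (s / √3 : ℝ) * Complex.I)) atTop (𝓝 L) := by
    have h2 : Tendsto (fun s : ℝ => 2 / √3 * s) atTop atTop :=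
      tendsto_id.const_mul_atTop (by positivity)
    have h4 := hL.comp ((tendsto_ray_sectorAtInfty hd 0).comp h2)
    refine h4.congr fun s => ?_
    simp only [Function.comp_apply, zero_add]
    congr 1
    have : (√3 : ℂ) ≠ 0 := by exact_mod_cast h3.ne'
    push_cast
    field_simp
  have h5 : Tendsto (fun s : ℝ => Φ ((ε * s : ℝ) + b * Complex.I) -
      Φ ((ε * s : ℝ) + (s / √3 : ℝ) * Complex.I)) atTop (𝓝 0) := by
    have hbound : ∀ᶠ s : ℝ in atTop, ‖Φ ((ε * s : ℝ) + b * Complex.I) -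
        Φ ((ε * s : ℝ) + (s / √3 : ℝ) * Complex.I)‖ ≤ Real.exp (-s) * s := by
      filter_upwards [eventually_ge_atTop (√3 * b), eventually_ge_atTop (3 / b * (‖z‖ + 1)),
        eventually_gt_atTop 0] with s hs1 hs2 hs0
      have hbs : b ≤ s / √3 := by rw [le_div_iff₀ h3]; linarith
      have hder : ∀ η ∈ Icc b (s / √3), HasDerivWithinAt
          (fun η : ℝ => Φ ((ε * s : ℝ) + η * Complex.I))
          (cubicExp 0 z ((ε * s : ℝ) + η * Complex.I) * Complex.I) (Icc b (s / √3)) η := by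
        intro η _
        have h6 : HasDerivAt (fun η : ℝ => ((ε * s : ℝ) : ℂ) + η * Complex.I) Complex.I η := by
          simpa using ((Complex.ofRealCLM.hasDerivAt (x := η)).mul_const Complex.I).const_add
            ((ε * s : ℝ) : ℂ)
        exact ((hΦ _).comp η h6).hasDerivWithinAt
      -- For η ≤ s the exponent -s²η + η³/3 is at most -2s²b/3. Since sb ≥ 3(‖z‖ + 1), this absorbs
      -- the linear terms, of size 2s‖z‖, and leaves at most -s.
      have hbd : ∀ η ∈ Icc b (s / √3),
          ‖cubicExp 0 z ((ε * s : ℝ) + η * Complex.I) * Complex.I‖ ≤ Real.exp (-s) := by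
        intro η ⟨hη1, hη2⟩
        have hη0 : 0 < η := hb.trans_le hη1
        have hηs : η ≤ s := hη2.trans (div_le_self hs0.le h31)
        rw [norm_mul, Complex.norm_I, mul_one, norm_cubicExp_line]
        apply Real.exp_le_exp.2
        have e1 : (ε * s) ^ 2 = s ^ 2 := by rcases hε with rfl | rfl <;> ring
        have e2 : -(ε * s * z.im) ≤ s * ‖z‖ := by
          have h7 := Complex.abs_im_le_norm z
          have h8 := abs_le.1 h7
          rcases hε with rfl | rfl <;> nlinarith
        have e3 : -(η * z.re) ≤ s * ‖z‖ := by
          have h8 := abs_le.1 (Complex.abs_re_le_norm z)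
          nlinarith [norm_nonneg z]
        have e4 : η ^ 3 / 3 ≤ s ^ 2 * η / 3 := by
          have : η ^ 2 ≤ s ^ 2 := by gcongr
          nlinarith
        have e5 : s ^ 2 * b ≤ s ^ 2 * η := by gcongr
        have e6 : 3 * (‖z‖ + 1) ≤ s * b := by
          rw [div_mul_eq_mul_div, div_le_iff₀ hb] at hs2; linarith
        rw [e1]
        nlinarith
      have := (convex_Icc b (s / √3)).norm_image_sub_le_of_norm_hasDerivWithin_le hder hbd
        (right_mem_Icc.2 hbs) (left_mem_Icc.2 hbs)
      refine this.trans ?_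
      gcongr
      rw [Real.norm_eq_abs, abs_sub_comm, abs_of_nonneg (by linarith)]
      have := div_le_self hs0.le h31
      linarith
    refine squeeze_zero_norm' hbound ?_
    have := Real.tendsto_pow_mul_exp_neg_atTop_nhds_zero 1
    refine this.congr fun s => ?_
    rw [pow_one, mul_comm]
  simpa using h5.add h1

/-- The Airy function as an integral along a horizontal line in the upper half plane. -/
theorem airyAi_eq_integral_line (z : ℂ) {b : ℝ} (hb : 0 < b) : airyAi z =
    1 / (2 * Real.pi) * ∫ s : ℝ, cubicExp 0 z (s + b * Complex.I) := by
  obtain ⟨Φ, hΦ⟩ := (differentiable_cubicExp 0 z).isExactOn_univ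
  replace hΦ : ∀ t, HasDerivAt Φ (cubicExp 0 z t) t := fun t => hΦ t (mem_univ t)
  have h1 := (tendsto_primitive_rayIntegral
    (sectorDecay_cubicExp (norm_exp_I_mul _) exp_pi_six_pow 0 z) hΦ).2
  have h2 := (tendsto_primitive_rayIntegral
    (sectorDecay_cubicExp (norm_exp_I_mul _) exp_five_pi_six_pow 0 z) hΦ).2
  have n1 := norm_exp_I_mul (Real.pi / 6)
  have n2 := norm_exp_I_mul (5 * Real.pi / 6)
  rw [exp_pi_six] at h1 n1
  rw [exp_five_pi_six] at h2 n2
  have t1 := tendsto_primitive_line hΦ (Or.inl rfl) hb n1 h1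
  have t2 := (tendsto_primitive_line hΦ (Or.inr rfl) hb n2 h2).comp tendsto_neg_atBot_atTop
  have hder : ∀ s : ℝ, HasDerivAt (fun s : ℝ => Φ (s + b * Complex.I))
      (cubicExp 0 z (s + b * Complex.I)) s := by
    intro s
    have h6 : HasDerivAt (fun s : ℝ => (s : ℂ) + b * Complex.I) 1 s := by
      simpa using (Complex.ofRealCLM.hasDerivAt (x := s)).add_const (b * Complex.I)
    have := (hΦ _).comp s h6
    rw [mul_one] at this
    exact this
  have := integral_of_hasDerivAt_of_tendsto hder (integrable_cubicExp_line z hb)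
    (m := Φ 0 + rayIntegral (5 * Real.pi / 6) (cubicExp 0 z))
    (n := Φ 0 + rayIntegral (Real.pi / 6) (cubicExp 0 z))
    (t2.congr fun s => by simp) (t1.congr fun s => by simp)
  rw [this, airyAi_eq]
  ring

/-! ### Asymptotics of the Airy function -/

/-- The integrand of the Airy integral along the line through the saddle point. -/
def airyKernel (β δ : ℂ) (s : ℝ) : ℂ :=
  Complex.exp (-β * s ^ 2 + Complex.I * (s ^ 3 / 3) + Complex.I * s * δ)

lemma continuous_airyKernel (β δ : ℂ) : Continuous (airyKernel β δ) := by
  unfold airyKernel; fun_prop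

/-- The Airy function in terms of the integral through the saddle point. -/
theorem airyAi_eq_airyKernel {β : ℂ} (hβ : 0 < β.re) (δ : ℂ) : airyAi (β ^ 2 + δ) =
    1 / (2 * Real.pi) * (Complex.exp (-(2 / 3 * β ^ 3 + β * δ)) * ∫ s : ℝ, airyKernel β δ s) := by
  rw [airyAi_eq_integral_line _ hβ]
  congr 1
  -- The line at height Re β passes through the saddle point t = iβ of t³/3 + β²t; translating s by
  -- Im β centres the parametrization there.
  rw [← integral_const_mul,
    ← integral_sub_right_eq_self (fun s : ℝ => cubicExp 0 (β ^ 2 + δ) (s + β.re * Complex.I)) β.im]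
  congr 1
  ext s
  have h : ((s - β.im : ℝ) : ℂ) + β.re * Complex.I = s + Complex.I * β := by
    conv_rhs => rw [← Complex.re_add_im β]
    push_cast
    linear_combination -(β.im : ℂ) * Complex.I_sq
  rw [h, cubicExp, airyKernel, ← Complex.exp_add]
  congr 1
  linear_combination (s ^ 2 * β + s * β ^ 2 * Complex.I + β ^ 3 / 3 * (Complex.I ^ 2 - 1) +
    β * (β ^ 2 + δ)) * Complex.I_sq

/-- The cubic term has modulus one. Half of the Gaussian absorbs the term in δ, by completing the
square. -/
lemma norm_airyKernel_le {β : ℂ} (hβ : 0 < β.re) (δ : ℂ) (s : ℝ) : ‖airyKernel β δ s‖ ≤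
    Real.exp (‖δ‖ ^ 2 / (2 * β.re)) * Real.exp (-(β.re / 2) * s ^ 2) := by
  rw [airyKernel, Complex.norm_exp, ← Real.exp_add]
  apply Real.exp_le_exp.2
  have h1 : (-β * s ^ 2 + Complex.I * (s ^ 3 / 3) + Complex.I * s * δ).re =
      -(β.re * s ^ 2) - s * δ.im := by
    have h2 : -β * s ^ 2 + Complex.I * (s ^ 3 / 3) + Complex.I * s * δ =
        ((s ^ 2 : ℝ) : ℂ) * (-β) + ((s ^ 3 / 3 : ℝ) : ℂ) * Complex.I +
          (s : ℂ) * (Complex.I * δ) := by push_cast; ring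
    rw [h2, Complex.add_re, Complex.add_re, Complex.re_ofReal_mul, Complex.re_ofReal_mul,
      Complex.re_ofReal_mul, Complex.I_mul_re, Complex.I_re, Complex.neg_re]
    ring
  have h3 : -(s * δ.im) ≤ |s| * ‖δ‖ := by
    refine (neg_le_abs _).trans ?_
    rw [abs_mul]
    gcongr
    exact Complex.abs_im_le_norm δ
  have h4 : (β.re * |s| - ‖δ‖) ^ 2 / (2 * β.re) =
      β.re / 2 * s ^ 2 - |s| * ‖δ‖ + ‖δ‖ ^ 2 / (2 * β.re) := by
    rw [← sq_abs s]; field_simp; ring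
  have h5 : 0 ≤ (β.re * |s| - ‖δ‖) ^ 2 / (2 * β.re) := by positivity
  rw [h1]
  linarith

lemma integrable_airyKernel {β : ℂ} (hβ : 0 < β.re) (δ : ℂ) : Integrable (airyKernel β δ) :=
  ((integrable_exp_neg_mul_sq (by positivity)).const_mul _).mono'
    (continuous_airyKernel β δ).aestronglyMeasurable (ae_of_all _ (norm_airyKernel_le hβ δ))

/-- Upper bound of the Airy function near the square of a point of the right half plane. -/
theorem norm_airyAi_le {β : ℂ} (hβ : 0 < β.re) (δ : ℂ) : ‖airyAi (β ^ 2 + δ)‖ ≤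
    Real.exp (‖δ‖ ^ 2 / (2 * β.re)) / √β.re * Real.exp (-(2 / 3 * β ^ 3 + β * δ).re) := by
  have hπ := Real.pi_gt_three
  have h1 : ‖∫ s : ℝ, airyKernel β δ s‖ ≤
      Real.exp (‖δ‖ ^ 2 / (2 * β.re)) * √(Real.pi / (β.re / 2)) := by
    refine (norm_integral_le_of_norm_le ((integrable_exp_neg_mul_sq (by positivity)).const_mul _)
      (ae_of_all _ (norm_airyKernel_le hβ δ))).trans ?_
    rw [integral_const_mul, integral_gaussian]
  rw [airyAi_eq_airyKernel hβ, norm_mul, norm_mul, Complex.norm_exp, ← Complex.neg_re]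
  have h2 : ‖(1 / (2 * Real.pi) : ℂ)‖ = 1 / (2 * Real.pi) := by
    rw [norm_div, norm_mul]; simp [abs_of_pos Real.pi_pos]
  have h3 : √(Real.pi / (β.re / 2)) ≤ 2 * Real.pi / √β.re := by
    rw [show Real.pi / (β.re / 2) = 2 * Real.pi / β.re by field_simp, Real.sqrt_div (by positivity)]
    gcongr
    rw [Real.sqrt_le_left (by positivity)]
    nlinarith
  rw [h2]
  calc _ ≤ 1 / (2 * Real.pi) * (Real.exp (-(2 / 3 * β ^ 3 + β * δ)).re *
        (Real.exp (‖δ‖ ^ 2 / (2 * β.re)) * (2 * Real.pi / √β.re))) := by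
        gcongr
        exact h1.trans (by gcongr)
    _ = _ := by field_simp

lemma norm_gaussian_integral {β : ℂ} (hβ : 0 < β.re) :
    ‖∫ s : ℝ, Complex.exp (-β * s ^ 2)‖ = √Real.pi / √‖β‖ := by
  rw [integral_gaussian_complex hβ]
  have h1 : ‖((Real.pi : ℂ) / β) ^ (1 / 2 : ℂ)‖ ^ 2 = Real.pi / ‖β‖ := by
    have : (((Real.pi : ℂ) / β) ^ (1 / 2 : ℂ)) ^ 2 = Real.pi / β := by
      rw [← Complex.cpow_nat_mul]; norm_num
    rw [← norm_pow, this, norm_div]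
    simp [abs_of_pos Real.pi_pos]
  rw [← Real.sqrt_div Real.pi_pos.le, ← h1, Real.sqrt_sq (norm_nonneg _)]

/-- Lower bound of the Airy function in the sector `|arg z| ≤ 2π/3`. -/
theorem le_norm_airyAi {β : ℂ} (hβ : ‖β‖ ≤ 2 * β.re) (hβ4 : 4 ≤ ‖β‖) :
    1 / (8 * √‖β‖) * Real.exp (-(2 / 3 * β ^ 3).re) ≤ ‖airyAi (β ^ 2)‖ := by
  have hb : 0 < β.re := by linarith
  have hπ := Real.pi_gt_three
  have hβ0 : 0 < ‖β‖ := by linarith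
  have hg : Integrable fun s : ℝ => Complex.exp (-β * s ^ 2) := integrable_cexp_neg_mul_sq hb
  -- The main term is the Gaussian integral, known exactly; replacing e^{is³/3} by 1 costs at most
  -- |s|³/3 pointwise.
  have hdiff : ‖(∫ s : ℝ, airyKernel β 0 s) - ∫ s : ℝ, Complex.exp (-β * s ^ 2)‖ ≤
      2 / 3 * (1 / √β.re) ^ 3 * √(Real.pi / (β.re / 2)) := by
    rw [← integral_sub (integrable_airyKernel hb 0) hg, ← integral_gaussian, ← integral_const_mul]
    refine norm_integral_le_of_norm_le ((integrable_exp_neg_mul_sq (by positivity)).const_mul _)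
      (ae_of_all _ fun s => ?_)
    have h1 : airyKernel β 0 s - Complex.exp (-β * s ^ 2) =
        Complex.exp (-β * s ^ 2) * (Complex.exp (Complex.I * (s ^ 3 / 3 : ℝ)) - 1) := by
      rw [airyKernel, mul_zero, add_zero, Complex.exp_add]; push_cast; ring
    have h2 : ‖Complex.exp (-β * s ^ 2)‖ = Real.exp (-(β.re * s ^ 2)) := by
      rw [Complex.norm_exp]; congr 1
      rw [mul_comm, ← Complex.ofReal_pow, Complex.re_ofReal_mul, Complex.neg_re]; ring
    have h3 : ‖Complex.exp (Complex.I * (s ^ 3 / 3 : ℝ)) - 1‖ ≤ |s| ^ 3 / 3 := by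
      refine (Real.norm_exp_I_mul_ofReal_sub_one_le).trans ?_
      rw [Real.norm_eq_abs, abs_div, abs_pow, abs_of_pos (by norm_num : (0 : ℝ) < 3)]
    set y := √β.re * |s| with hy
    have hy0 : 0 ≤ y := by positivity
    have hy2 : y ^ 2 = β.re * s ^ 2 := by rw [hy, mul_pow, Real.sq_sqrt hb.le, sq_abs]
    -- Half of the Gaussian pays for the cubic factor; the other half remains to be integrated.
    have h4 : y ^ 3 ≤ 2 * Real.exp (y ^ 2 / 2) := by
      have := Real.quadratic_le_exp_of_nonneg (by positivity : 0 ≤ y ^ 2 / 2)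
      nlinarith [sq_nonneg (y ^ 2 / 2 - y), sq_nonneg y]
    have h5 : |s| ^ 3 = (1 / √β.re) ^ 3 * y ^ 3 := by
      rw [hy]; field_simp
    rw [h1, norm_mul, h2]
    calc _ ≤ Real.exp (-(β.re * s ^ 2)) * (|s| ^ 3 / 3) := by gcongr
      _ ≤ Real.exp (-(β.re * s ^ 2)) * ((1 / √β.re) ^ 3 * (2 * Real.exp (y ^ 2 / 2)) / 3) := by
        rw [h5]; gcongr
      _ = 2 / 3 * (1 / √β.re) ^ 3 * (Real.exp (-(β.re * s ^ 2)) * Real.exp (y ^ 2 / 2)) := by ring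
      _ = _ := by
        rw [← Real.exp_add, hy2]
        congr 2; ring
  -- With Re β ≥ ‖β‖/2 the error is at most 8/‖β‖^{3/2} times half the main term, and ‖β‖ ≥ 4 makes
  -- this factor at most 1.
  have hsmall : 2 / 3 * (1 / √β.re) ^ 3 * √(Real.pi / (β.re / 2)) ≤ √Real.pi / √‖β‖ / 2 := by
    rw [show Real.pi / (β.re / 2) = 2 * Real.pi / β.re by field_simp, Real.sqrt_div (by positivity),
      Real.sqrt_mul (by norm_num)]
    have h1 : (1 / √β.re) ^ 3 * (√2 * √Real.pi / √β.re) = √2 * √Real.pi / β.re ^ 2 := by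
      have : β.re ^ 2 = √β.re ^ 4 := by
        rw [show √β.re ^ 4 = (√β.re ^ 2) ^ 2 by ring, Real.sq_sqrt hb.le]
      rw [this]; field_simp
    rw [mul_assoc, h1]
    have h2 : ‖β‖ ^ 2 / 4 ≤ β.re ^ 2 := by nlinarith
    have h3 : 2 ≤ √‖β‖ := Real.le_sqrt_of_sq_le (by linarith)
    have h4 : ‖β‖ ^ 2 = √‖β‖ ^ 4 := by
      rw [show √‖β‖ ^ 4 = (√‖β‖ ^ 2) ^ 2 by ring, Real.sq_sqrt hβ0.le]
    have h5 : √2 ≤ 3 / 2 := Real.sqrt_le_iff.2 (by norm_num)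
    have h6 : (8 : ℝ) ≤ √‖β‖ ^ 3 := by
      calc (8 : ℝ) = 2 ^ 3 := by norm_num
        _ ≤ _ := by gcongr
    calc 2 / 3 * (√2 * √Real.pi / β.re ^ 2) ≤ 2 / 3 * (3 / 2 * √Real.pi / (‖β‖ ^ 2 / 4)) := by
          gcongr
      _ = √Real.pi / √‖β‖ / 2 * (8 / √‖β‖ ^ 3) := by rw [h4]; field_simp; ring
      _ ≤ √Real.pi / √‖β‖ / 2 * 1 := by
        gcongr; exact (div_le_one (by positivity)).2 h6
      _ = _ := mul_one _
  have hmain : √Real.pi / √‖β‖ / 2 ≤ ‖∫ s : ℝ, airyKernel β 0 s‖ := by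
    have h1 := norm_sub_norm_le (∫ s : ℝ, Complex.exp (-β * s ^ 2)) (∫ s : ℝ, airyKernel β 0 s)
    rw [norm_gaussian_integral hb, norm_sub_rev] at h1
    linarith
  have h0 := airyAi_eq_airyKernel hb 0
  rw [add_zero, mul_zero, add_zero] at h0
  rw [h0, norm_mul, norm_mul, Complex.norm_exp, Complex.neg_re]
  have h2 : ‖(1 / (2 * Real.pi) : ℂ)‖ = 1 / (2 * Real.pi) := by
    rw [norm_div, norm_mul]; simp [abs_of_pos Real.pi_pos]
  rw [h2]
  have h7 : √Real.pi ≤ 2 := by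
    rw [Real.sqrt_le_left (by norm_num)]; linarith [Real.pi_lt_four]
  have h8 : 1 / (8 * √‖β‖) ≤ 1 / (2 * Real.pi) * (√Real.pi / √‖β‖ / 2) := by
    have : Real.pi = √Real.pi ^ 2 := (Real.sq_sqrt Real.pi_pos.le).symm
    have hs : 0 < √Real.pi := Real.sqrt_pos.2 Real.pi_pos
    have h9 : 1 / (2 * Real.pi) * (√Real.pi / √‖β‖ / 2) = 1 / (4 * √Real.pi * √‖β‖) := by
      nth_rewrite 1 [this]; field_simp; ring
    rw [h9]
    gcongr
    linarith
  calc _ ≤ 1 / (2 * Real.pi) * (√Real.pi / √‖β‖ / 2) * Real.exp (-(2 / 3 * β ^ 3).re) := by gcongr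
    _ = 1 / (2 * Real.pi) * (Real.exp (-(2 / 3 * β ^ 3).re) * (√Real.pi / √‖β‖ / 2)) := by ring
    _ ≤ _ := by gcongr

/-! ### The Airy equation and the zeros of the Airy function -/

/-- The exponent of the Airy integral along the line `Im t = 1`. -/
def airyExponent (s : ℝ) : ℂ := Complex.I * (s + Complex.I)

/-- The weight of the Airy integral along the line `Im t = 1`. -/
def airyWeight (s : ℝ) : ℂ := cubicExp 0 0 (s + (1 : ℝ) * Complex.I)

lemma airyWeight_mul_exp (z : ℂ) (s : ℝ) : airyWeight s * Complex.exp (airyExponent s * z) =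
    cubicExp 0 z (s + (1 : ℝ) * Complex.I) := by
  rw [airyWeight, airyExponent, cubicExp, cubicExp, ← Complex.exp_add]
  congr 1; push_cast; ring

lemma expIntegrable_airyWeight : ExpIntegrable volume airyWeight airyExponent := by
  have hc1 : Continuous airyWeight :=
    (differentiable_cubicExp 0 0).continuous.comp (by fun_prop)
  have hc2 : Continuous airyExponent := by unfold airyExponent; fun_prop
  refine ⟨hc1.aestronglyMeasurable, hc2.aestronglyMeasurable, fun T => ?_⟩
  refine ((integrable_exp_neg_mul_sq (b := 1 / 2) (by norm_num)).const_mul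
    (Real.exp (1 / 3 + |T| + |T| ^ 2 / 2))).mono' (by fun_prop) (ae_of_all _ fun s => ?_)
  rw [Real.norm_of_nonneg (by positivity), airyWeight, norm_cubicExp_line, ← Real.exp_add,
    ← Real.exp_add]
  apply Real.exp_le_exp.2
  have h1 : ‖airyExponent s‖ ≤ |s| + 1 := by
    rw [airyExponent, norm_mul, Complex.norm_I, one_mul]
    refine (norm_add_le _ _).trans ?_
    simp
  have h2 : T * ‖airyExponent s‖ ≤ |T| * (|s| + 1) :=
    (mul_le_mul_of_nonneg_right (le_abs_self T) (norm_nonneg _)).trans (by gcongr)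
  simp only [Complex.zero_im, Complex.zero_re]
  nlinarith [sq_nonneg (|T| - |s|), sq_abs s]

/-- The derivative of the Airy function. -/
def airyAiDeriv (z : ℂ) : ℂ :=
  1 / (2 * Real.pi) * ∫ s, airyWeight s * airyExponent s * Complex.exp (airyExponent s * z)

lemma airyAi_eq_weight (z : ℂ) : airyAi z =
    1 / (2 * Real.pi) * ∫ s, airyWeight s * Complex.exp (airyExponent s * z) := by
  simp only [airyWeight_mul_exp]
  exact airyAi_eq_integral_line z one_pos

lemma hasDerivAt_airyAi (z : ℂ) : HasDerivAt airyAi (airyAiDeriv z) z := by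
  rw [funext airyAi_eq_weight]
  exact (expIntegrable_airyWeight.hasDerivAt z).const_mul _

lemma differentiable_airyAi : Differentiable ℂ airyAi := fun z =>
  (hasDerivAt_airyAi z).differentiableAt

/-- The Airy equation. -/
theorem hasDerivAt_airyAiDeriv (z : ℂ) : HasDerivAt airyAiDeriv (z * airyAi z) z := by
  have h1 := (expIntegrable_airyWeight.mul_right.hasDerivAt z).const_mul (1 / (2 * Real.pi) : ℂ)
  have i1 := expIntegrable_airyWeight.integrable z
  have i2 := expIntegrable_airyWeight.mul_right.mul_right.integrable z
  -- With t = s + i the derivative is i(z + t²) times the integrand, and `airyExponent s ^ 2` = -t².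
  -- Its integral vanishes, which is the Airy equation.
  have hder : ∀ s : ℝ, HasDerivAt (fun s : ℝ => airyWeight s * Complex.exp (airyExponent s * z))
      (Complex.I * (z * (airyWeight s * Complex.exp (airyExponent s * z)) -
        airyWeight s * airyExponent s * airyExponent s * Complex.exp (airyExponent s * z))) s := by
    intro s
    simp only [airyWeight_mul_exp]
    have h2 : HasDerivAt (fun t : ℂ => cubicExp 0 z (t + (1 : ℝ) * Complex.I))
        (cubicExp 0 z (s + (1 : ℝ) * Complex.I) *
          (Complex.I * ((s + (1 : ℝ) * Complex.I) ^ 2 + z))) s := by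
      have h3 : HasDerivAt (fun t : ℂ => t + (1 : ℝ) * Complex.I) 1 s :=
        (hasDerivAt_id _).add_const _
      have h4 := (((h3.pow 3).div_const 3).add
        (((h3.pow 2).const_mul 0).add (h3.const_mul z))).const_mul Complex.I
      have h5 := h4.cexp
      unfold cubicExp
      simp only [Pi.add_apply, Pi.pow_apply] at h5
      convert! h5 using 1
      simp; ring_nf
    have h6 := h2.comp_ofReal
    convert! h6 using 1
    rw [show airyWeight s * airyExponent s * airyExponent s * Complex.exp (airyExponent s * z) =
      (airyWeight s * Complex.exp (airyExponent s * z)) * airyExponent s ^ 2 by ring,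
      airyWeight_mul_exp, airyExponent]
    push_cast
    linear_combination (-Complex.I * cubicExp 0 z (s + 1 * Complex.I) *
      (s + Complex.I) ^ 2) * Complex.I_sq
  have h7 := integral_eq_zero_of_hasDerivAt_of_integrable hder
    (((i1.const_mul z).sub i2).const_mul Complex.I) i1
  rw [integral_const_mul, integral_sub (i1.const_mul z) i2, integral_const_mul, mul_eq_zero,
    or_iff_right Complex.I_ne_zero, sub_eq_zero] at h7
  have h8 : z * airyAi z = 1 / (2 * Real.pi) * ∫ s, airyWeight s * airyExponent s *
      airyExponent s * Complex.exp (airyExponent s * z) := by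
    rw [← h7, airyAi_eq_weight]; ring
  rw [h8]
  exact h1

/-- Exponential integrals with `Re w = -1` decay along horizontal lines. -/
lemma tendsto_expIntegral {k : ℝ → ℂ} (hk : ExpIntegrable volume k airyExponent) (ζ : ℂ) :
    Tendsto (fun r : ℝ => ∫ s, k s * Complex.exp (airyExponent s * (ζ + r))) atTop (𝓝 0) := by
  have hb : ∀ r : ℝ, ‖∫ s, k s * Complex.exp (airyExponent s * (ζ + r))‖ ≤
      Real.exp (-r) * ∫ s, ‖k s * Complex.exp (airyExponent s * ζ)‖ := by
    intro r
    rw [← integral_const_mul]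
    refine norm_integral_le_of_norm_le ((hk.integrable ζ).norm.const_mul _)
      (ae_of_all _ fun s => le_of_eq ?_)
    rw [mul_add, Complex.exp_add, norm_mul, norm_mul, norm_mul, Complex.norm_exp
      (airyExponent s * r)]
    have : (airyExponent s * r).re = -r := by simp [airyExponent]
    rw [this]; ring
  refine squeeze_zero_norm hb ?_
  simpa using (Real.tendsto_exp_comp_nhds_zero.2 tendsto_neg_atTop_atBot).mul_const
    (∫ s, ‖k s * Complex.exp (airyExponent s * ζ)‖)

lemma tendsto_airyAi_add (ζ : ℂ) : Tendsto (fun r : ℝ => airyAi (ζ + r)) atTop (𝓝 0) := by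
  simp only [airyAi_eq_weight]
  simpa using (tendsto_expIntegral expIntegrable_airyWeight ζ).const_mul (1 / (2 * Real.pi) : ℂ)

lemma tendsto_airyAiDeriv_add (ζ : ℂ) :
    Tendsto (fun r : ℝ => airyAiDeriv (ζ + r)) atTop (𝓝 0) := by
  simp only [airyAiDeriv]
  simpa using (tendsto_expIntegral expIntegrable_airyWeight.mul_right ζ).const_mul
    (1 / (2 * Real.pi) : ℂ)

/-- A monotone function on the half-line with equal values at both ends is constant. -/
lemma deriv_eq_zero_of_tendsto_zero {h h' : ℝ → ℝ} (hd : ∀ r, HasDerivAt h (h' r) r)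
    (hpos : ∀ r, 0 ≤ r → 0 ≤ h' r) (h0 : h 0 = 0) (hlim : Tendsto h atTop (𝓝 0)) {r : ℝ}
    (hr : 0 < r) : h' r = 0 := by
  have hmono : MonotoneOn h (Ici 0) := by
    refine monotoneOn_of_hasDerivWithinAt_nonneg (convex_Ici 0)
      (fun r _ => (hd r).continuousAt.continuousWithinAt) (fun r _ => (hd r).hasDerivWithinAt) ?_
    intro r hr
    rw [interior_Ici] at hr
    exact hpos r (le_of_lt hr)
  have hz : ∀ u, 0 ≤ u → h u = 0 := by
    intro u hu
    refine le_antisymm (ge_of_tendsto hlim ?_) ?_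
    · filter_upwards [eventually_ge_atTop u] with v hv
      exact hmono hu (hu.trans hv : (0 : ℝ) ≤ v) hv
    · rw [← h0]; exact hmono (self_mem_Ici) hu hu
  have h1 : h =ᶠ[𝓝 r] fun _ => 0 := by
    filter_upwards [Ioi_mem_nhds hr] with u hu using hz u (le_of_lt hu)
  exact (hd r).unique ((hasDerivAt_const r (0 : ℝ)).congr_of_eventuallyEq h1)

/-- The Airy function has no zeros off the negative real axis. -/
theorem airyAi_ne_zero {ζ : ℂ} (hζ : ζ.im ≠ 0 ∨ 0 ≤ ζ.re) : airyAi ζ ≠ 0 := by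
  intro h0
  -- At a zero ζ this energy vanishes at r = 0 and at infinity. By the Airy equation its derivative
  -- is |Ai'|² + (ζ + r)|Ai|², whose imaginary part has constant sign if Im ζ ≠ 0, and whose real
  -- part is nonnegative if Re ζ ≥ 0. Either way Ai vanishes on the whole half-line.
  set E : ℝ → ℂ := fun r => starRingEnd ℂ (airyAi (ζ + r)) * airyAiDeriv (ζ + r) with hE
  set E' : ℝ → ℂ := fun r => (‖airyAiDeriv (ζ + r)‖ ^ 2 : ℝ) +
    (ζ + r) * (‖airyAi (ζ + r)‖ ^ 2 : ℝ) with hE'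
  have hline : ∀ r : ℝ, HasDerivAt (fun r : ℝ => ζ + r) 1 r := fun r => by
    simpa using (Complex.ofRealCLM.hasDerivAt (x := r)).const_add ζ
  have hEd : ∀ r, HasDerivAt E (E' r) r := by
    intro r
    have h1 : HasDerivAt (fun r : ℝ => airyAi (ζ + r)) (airyAiDeriv (ζ + r)) r := by
      have := (hasDerivAt_airyAi (ζ + r)).comp r (hline r)
      rwa [mul_one] at this
    have h2 : HasDerivAt (fun r : ℝ => airyAiDeriv (ζ + r)) ((ζ + r) * airyAi (ζ + r)) r := by
      have := (hasDerivAt_airyAiDeriv (ζ + r)).comp r (hline r)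
      rwa [mul_one] at this
    have h3 : HasDerivAt (fun r : ℝ => starRingEnd ℂ (airyAi (ζ + r)))
        (starRingEnd ℂ (airyAiDeriv (ζ + r))) r := h1.star
    have h4 := h3.mul h2
    have h5 : E' r = starRingEnd ℂ (airyAiDeriv (ζ + r)) * airyAiDeriv (ζ + r) +
        starRingEnd ℂ (airyAi (ζ + r)) * ((ζ + r) * airyAi (ζ + r)) := by
      simp only [hE', ← Complex.normSq_eq_norm_sq, ← Complex.mul_conj]
      ring
    rw [h5]
    exact h4
  have hE0 : E 0 = 0 := by simp [hE, h0]
  have hElim : Tendsto E atTop (𝓝 0) := by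
    have h1 : Tendsto (fun r : ℝ => starRingEnd ℂ (airyAi (ζ + r))) atTop (𝓝 0) := by
      simpa [Function.comp_def] using
        (Complex.continuous_conj.tendsto 0).comp (tendsto_airyAi_add ζ)
    simpa using h1.mul (tendsto_airyAiDeriv_add ζ)
  have hEim : ∀ r, (E' r).im = ζ.im * ‖airyAi (ζ + r)‖ ^ 2 := by
    intro r
    rw [hE', Complex.add_im, Complex.ofReal_im, Complex.im_mul_ofReal]; simp
  have hEre : ∀ r, (E' r).re = ‖airyAiDeriv (ζ + r)‖ ^ 2 + (ζ.re + r) * ‖airyAi (ζ + r)‖ ^ 2 := by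
    intro r
    rw [hE', Complex.add_re, Complex.ofReal_re, Complex.re_mul_ofReal]; simp
  have hzero : ∀ r : ℝ, 0 < r → airyAi (ζ + r) = 0 := by
    intro r hr
    rcases hζ with him | hre
    · have h1 : ∀ r : ℝ, HasDerivAt (fun r => (E r).im / ζ.im) (‖airyAi (ζ + r)‖ ^ 2) r := by
        intro r
        have := ((Complex.imCLM.hasFDerivAt.comp_hasDerivAt r (hEd r)).div_const ζ.im)
        have h2 : Complex.imCLM (E' r) / ζ.im = ‖airyAi (ζ + r)‖ ^ 2 := by
          rw [Complex.imCLM_apply, hEim, mul_div_cancel_left₀ _ him]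
        rw [h2] at this
        exact this
      have h3 : Tendsto (fun r => (E r).im / ζ.im) atTop (𝓝 0) := by
        simpa [Function.comp_def] using
          ((Complex.continuous_im.tendsto 0).comp hElim).div_const ζ.im
      have := deriv_eq_zero_of_tendsto_zero h1 (fun r _ => by positivity) (by simp [hE0]) h3 hr
      simpa using this
    · have h1 : ∀ r, HasDerivAt (fun r => (E r).re) (E' r).re r := fun r =>
        Complex.reCLM.hasFDerivAt.comp_hasDerivAt r (hEd r)
      have h3 : Tendsto (fun r => (E r).re) atTop (𝓝 0) := by
        simpa [Function.comp_def] using (Complex.continuous_re.tendsto 0).comp hElim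
      have := deriv_eq_zero_of_tendsto_zero h1
        (fun r hr => by rw [hEre]; positivity) (by simp [hE0]) h3 hr
      rw [hEre] at this
      have h4 : (ζ.re + r) * ‖airyAi (ζ + r)‖ ^ 2 ≤ 0 := by
        nlinarith [sq_nonneg ‖airyAiDeriv (ζ + r)‖]
      have h5 : ‖airyAi (ζ + r)‖ ^ 2 ≤ 0 := by
        by_contra hcon
        nlinarith
      simpa using le_antisymm h5 (sq_nonneg _)
  -- The zeros accumulate at ζ, so Ai would vanish identically, against the lower bound at 16 = 4².
  have hfreq : ∃ᶠ z in 𝓝[≠] ζ, airyAi z = 0 := by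
    have h1 : Tendsto (fun r : ℝ => ζ + r) (𝓝[>] 0) (𝓝[≠] ζ) := by
      refine tendsto_nhdsWithin_iff.2 ⟨?_, ?_⟩
      · have : ContinuousAt (fun r : ℝ => ζ + r) 0 := by fun_prop
        have h2 : Tendsto (fun r : ℝ => ζ + r) (𝓝 0) (𝓝 ζ) := by
          simpa [ContinuousAt] using this
        exact h2.mono_left nhdsWithin_le_nhds
      · filter_upwards [self_mem_nhdsWithin] with r hr
        have : r ≠ 0 := ne_of_gt hr
        simpa using this
    refine h1.frequently (Eventually.frequently ?_)
    filter_upwards [self_mem_nhdsWithin] with r hr using hzero r hr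
  have hall := (differentiable_airyAi.differentiableOn.analyticOnNhd
    isOpen_univ).eqOn_zero_of_preconnected_of_frequently_eq_zero isPreconnected_univ
    (mem_univ ζ) hfreq (mem_univ ((4 : ℂ) ^ 2))
  have hlow := le_norm_airyAi (β := 4) (by norm_num) (by norm_num)
  rw [hall] at hlow
  simp only [Pi.zero_apply, norm_zero] at hlow
  have : 0 < 1 / (8 * √‖(4 : ℂ)‖) * Real.exp (-(2 / 3 * (4 : ℂ) ^ 3).re) := by
    have : (0 : ℝ) < √‖(4 : ℂ)‖ := Real.sqrt_pos.2 (by norm_num)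
    positivity
  linarith

/-! ### The Pekeris function -/

/-- 4v³/27 is the maximum of vr - r^{3/2} over r ≥ 0, attained at √r = 2v/3. It is the source of
every 4/27 in the growth bounds. -/
lemma mul_le_cube_add_sqrt_cube {v r : ℝ} (hv : 0 ≤ v) (hr : 0 ≤ r) :
    v * r ≤ 4 / 27 * v ^ 3 + √r ^ 3 := by
  set w := √r
  have hw : 0 ≤ w := Real.sqrt_nonneg r
  have h : r = w ^ 2 := (Real.sq_sqrt hr).symm
  have h1 : 0 ≤ (w - 2 * v / 3) ^ 2 * (w + v / 3) := by positivity
  rw [h]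
  nlinarith

lemma integrableOn_exp_neg_sqrt_cube :
    IntegrableOn (fun r : ℝ => Real.exp (-(1 / 3) * √r ^ 3)) (Ioi 0) := by
  have h1 : IntegrableOn (fun r : ℝ => Real.exp (4 / 27) * Real.exp (-(1 / 3) * r)) (Ioi 0) :=
    (integrableOn_exp_mul_Ioi (by norm_num) 0).const_mul _
  refine h1.mono' (by fun_prop) ?_
  rw [ae_restrict_iff' measurableSet_Ioi]
  refine ae_of_all _ fun r hr => ?_
  rw [Real.norm_of_nonneg (by positivity), ← Real.exp_add]
  apply Real.exp_le_exp.2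
  have := mul_le_cube_add_sqrt_cube zero_le_one (le_of_lt hr : (0 : ℝ) ≤ r)
  linarith

/-- The decay of the ratios of Airy functions in the Pekeris integrals. -/
def PekerisDecay (k : ℝ → ℂ) (C : ℝ) : Prop :=
  ∀ r : ℝ, 0 ≤ r → ‖k r‖ ≤ C * Real.exp (-(4 / 3) * √r ^ 3)

lemma PekerisDecay.nonneg {k : ℝ → ℂ} {C : ℝ} (h : PekerisDecay k C) : 0 ≤ C := by
  have := (norm_nonneg _).trans (h 0 le_rfl)
  simpa using this

/-- Of the exponent 4/3, a part 1 pays for e^{Tr} and the part 1/3 is kept for integrability. -/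
lemma PekerisDecay.mul_exp_le {k : ℝ → ℂ} {C T r : ℝ} (h : PekerisDecay k C) (hT : 0 ≤ T)
    (hr : 0 ≤ r) : ‖k r‖ * Real.exp (T * r) ≤
      C * Real.exp (4 / 27 * T ^ 3) * Real.exp (-(1 / 3) * √r ^ 3) := by
  have hC := h.nonneg
  calc ‖k r‖ * Real.exp (T * r) ≤
      C * Real.exp (-(4 / 3) * √r ^ 3) * Real.exp (4 / 27 * T ^ 3 + √r ^ 3) := by
        gcongr
        · exact h r hr
        · exact mul_le_cube_add_sqrt_cube hT hr
    _ = C * (Real.exp (-(4 / 3) * √r ^ 3) * Real.exp (4 / 27 * T ^ 3 + √r ^ 3)) := by ring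
    _ = C * (Real.exp (4 / 27 * T ^ 3) * Real.exp (-(1 / 3) * √r ^ 3)) := by
        rw [← Real.exp_add, ← Real.exp_add]; congr 2; ring
    _ = _ := by ring

/-- The weight `k` is dominated well enough for `∫ k(r) e^{i f(r) t} dμ(r)` to be an entire function
of growth `e^{4‖t‖³/27}`. -/
structure PhaseWeight (μ : Measure ℝ) (k f : ℝ → ℂ) (K : ℝ → ℝ) : Prop where
  aestronglyMeasurable_left : AEStronglyMeasurable k μ
  aestronglyMeasurable_right : AEStronglyMeasurable f μ
  integrable : Integrable K μ
  le : ∀ᵐ r ∂μ, ∀ T : ℝ, 0 ≤ T → ‖k r‖ * Real.exp (T * ‖f r‖) ≤ K r * Real.exp (4 / 27 * T ^ 3)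

namespace PhaseWeight

variable {μ : Measure ℝ} {k f : ℝ → ℂ} {K : ℝ → ℝ}

lemma expIntegrable (h : PhaseWeight μ k f K) :
    ExpIntegrable μ k (fun r => Complex.I * f r) := by
  have hm := h.aestronglyMeasurable_right.const_mul Complex.I
  refine ⟨h.aestronglyMeasurable_left, hm, fun T => ?_⟩
  refine (h.integrable.mul_const (Real.exp (4 / 27 * |T| ^ 3))).mono'
    (h.aestronglyMeasurable_left.norm.mul
      (Real.continuous_exp.comp_aestronglyMeasurable (hm.norm.const_mul T))) ?_
  filter_upwards [h.le] with r hr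
  rw [norm_mul Complex.I, Complex.norm_I, one_mul, Real.norm_of_nonneg (by positivity)]
  refine le_trans ?_ (hr |T| (abs_nonneg T))
  gcongr
  exact le_abs_self T

lemma norm_mul_exp_le (h : PhaseWeight μ k f K) : ∀ᵐ r ∂μ, ∀ t : ℂ,
    ‖k r * Complex.exp (Complex.I * f r * t)‖ ≤ K r * Real.exp (4 / 27 * ‖t‖ ^ 3) := by
  filter_upwards [h.le] with r hr t
  refine le_trans ?_ (hr ‖t‖ (norm_nonneg t))
  rw [norm_mul]
  gcongr
  have := ExpIntegrable.norm_exp_mul_le (Complex.I * f r) t le_rfl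
  rwa [norm_mul Complex.I, Complex.norm_I, one_mul] at this

lemma norm_integral_le (h : PhaseWeight μ k f K) (t : ℂ) :
    ‖∫ r, k r * Complex.exp (Complex.I * f r * t) ∂μ‖ ≤
      (∫ r, K r ∂μ) * Real.exp (4 / 27 * ‖t‖ ^ 3) := by
  rw [← integral_mul_const]
  refine norm_integral_le_of_norm_le (h.integrable.mul_const _) ?_
  filter_upwards [h.norm_mul_exp_le] with r hr using hr t

lemma differentiable (h : PhaseWeight μ k f K) :
    Differentiable ℂ fun t => ∫ r, k r * Complex.exp (Complex.I * f r * t) ∂μ := fun t =>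
  (h.expIntegrable.hasDerivAt t).differentiableAt

end PhaseWeight

lemma PekerisDecay.phaseWeight {k : ℝ → ℂ} {C : ℝ} (h : PekerisDecay k C) (hk : Continuous k)
    {c : ℂ} (hc : ‖c‖ = 1) : PhaseWeight (volume.restrict (Ioi 0)) k (fun r : ℝ => r * c)
      (fun r => C * Real.exp (-(1 / 3) * √r ^ 3)) := by
  refine ⟨hk.aestronglyMeasurable, by fun_prop, integrableOn_exp_neg_sqrt_cube.const_mul C, ?_⟩
  rw [ae_restrict_iff' measurableSet_Ioi]
  refine ae_of_all _ fun r (hr : 0 < r) T hT => ?_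
  have hn : ‖(r : ℂ) * c‖ = r := by simp [hc, abs_of_pos hr]
  rw [hn, mul_right_comm]
  exact h.mul_exp_le hT hr.le

/-- The ratio of the Airy function on the positive axis to its values on the rays `±2π/3`. -/
lemma exists_pekerisDecay {u : ℂ} (hu3 : u ^ 3 = -1) (hre : u.re = 1 / 2) (hu : ‖u‖ = 1)
    (him : u.im ≠ 0) :
    (∀ r : ℝ, airyAi (u ^ 2 * r) ≠ 0) ∧ Continuous (fun r : ℝ => airyAi r / airyAi (u ^ 2 * r)) ∧
      ∃ C, PekerisDecay (fun r : ℝ => airyAi r / airyAi (u ^ 2 * r)) C := by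
  have hne : ∀ r : ℝ, airyAi (u ^ 2 * r) ≠ 0 := by
    intro r
    apply airyAi_ne_zero
    rcases eq_or_ne r 0 with rfl | hr
    · right; simp
    · left
      rw [Complex.im_mul_ofReal, pow_two, Complex.mul_im, hre]
      have : (1 / 2 * u.im + u.im * (1 / 2)) * r = u.im * r := by ring
      rw [this]
      exact mul_ne_zero him hr
  have hc : Continuous (fun r : ℝ => airyAi r / airyAi (u ^ 2 * r)) :=
    (differentiable_airyAi.continuous.comp (by fun_prop)).div
      (differentiable_airyAi.continuous.comp (by fun_prop)) hne
  refine ⟨hne, hc, ?_⟩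
  have hlarge : ∀ r : ℝ, 16 ≤ r → ‖airyAi r / airyAi (u ^ 2 * r)‖ ≤
      8 * Real.exp (-(4 / 3) * √r ^ 3) := by
    intro r hr
    set w := √r with hw
    have hw4 : 4 ≤ w := Real.le_sqrt_of_sq_le (by norm_num [hr])
    have hw2 : (w : ℂ) ^ 2 = r := by
      rw [hw, ← Complex.ofReal_pow, Real.sq_sqrt (by linarith)]
    -- Since u³ = -1, the saddle points w and wu have opposite cubes: Ai(r) decays like e^{-2w³/3}
    -- while Ai(u²r) grows like e^{2w³/3}, up to equal powers of w. The condition r ≥ 16 gives w ≥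
    -- 4, as the lower bound requires.
    have h1 := norm_airyAi_le (β := w) (by simp; linarith) 0
    have h2 := le_norm_airyAi (β := w * u)
      (by
        rw [norm_mul, hu, Complex.re_ofReal_mul, hre, Complex.norm_real,
          Real.norm_of_nonneg (by linarith)]
        linarith)
      (by rw [norm_mul, hu]; simp [abs_of_pos (by linarith : 0 < w), hw4])
    have hn : ‖(w : ℂ) * u‖ = w := by rw [norm_mul, hu]; simp [abs_of_pos (by linarith : 0 < w)]
    have e1 : (2 / 3 * (w : ℂ) ^ 3 + w * 0).re = 2 / 3 * w ^ 3 := by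
      have : 2 / 3 * (w : ℂ) ^ 3 + w * 0 = ((2 / 3 * w ^ 3 : ℝ) : ℂ) := by push_cast; ring
      rw [this, Complex.ofReal_re]
    have e2 : (2 / 3 * ((w : ℂ) * u) ^ 3).re = -(2 / 3 * w ^ 3) := by
      rw [mul_pow, hu3]
      have : (2 / 3 * ((w : ℂ) ^ 3 * -1)) = ((-(2 / 3 * w ^ 3) : ℝ) : ℂ) := by push_cast; ring
      rw [this, Complex.ofReal_re]
    rw [e1, add_zero, hw2, norm_zero, Complex.ofReal_re] at h1
    rw [e2, hn, mul_pow, hw2, mul_comm (r : ℂ)] at h2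
    have hsw : 0 < √w := Real.sqrt_pos.2 (by linarith)
    rw [norm_div, div_le_iff₀ (norm_pos_iff.2 (hne r))]
    calc ‖airyAi r‖ ≤ 1 / √w * Real.exp (-(2 / 3 * w ^ 3)) := by simpa using h1
      _ = 8 * Real.exp (-(4 / 3) * w ^ 3) * (1 / (8 * √w) * Real.exp (-(-(2 / 3 * w ^ 3)))) := by
        have : Real.exp (-(2 / 3 * w ^ 3)) =
            Real.exp (-(4 / 3) * w ^ 3) * Real.exp (-(-(2 / 3 * w ^ 3))) := by
          rw [← Real.exp_add]; congr 1; ring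
        rw [this]; field_simp
      _ ≤ _ := by gcongr
  obtain ⟨B, hB⟩ := (isCompact_Icc (a := (0 : ℝ)) (b := 16)).exists_bound_of_continuousOn
    hc.continuousOn
  refine ⟨max 8 (B * Real.exp (4 / 3 * 4 ^ 3)), fun r hr => ?_⟩
  rcases le_total r 16 with h | h
  · have hB0 : 0 ≤ B := (norm_nonneg _).trans (hB r ⟨hr, h⟩)
    have h4 : √r ≤ 4 := Real.sqrt_le_iff.2 ⟨by norm_num, by norm_num [h]⟩
    calc _ ≤ B * 1 := by rw [mul_one]; exact hB r ⟨hr, h⟩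
      _ ≤ B * (Real.exp (4 / 3 * 4 ^ 3) * Real.exp (-(4 / 3) * √r ^ 3)) := by
        gcongr
        rw [← Real.exp_add]
        apply Real.one_le_exp
        have : √r ^ 3 ≤ 4 ^ 3 := by gcongr
        linarith
      _ = B * Real.exp (4 / 3 * 4 ^ 3) * Real.exp (-(4 / 3) * √r ^ 3) := by ring
      _ ≤ _ := by gcongr; exact le_max_right _ _
  · refine (hlarge r h).trans ?_
    gcongr
    exact le_max_left _ _

/-- The primitive cube root of unity `e^{2πi/3}`. -/
def omega : ℂ := Complex.exp (Complex.I * (2 * Real.pi / 3 : ℝ))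

lemma omega_eq : omega = Complex.exp (2 * Real.pi * Complex.I / 3) := by
  rw [omega]; congr 1; push_cast; ring

lemma norm_omega : ‖omega‖ = 1 := norm_exp_I_mul _

lemma omega_pow_three : omega ^ 3 = 1 := by rw [omega_eq]; exact exp_two_pi_div_three_pow

lemma omega_ne_zero : omega ≠ 0 := Complex.exp_ne_zero _

lemma omega_inv : Complex.exp (-(2 * Real.pi * Complex.I / 3)) = omega ^ 2 := by
  rw [Complex.exp_neg, ← omega_eq]
  exact inv_eq_of_mul_eq_one_left (by rw [← omega_pow_three]; ring)

lemma airyA1_def (z : ℂ) : airyA1 z = omega * airyAi (omega * z) := by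
  rw [airyA1, omega_eq]

lemma airyA2_def (z : ℂ) : airyA2 z = omega ^ 2 * airyAi (omega ^ 2 * z) := by
  rw [airyA2, omega_inv]

lemma omega_re : omega.re = -(1 / 2) := by
  have h : 2 * Real.pi / 3 = Real.pi - Real.pi / 3 := by ring
  rw [omega, mul_comm, Complex.exp_ofReal_mul_I_re, h, Real.cos_pi_sub, Real.cos_pi_div_three]

lemma omega_im : omega.im = √3 / 2 := by
  have h : 2 * Real.pi / 3 = Real.pi - Real.pi / 3 := by ring
  rw [omega, mul_comm, Complex.exp_ofReal_mul_I_im, h, Real.sin_pi_sub, Real.sin_pi_div_three]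

lemma omega_sq : omega ^ 2 = -1 - omega := by
  have h : (√3 : ℂ) ^ 2 = 3 := by
    rw [← Complex.ofReal_pow, Real.sq_sqrt (by norm_num)]; norm_num
  rw [← Complex.re_add_im omega, omega_re, omega_im]
  push_cast
  linear_combination (Complex.I ^ 2 / 4) * h + 3 / 4 * Complex.I_sq

/-- The ratio `A₀/A₁` on the real line. -/
def ratio₃ (r : ℝ) : ℂ := airyA0 r / airyA1 r

/-- The ratio `A₂/A₁` on the line through `e^{2πi/3}`. -/
def ratio₂ (r : ℝ) : ℂ := airyA2 (r * omega) / airyA1 (r * omega)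

/-- Taking u = -ω² = e^{iπ/3} gives u² = ω, the argument turn in A₁. -/
lemma ratio₃_props : (∀ r : ℝ, airyA1 r ≠ 0) ∧ Continuous ratio₃ ∧ ∃ C, PekerisDecay ratio₃ C := by
  have h2 : (-omega ^ 2) ^ 2 = omega := by linear_combination omega * omega_pow_three
  have him : (-omega ^ 2).im = √3 / 2 := by rw [omega_sq]; simp [omega_im]
  obtain ⟨h1, hc, C, hC⟩ := exists_pekerisDecay (u := -omega ^ 2)
    (by linear_combination (-omega ^ 3 - 1) * omega_pow_three)
    (by rw [omega_sq]; norm_num [omega_re])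
    (by rw [norm_neg, norm_pow, norm_omega, one_pow])
    (by rw [him]; positivity)
  rw [h2] at h1 hc hC
  have he : ratio₃ = fun r : ℝ => omega⁻¹ * (airyAi r / airyAi (omega * r)) := by
    ext r
    rw [ratio₃, airyA0, airyA1_def]
    field_simp [h1 r, omega_ne_zero]
  refine ⟨fun r => ?_, by rw [he]; fun_prop, C, fun r hr => ?_⟩
  · rw [airyA1_def]; exact mul_ne_zero omega_ne_zero (h1 r)
  · rw [he, norm_mul, norm_inv, norm_omega, inv_one, one_mul]
    exact hC r hr

/-- At σ = rω the functions A₂ and A₁ involve Ai(ω³r) = Ai(r) and Ai(ω²r), so the ratio is again of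
the same type, with u = -ω = e^{-iπ/3}. -/
lemma ratio₂_props : Continuous ratio₂ ∧ ∃ C, PekerisDecay ratio₂ C := by
  have h2 : (-omega) ^ 2 = omega ^ 2 := by ring
  obtain ⟨h1, hc, C, hC⟩ := exists_pekerisDecay (u := -omega)
    (by linear_combination -omega_pow_three) (by norm_num [omega_re])
    (by rw [norm_neg, norm_omega])
    (by rw [Complex.neg_im, omega_im]; simp)
  rw [h2] at h1 hc hC
  have he : ratio₂ = fun r : ℝ => omega * (airyAi r / airyAi (omega ^ 2 * r)) := by
    ext r
    have e1 : omega ^ 2 * (r * omega) = r := by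
      linear_combination (r : ℂ) * omega_pow_three
    have e2 : omega * (r * omega) = omega ^ 2 * r := by ring
    rw [ratio₂, airyA2_def, airyA1_def, e1, e2]
    field_simp [h1 r, omega_ne_zero]
  refine ⟨by rw [he]; fun_prop, C, fun r hr => ?_⟩
  rw [he, norm_mul, norm_omega, one_mul]
  exact hC r hr

lemma pekerisIntegrand₂_ray (t : ℂ) :
    (fun r : ℝ => pekerisIntegrand₂ t (r * Complex.exp (Complex.I * (2 * Real.pi / 3 : ℝ))) *
      Complex.exp (Complex.I * (2 * Real.pi / 3 : ℝ))) =
    fun r : ℝ => omega * (ratio₂ r * Complex.exp (Complex.I * (r * omega) * t)) := by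
  ext r
  change pekerisIntegrand₂ t (r * omega) * omega = _
  rw [pekerisIntegrand₂, ← ratio₂]
  rw [mul_right_comm Complex.I t]
  ring

lemma pekerisIntegrand₃_ray (t : ℂ) :
    (fun r : ℝ => pekerisIntegrand₃ t (r * Complex.exp (Complex.I * (0 : ℝ))) *
      Complex.exp (Complex.I * (0 : ℝ))) =
    fun r : ℝ => ratio₃ r * Complex.exp (Complex.I * (r * 1) * t) := by
  ext r
  rw [Complex.ofReal_zero, mul_zero, Complex.exp_zero, mul_one, mul_one, pekerisIntegrand₃,
    ← ratio₃]
  rw [mul_right_comm Complex.I t, mul_comm (Complex.exp _)]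

lemma rayIntegrable_pekerisIntegrand (t : ℂ) :
    RayIntegrable (2 * Real.pi / 3) (pekerisIntegrand₂ t) ∧
      RayIntegrable 0 (pekerisIntegrand₃ t) := by
  obtain ⟨hc2, C2, h2⟩ := ratio₂_props
  obtain ⟨-, hc3, C3, h3⟩ := ratio₃_props
  constructor
  · rw [RayIntegrable, pekerisIntegrand₂_ray]
    exact ((h2.phaseWeight hc2 norm_omega).expIntegrable.integrable t).const_mul _
  · rw [RayIntegrable, pekerisIntegrand₃_ray]
    exact (h3.phaseWeight hc3 norm_one).expIntegrable.integrable t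

lemma pekeris_eq (t : ℂ) : pekeris t = 1 / (2 * Real.pi) *
    (-(omega * ∫ r in Ioi (0 : ℝ), ratio₂ r * Complex.exp (Complex.I * (r * omega) * t)) -
      ∫ r in Ioi (0 : ℝ), ratio₃ r * Complex.exp (Complex.I * (r * 1) * t)) := by
  rw [pekeris, rayIntegral, rayIntegral, pekerisIntegrand₂_ray, pekerisIntegrand₃_ray,
    integral_const_mul]

lemma differentiable_pekeris : Differentiable ℂ pekeris := by
  obtain ⟨hc2, C2, h2⟩ := ratio₂_props
  obtain ⟨-, hc3, C3, h3⟩ := ratio₃_props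
  rw [funext pekeris_eq]
  exact ((((h2.phaseWeight hc2 norm_omega).differentiable.const_mul omega).neg).sub
    (h3.phaseWeight hc3 norm_one).differentiable).const_mul _

lemma tendsto_mul_pekerisCaret : Tendsto (fun t : ℂ => t * pekerisCaret t) (𝓝[≠] 0)
    (𝓝 (1 / (2 * Real.pi * Complex.I))) := by
  have h1 : Tendsto (fun t : ℂ => 1 / (2 * Real.pi * Complex.I) + t * pekeris t) (𝓝[≠] 0)
      (𝓝 (1 / (2 * Real.pi * Complex.I))) := by
    have : Continuous fun t : ℂ => 1 / (2 * Real.pi * Complex.I) + t * pekeris t :=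
      continuous_const.add (continuous_id.mul differentiable_pekeris.continuous)
    simpa using (this.tendsto 0).mono_left nhdsWithin_le_nhds
  refine h1.congr' ?_
  filter_upwards [self_mem_nhdsWithin] with t (ht : t ≠ 0)
  have hpi : (Real.pi : ℂ) ≠ 0 := by exact_mod_cast Real.pi_ne_zero
  rw [pekerisCaret, mul_add]
  congr 1
  field_simp [Complex.I_ne_zero]

/-! ### The phase integrals -/

/-- The integral of a cubic exponential from `-i∞` to `e^{5πi/6}∞`. -/
def cubicIntegral (a b : ℂ) : ℂ :=
  rayIntegral (5 * Real.pi / 6) (cubicExp a b) - rayIntegral (-(Real.pi / 2)) (cubicExp a b)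

lemma cubicExp_sub (a b u : ℂ) : cubicExp a b (u - a) =
    Complex.exp (Complex.I * (2 * a ^ 3 / 3 - a * b)) * cubicExp 0 (b - a ^ 2) u := by
  rw [cubicExp, cubicExp, ← Complex.exp_add]
  congr 1; ring

/-- A primitive has the same limit along parallel rays from 0 and from a, since both end in the same
sector. Hence completing the cube costs only Φ 0 - Φ a. -/
lemma rayIntegral_cubicExp_shift {a b : ℂ} {α : ℝ}
    (hα : Complex.exp (Complex.I * α) ^ 3 = Complex.I) {Φ : ℂ → ℂ}
    (hΦ : ∀ t, HasDerivAt Φ (cubicExp 0 (b - a ^ 2) t) t) :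
    rayIntegral α (cubicExp a b) = Complex.exp (Complex.I * (2 * a ^ 3 / 3 - a * b)) *
      (Φ 0 - Φ a + rayIntegral α (cubicExp 0 (b - a ^ 2))) := by
  set e := Complex.exp (Complex.I * (2 * a ^ 3 / 3 - a * b)) with he
  have hd := norm_exp_I_mul α
  have hΨ : ∀ t, HasDerivAt (fun t => e * Φ (t + a)) (cubicExp a b t) t := by
    intro t
    have h1 := ((hΦ (t + a)).comp_add_const t a).const_mul e
    rwa [he, ← cubicExp_sub, add_sub_cancel_right] at h1
  have h1 := (tendsto_primitive_rayIntegral (sectorDecay_cubicExp hd hα a b) hΨ).2.comp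
    (tendsto_ray_sectorAtInfty hd 0)
  have h2 := ((tendsto_primitive_rayIntegral (sectorDecay_cubicExp hd hα 0 (b - a ^ 2)) hΦ).2.comp
    (tendsto_ray_sectorAtInfty hd a)).const_mul e
  have h3 := tendsto_nhds_unique h1 (h2.congr fun v => by
    simp only [Function.comp_apply]; congr 2; ring)
  rw [zero_add] at h3
  linear_combination h3

/-- The corrections Φ 0 - Φ a of the two rays cancel, and what remains is the contour of A₁. -/
lemma cubicIntegral_eq (a b : ℂ) : cubicIntegral a b =
    Complex.exp (Complex.I * (2 * a ^ 3 / 3 - a * b)) * (2 * Real.pi * airyA1 (b - a ^ 2)) := by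
  obtain ⟨Φ, hΦ⟩ := (differentiable_cubicExp 0 (b - a ^ 2)).isExactOn_univ
  replace hΦ : ∀ t, HasDerivAt Φ (cubicExp 0 (b - a ^ 2) t) t := fun t => hΦ t (mem_univ t)
  have hpi : (Real.pi : ℂ) ≠ 0 := by exact_mod_cast Real.pi_ne_zero
  rw [cubicIntegral, rayIntegral_cubicExp_shift exp_five_pi_six_pow hΦ,
    rayIntegral_cubicExp_shift exp_neg_pi_two_pow hΦ, airyA1_eq]
  field_simp
  ring

lemma cubicExp_mul_exp (a b f t : ℂ) :
    Complex.exp (Complex.I * f * t) * cubicExp a b t = cubicExp a (b + f) t := by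
  rw [cubicExp, cubicExp, ← Complex.exp_add]
  congr 1; ring

lemma integrableOn_exp_cubic (M : ℝ) :
    IntegrableOn (fun v : ℝ => Real.exp (4 / 27 * v ^ 3) *
      (Real.exp (M * (v ^ 2 + v)) * Real.exp (-(v ^ 3 / 3)))) (Ioi 0) := by
  refine integrable_of_isBigO_exp_neg (b := 1) one_pos (by fun_prop)
    (Asymptotics.IsBigO.of_bound 1 ?_)
  filter_upwards [eventually_ge_atTop (6 * (2 * |M| + 1)), eventually_ge_atTop 1] with v h1 h2
  rw [Real.norm_of_nonneg (by positivity), Real.norm_of_nonneg (by positivity), one_mul,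
    ← Real.exp_add, ← Real.exp_add]
  apply Real.exp_le_exp.2
  have hM := abs_nonneg M
  have h3 : M * (v ^ 2 + v) ≤ |M| * (v ^ 2 + v ^ 2) := by
    refine (mul_le_mul_of_nonneg_right (le_abs_self M) (by positivity)).trans ?_
    gcongr; nlinarith
  have h4 : (6 * (2 * |M| + 1)) * v ^ 2 ≤ v ^ 3 := by nlinarith [sq_nonneg v]
  nlinarith

/-- Interchange of a phase integral along a ray with the integral over its parameter. -/
lemma PhaseWeight.rayIntegral_integral {μ : Measure ℝ} [SFinite μ] {k f : ℝ → ℂ} {K : ℝ → ℝ}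
    (h : PhaseWeight μ k f K) {α : ℝ} (hα : Complex.exp (Complex.I * α) ^ 3 = Complex.I)
    (a b : ℂ) : Integrable (fun r => k r * rayIntegral α (cubicExp a (b + f r))) μ ∧
      rayIntegral α (fun t => (∫ r, k r * Complex.exp (Complex.I * f r * t) ∂μ) *
        cubicExp a b t) = ∫ r, k r * rayIntegral α (cubicExp a (b + f r)) ∂μ := by
  set d := Complex.exp (Complex.I * α)
  have hd : ‖d‖ = 1 := norm_exp_I_mul α
  set F : ℝ → ℝ → ℂ := fun v r =>
    k r * Complex.exp (Complex.I * f r * (v * d)) * cubicExp a b (v * d) * d with hF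
  have hint : Integrable (Function.uncurry F) ((volume.restrict (Ioi (0 : ℝ))).prod μ) := by
    -- The growth 4v³/27 allowed by the weight is below the decay v³/3 on the ray, so a product of
    -- integrable functions dominates.
    have hmaj := (integrableOn_exp_cubic (‖a‖ + ‖b‖)).mul_prod h.integrable
    refine hmaj.mono' ?_ ?_
    · have m1 : AEStronglyMeasurable (fun p : ℝ × ℝ => k p.2)
          ((volume.restrict (Ioi 0)).prod μ) := h.aestronglyMeasurable_left.comp_snd
      have m2 : AEStronglyMeasurable (fun p : ℝ × ℝ => f p.2)
          ((volume.restrict (Ioi 0)).prod μ) := h.aestronglyMeasurable_right.comp_snd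
      have m3 : AEStronglyMeasurable (fun p : ℝ × ℝ => (p.1 : ℂ) * d)
          ((volume.restrict (Ioi 0)).prod μ) :=
        (by fun_prop : Continuous fun p : ℝ × ℝ => (p.1 : ℂ) * d).aestronglyMeasurable
      exact ((m1.mul (Complex.continuous_exp.comp_aestronglyMeasurable
        ((m2.const_mul Complex.I).mul m3))).mul
        ((differentiable_cubicExp a b).continuous.comp_aestronglyMeasurable m3)).mul_const d
    · have n1 : ∀ᵐ p ∂((volume.restrict (Ioi (0 : ℝ))).prod μ), 0 < p.1 :=
        Measure.quasiMeasurePreserving_fst.ae (ae_restrict_mem measurableSet_Ioi)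
      have n2 := (Measure.quasiMeasurePreserving_snd (μ := volume.restrict (Ioi (0 : ℝ)))
        (ν := μ)).ae
        h.norm_mul_exp_le
      filter_upwards [n1, n2] with p hp1 hp2
      have hn : ‖(p.1 : ℂ) * d‖ = p.1 := by simp [hd, abs_of_pos hp1]
      have h3 := hp2 (p.1 * d)
      rw [hn] at h3
      simp only [Function.uncurry, hF]
      rw [norm_mul, hd, mul_one, norm_mul]
      calc _ ≤ K p.2 * Real.exp (4 / 27 * p.1 ^ 3) * (Real.exp ((‖a‖ + ‖b‖) * (p.1 ^ 2 + p.1)) *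
            Real.exp (-(p.1 ^ 3 / 3))) := by
            gcongr
            · exact (norm_nonneg _).trans h3
            · exact norm_cubicExp_ray_le hd hα a b hp1.le
        _ = _ := by ring
  have h1 : rayIntegral α (fun t => (∫ r, k r * Complex.exp (Complex.I * f r * t) ∂μ) *
      cubicExp a b t) = ∫ v in Ioi (0 : ℝ), ∫ r, F v r ∂μ := by
    unfold rayIntegral
    congr 1; ext v
    beta_reduce
    rw [← integral_mul_const, ← integral_mul_const]
  have h2 : ∀ r, ∫ v in Ioi (0 : ℝ), F v r = k r * rayIntegral α (cubicExp a (b + f r)) := by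
    intro r
    rw [rayIntegral, ← integral_const_mul]
    congr 1; ext v
    rw [← cubicExp_mul_exp, hF]
    ring
  constructor
  · simpa only [Function.uncurry, h2] using hint.integral_prod_right
  · rw [h1, integral_integral_swap hint]
    simp only [h2]

lemma PhaseWeight.cubicIntegral_integral {μ : Measure ℝ} [SFinite μ] {k f : ℝ → ℂ} {K : ℝ → ℝ}
    (h : PhaseWeight μ k f K) (a b : ℂ) :
    Integrable (fun r => k r * cubicIntegral a (b + f r)) μ ∧
      rayIntegral (5 * Real.pi / 6) (fun t =>
        (∫ r, k r * Complex.exp (Complex.I * f r * t) ∂μ) * cubicExp a b t) -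
      rayIntegral (-(Real.pi / 2)) (fun t =>
        (∫ r, k r * Complex.exp (Complex.I * f r * t) ∂μ) * cubicExp a b t) =
      ∫ r, k r * cubicIntegral a (b + f r) ∂μ := by
  obtain ⟨i1, e1⟩ := h.rayIntegral_integral exp_five_pi_six_pow a b
  obtain ⟨i2, e2⟩ := h.rayIntegral_integral exp_neg_pi_two_pow a b
  simp only [cubicIntegral, mul_sub]
  exact ⟨i1.sub i2, by rw [e1, e2, integral_sub i1 i2]⟩

/-- A primitive of a phase integral times a cubic exponential, and its limits at infinity. -/
lemma PhaseWeight.exists_primitive {μ : Measure ℝ} [SFinite μ] {k f : ℝ → ℂ} {K : ℝ → ℝ}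
    (h : PhaseWeight μ k f K) (a b : ℂ) : ∃ (P : ℂ → ℂ) (k₀ l₀ : ℂ),
      (∀ t, HasDerivAt P
        ((∫ r, k r * Complex.exp (Complex.I * f r * t) ∂μ) * cubicExp a b t) t) ∧
      Tendsto P (sectorAtInfty (Complex.exp (Complex.I * (-(Real.pi / 2) : ℝ)))) (𝓝 k₀) ∧
      Tendsto P (sectorAtInfty (Complex.exp (Complex.I * (5 * Real.pi / 6 : ℝ)))) (𝓝 l₀) ∧
      l₀ - k₀ = ∫ r, k r * cubicIntegral a (b + f r) ∂μ := by
  obtain ⟨P, hP⟩ := (h.differentiable.mul (differentiable_cubicExp a b)).isExactOn_univ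
  have hP' : ∀ t, HasDerivAt P
      ((∫ r, k r * Complex.exp (Complex.I * f r * t) ∂μ) * cubicExp a b t) t :=
    fun t => hP t (mem_univ t)
  have hdec : ∀ {d : ℂ}, ‖d‖ = 1 → d ^ 3 = Complex.I → SectorDecay (fun t =>
      (∫ r, k r * Complex.exp (Complex.I * f r * t) ∂μ) * cubicExp a b t) d := fun hd hd3 =>
    sectorDecay_mul_cubicExp hd hd3 (fun t _ => h.norm_integral_le t) a b
  refine ⟨P, _, _, hP',
    (tendsto_primitive_rayIntegral (hdec (norm_exp_I_mul _) exp_neg_pi_two_pow) hP').2,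
    (tendsto_primitive_rayIntegral (hdec (norm_exp_I_mul _) exp_five_pi_six_pow) hP').2, ?_⟩
  rw [← (h.cubicIntegral_integral a b).2]
  ring

/-! ### The polar part -/

/-- The sector strays from its axis by at most ‖t‖/20, while the axis is at distance at least ‖t‖/2
from the real line; so the principal logarithm is holomorphic in the sector. -/
lemma mem_slitPlane_of_mem_sector {d t : ℂ} (hd : ‖d‖ = 1) (him : 1 / 2 ≤ |d.im|)
    (ht : t ∈ sector d) : t ∈ Complex.slitPlane := by
  have h1 := norm_sub_le_of_mem_sector hd ht
  have h0 : t ≠ 0 := by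
    rintro rfl
    simp [sector] at ht
  have hpos : 0 < ‖t‖ := norm_pos_iff.2 h0
  refine Complex.mem_slitPlane_iff.2 (Or.inr fun h => ?_)
  have h2 := (Complex.abs_im_le_norm _).trans h1
  rw [Complex.sub_im, h, Complex.im_ofReal_mul, zero_sub, abs_neg, abs_mul, abs_of_pos hpos] at h2
  nlinarith

lemma exp_five_pi_six_im : (Complex.exp (Complex.I * (5 * Real.pi / 6 : ℝ))).im = 1 / 2 := by
  rw [exp_five_pi_six, show (√3 * (-1 : ℝ) + Complex.I : ℂ) / 2 =
    ((-√3 / 2 : ℝ) : ℂ) + ((1 / 2 : ℝ) : ℂ) * Complex.I by push_cast; ring]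
  simp

lemma exp_neg_pi_two_im : (Complex.exp (Complex.I * (-(Real.pi / 2) : ℝ))).im = -1 := by
  rw [exp_neg_pi_two]; simp

/-- `Φ(t) + log t` is a primitive of `t⁻¹` times the cubic exponential. -/
def IsPolarPrimitive (a b : ℂ) (Φ : ℂ → ℂ) : Prop :=
  ∀ t ≠ 0, HasDerivAt Φ ((cubicExp a b t - 1) / t) t

/-- The exponential equals 1 at the origin, so its divided difference there is an entire function.
-/
lemma exists_polarPrimitive (a b : ℂ) : ∃ G Φ : ℂ → ℂ, (∀ t, HasDerivAt Φ (G t) t) ∧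
    ∀ t ≠ 0, G t = (cubicExp a b t - 1) / t := by
  have hG : Differentiable ℂ (dslope (cubicExp a b) 0) := by
    have := (Complex.differentiableOn_dslope (s := univ) (c := 0) (f := cubicExp a b)
      univ_mem).2 (differentiable_cubicExp a b).differentiableOn
    exact differentiableOn_univ.1 this
  obtain ⟨Φ, hΦ⟩ := hG.isExactOn_univ
  refine ⟨_, Φ, fun t => hΦ t (mem_univ t), fun t ht => ?_⟩
  rw [dslope_of_ne _ ht, slope_def_field]
  simp [cubicExp]

lemma IsPolarPrimitive.exists_tendsto {a b : ℂ} {Φ : ℂ → ℂ} (hΦ : IsPolarPrimitive a b Φ) {d : ℂ}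
    (hd : ‖d‖ = 1) (hd3 : d ^ 3 = Complex.I) (him : 1 / 2 ≤ |d.im|) :
    ∃ L, Tendsto (fun t => Φ t + Complex.log t) (sectorAtInfty d) (𝓝 L) := by
  have hdec : SectorDecay (fun t => t⁻¹ * cubicExp a b t) d := by
    refine sectorDecay_mul_cubicExp hd hd3 (C := 1) (fun t ht => ?_) a b
    rw [norm_inv, one_mul]
    exact (inv_le_one_of_one_le₀ ht).trans (Real.one_le_exp (by positivity))
  refine exists_tendsto_primitive hd hdec fun t ht => ?_
  have hs := mem_slitPlane_of_mem_sector hd him ht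
  have h0 : t ≠ 0 := Complex.slitPlane_ne_zero hs
  have := (hΦ t h0).add (Complex.hasDerivAt_log hs)
  have e : t⁻¹ * cubicExp a b t = (cubicExp a b t - 1) / t + t⁻¹ := by field_simp; ring
  rw [e]
  exact this

/-- The cubic exponential along a ray issuing from a stationary point on the negative side. -/
lemma norm_cubicExp_stationary_le {a b n w : ℝ} (hw : w ^ 2 = n) (hw0 : 0 ≤ w) (hn : n = a ^ 2 - b)
    {d : ℂ} (hd3 : d ^ 3 = Complex.I) (hd2 : 0 ≤ (Complex.I * d ^ 2).re) (s : ℝ) :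
    ‖cubicExp a b ((-(a + w) : ℝ) + s * d)‖ ≤ Real.exp (-(s ^ 3 / 3)) := by
  have e1 : ((-(a + w) : ℝ) : ℂ) + s * d = (-w + s * d) - a := by push_cast; ring
  rw [e1, cubicExp_sub, norm_mul]
  have e2 : ‖Complex.exp (Complex.I * (2 * (a : ℂ) ^ 3 / 3 - a * b))‖ = 1 := by
    have : Complex.I * (2 * (a : ℂ) ^ 3 / 3 - a * b) =
      ((2 * a ^ 3 / 3 - a * b : ℝ) : ℂ) * Complex.I := by push_cast; ring
    rw [this, Complex.norm_exp_ofReal_mul_I]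
  have e3 : (b : ℂ) - a ^ 2 = -(w : ℂ) ^ 2 := by
    have : b - a ^ 2 = -w ^ 2 := by rw [hw, hn]; ring
    exact_mod_cast this
  rw [e2, one_mul, e3, cubicExp, Complex.norm_exp]
  apply Real.exp_le_exp.2
  -- Expansion at the stationary point -w of u³/3 - w²u: there is no linear term, the quadratic one
  -- decays by `hd2`, and the cubic one is -s³/3.
  have e4 : Complex.I * ((-w + s * d) ^ 3 / 3 + 0 * (-w + s * d) ^ 2 + -(w : ℂ) ^ 2 *
      (-w + s * d)) = ((2 / 3 * w ^ 3 : ℝ) : ℂ) * Complex.I +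
        ((-(w * s ^ 2) : ℝ) : ℂ) * (Complex.I * d ^ 2) + ((-(s ^ 3 / 3) : ℝ) : ℂ) := by
    push_cast
    linear_combination (Complex.I * s ^ 3 / 3) * hd3 + (s : ℂ) ^ 3 / 3 * Complex.I_sq
  rw [e4, Complex.add_re, Complex.add_re, Complex.re_ofReal_mul, Complex.re_ofReal_mul,
    Complex.ofReal_re, Complex.I_re]
  have : 0 ≤ w * s ^ 2 * (Complex.I * d ^ 2).re := by positivity
  linarith

lemma exp_neg_cube_div_three_le {s : ℝ} (hs : 0 ≤ s) :
    Real.exp (-(s ^ 3 / 3)) ≤ 2 * Real.exp (-s) := by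
  have h1 : Real.exp (2 / 3) ≤ 2 := by
    rw [← Real.le_log_iff_exp_le (by norm_num)]
    linarith [Real.log_two_gt_d9]
  have h2 : -(s ^ 3 / 3) ≤ 2 / 3 + -s := by
    have : 0 ≤ (s - 1) ^ 2 * (s + 2) := by positivity
    nlinarith
  calc _ ≤ Real.exp (2 / 3 + -s) := Real.exp_le_exp.2 h2
    _ = Real.exp (2 / 3) * Real.exp (-s) := Real.exp_add _ _
    _ ≤ _ := by gcongr

/-- Along a ray in the left half-plane, the primitive with the logarithm of `-t` varies little. -/
lemma IsPolarPrimitive.norm_sub_le {a b n w : ℝ} {Φ : ℂ → ℂ} (hΦ : IsPolarPrimitive a b Φ)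
    (hw : w ^ 2 = n) (hw0 : 0 ≤ w) (hn : n = a ^ 2 - b) (hm : 0 < a + w)
    {d : ℂ} (hd3 : d ^ 3 = Complex.I) (hd2 : 0 ≤ (Complex.I * d ^ 2).re) (hd : ‖d‖ = 1)
    (hdre : d.re ≤ 0) {s : ℝ} (hs : 0 ≤ s) :
    ‖(Φ ((-(a + w) : ℝ) + s * d) + Complex.log (-((-(a + w) : ℝ) + s * d))) -
      (Φ ((-(a + w) : ℝ)) + Complex.log (-((-(a + w) : ℝ) : ℂ)))‖ ≤ 2 / (a + w) := by
  set c : ℂ := ((-(a + w) : ℝ) : ℂ) with hc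
  set f : ℝ → ℂ := fun s => (Φ (c + s * d) + Complex.log (-(c + s * d))) -
    (Φ c + Complex.log (-c)) with hf
  have hre : ∀ s : ℝ, 0 ≤ s → (c + s * d).re ≤ -(a + w) := by
    intro s hs
    rw [Complex.add_re, Complex.re_ofReal_mul, hc, Complex.ofReal_re]
    nlinarith
  have hder : ∀ s : ℝ, 0 ≤ s →
      HasDerivAt f (cubicExp a b (c + s * d) / (c + s * d) * d) s := by
    intro s hs
    have hr := hre s hs
    have h0 : c + s * d ≠ 0 := by
      intro h
      rw [h, Complex.zero_re] at hr
      linarith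
    have hline : HasDerivAt (fun s : ℝ => c + s * d) d s := by
      simpa using ((Complex.ofRealCLM.hasDerivAt (x := s)).mul_const d).const_add c
    -- The ray starts on the cut of log t, but log(-t) is holomorphic in the left half-plane, where
    -- the ray stays.
    have h1 : HasDerivAt (fun t : ℂ => Complex.log (-t)) ((c + s * d)⁻¹) (c + s * d) := by
      have := (hasDerivAt_neg (c + s * d)).clog (Complex.mem_slitPlane_iff.2 (Or.inl (by
        rw [Complex.neg_re]; linarith)))
      rwa [neg_div_neg_eq, one_div] at this
    have h2 := (((hΦ _ h0).add h1).comp s hline).sub_const (Φ c + Complex.log (-c))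
    have e : cubicExp a b (c + s * d) / (c + s * d) * d =
        ((cubicExp a b (c + s * d) - 1) / (c + s * d) + (c + s * d)⁻¹) * d := by
      field_simp; ring
    rw [e]
    exact h2
  have hbd : ∀ s : ℝ, 0 ≤ s → ‖cubicExp a b (c + s * d) / (c + s * d) * d‖ ≤
      2 / (a + w) * Real.exp (-s) := by
    intro s hs
    have hr := hre s hs
    have h1 : a + w ≤ ‖c + s * d‖ := by
      have := (abs_le.1 (Complex.abs_re_le_norm (c + s * d))).1
      linarith
    rw [norm_mul, hd, mul_one, norm_div]
    calc _ ≤ 2 * Real.exp (-s) / (a + w) := by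
          gcongr
          exact (norm_cubicExp_stationary_le hw hw0 hn hd3 hd2 s).trans
            (exp_neg_cube_div_three_le hs)
      _ = _ := by ring
  have hB : ∀ s : ℝ, HasDerivAt (fun s : ℝ => 2 / (a + w) * (1 - Real.exp (-s)))
      (2 / (a + w) * Real.exp (-s)) s := by
    intro s
    have h1 : HasDerivAt (fun s : ℝ => Real.exp (-s)) (Real.exp (-s) * -1) s :=
      (hasDerivAt_neg s).exp
    have := (h1.const_sub 1).const_mul (2 / (a + w))
    simpa using this
  have h := image_norm_le_of_norm_deriv_right_le_deriv_boundary (a := 0) (b := s)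
    (fun u hu => (hder u hu.1).continuousAt.continuousWithinAt)
    (fun u hu => (hder u hu.1).hasDerivWithinAt) (by simp [hf]) hB (fun u hu => hbd u hu.1)
    (right_mem_Icc.2 hs)
  refine h.trans ?_
  have : 0 ≤ 2 / (a + w) := by positivity
  nlinarith [Real.exp_pos (-s)]

lemma log_neg_of_im_pos {t : ℂ} (ht : 0 < t.im) :
    Complex.log (-t) = Complex.log t - Real.pi * Complex.I := by
  rw [Complex.log, Complex.log, norm_neg, Complex.arg_neg_eq_arg_sub_pi_of_im_pos ht]
  push_cast; ring

lemma log_neg_of_im_neg {t : ℂ} (ht : t.im < 0) :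
    Complex.log (-t) = Complex.log t + Real.pi * Complex.I := by
  rw [Complex.log, Complex.log, norm_neg, Complex.arg_neg_eq_arg_add_pi_of_im_neg ht]
  push_cast; ring

/-- Both rays issue from the stationary point c < 0. Measured with log(-t), which is log t ∓ πi
above and below the axis, each limit is within 2/(a + w) of the value P at c. The two jumps add up
to 2πi, the residue separating contours to the left and to the right of the origin. -/
lemma IsPolarPrimitive.norm_limit_sub_le {a b n w : ℝ} {Φ : ℂ → ℂ} (hΦ : IsPolarPrimitive a b Φ)
    (hw : w ^ 2 = n) (hw0 : 0 ≤ w) (hn : n = a ^ 2 - b) (hm : 0 < a + w) {K L : ℂ}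
    (hK : Tendsto (fun t => Φ t + Complex.log t)
      (sectorAtInfty (Complex.exp (Complex.I * (-(Real.pi / 2) : ℝ)))) (𝓝 K))
    (hL : Tendsto (fun t => Φ t + Complex.log t)
      (sectorAtInfty (Complex.exp (Complex.I * (5 * Real.pi / 6 : ℝ)))) (𝓝 L)) :
    ‖(L - K) - 2 * Real.pi * Complex.I‖ ≤ 4 / (a + w) := by
  set c : ℂ := ((-(a + w) : ℝ) : ℂ) with hc
  set P := Φ c + Complex.log (-c)
  have h3sq : (√3 : ℂ) ^ 2 = 3 := by
    rw [← Complex.ofReal_pow, Real.sq_sqrt (by norm_num)]; norm_num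
  have h1 : ‖(L - Real.pi * Complex.I) - P‖ ≤ 2 / (a + w) := by
    set d := Complex.exp (Complex.I * (5 * Real.pi / 6 : ℝ)) with hd
    have hdn : ‖d‖ = 1 := norm_exp_I_mul _
    have him : d.im = 1 / 2 := exp_five_pi_six_im
    have hre : d.re ≤ 0 := by
      rw [hd, exp_five_pi_six, show (√3 * (-1 : ℝ) + Complex.I : ℂ) / 2 =
        ((-(√3 / 2) : ℝ) : ℂ) + ((1 / 2 : ℝ) : ℂ) * Complex.I by push_cast; ring]
      simp
      positivity
    have hd2 : 0 ≤ (Complex.I * d ^ 2).re := by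
      have : Complex.I * d ^ 2 = ((√3 / 2 : ℝ) : ℂ) + ((1 / 2 : ℝ) : ℂ) * Complex.I := by
        rw [hd, exp_five_pi_six]
        push_cast
        linear_combination Complex.I / 4 * h3sq + (-√3 / 2 + Complex.I / 4) * Complex.I_sq
      rw [this]
      simp
      positivity
    have hlim := ((hL.comp (tendsto_ray_sectorAtInfty hdn c)).sub_const
      (Real.pi * Complex.I)).sub_const P
    refine le_of_tendsto hlim.norm ?_
    filter_upwards [eventually_gt_atTop 0] with s hs
    have := hΦ.norm_sub_le hw hw0 hn hm exp_five_pi_six_pow hd2 hdn hre hs.le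
    rw [log_neg_of_im_pos] at this
    · simpa only [Function.comp_apply, add_sub_assoc] using this
    · rw [Complex.add_im, Complex.ofReal_im, Complex.im_ofReal_mul, him]; linarith
  have h2 : ‖(K + Real.pi * Complex.I) - P‖ ≤ 2 / (a + w) := by
    set d := Complex.exp (Complex.I * (-(Real.pi / 2) : ℝ)) with hd
    have hdn : ‖d‖ = 1 := norm_exp_I_mul _
    have him : d.im = -1 := exp_neg_pi_two_im
    have hre : d.re ≤ 0 := by rw [hd, exp_neg_pi_two]; simp
    have hd2 : 0 ≤ (Complex.I * d ^ 2).re := by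
      rw [hd, exp_neg_pi_two]
      simp
    have hlim := ((hK.comp (tendsto_ray_sectorAtInfty hdn c)).add_const
      (Real.pi * Complex.I)).sub_const P
    refine le_of_tendsto hlim.norm ?_
    filter_upwards [eventually_gt_atTop 0] with s hs
    have := hΦ.norm_sub_le hw hw0 hn hm exp_neg_pi_two_pow hd2 hdn hre hs.le
    rw [log_neg_of_im_neg] at this
    · simpa only [Function.comp_apply, add_assoc] using this
    · rw [Complex.add_im, Complex.ofReal_im, Complex.im_ofReal_mul, him]; linarith
  have e : (L - K) - 2 * Real.pi * Complex.I =
      ((L - Real.pi * Complex.I) - P) - ((K + Real.pi * Complex.I) - P) := by ring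
  rw [e]
  refine (_root_.norm_sub_le _ _).trans ((add_le_add h1 h2).trans (le_of_eq ?_))
  ring

lemma phaseWeight_Ioc {R : ℝ} (hR : 0 ≤ R) : PhaseWeight (volume.restrict (Ioc (-R) 0)) (fun _ => 1)
    (fun r : ℝ => r) (fun _ => Real.exp (√R ^ 3)) := by
  refine ⟨by fun_prop, by fun_prop, integrable_const _, ?_⟩
  rw [ae_restrict_iff' measurableSet_Ioc]
  refine ae_of_all _ fun r hr T hT => ?_
  rw [norm_one, one_mul, ← Real.exp_add]
  apply Real.exp_le_exp.2
  have h1 : ‖(r : ℂ)‖ ≤ R := by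
    rw [Complex.norm_real]; exact abs_le.2 ⟨hr.1.le, hr.2.trans hR⟩
  have h2 := mul_le_cube_add_sqrt_cube hT hR
  nlinarith [mul_le_mul_of_nonneg_left h1 hT]

lemma integral_exp_Ioc {R : ℝ} (hR : 0 ≤ R) {t : ℂ} (ht : t ≠ 0) :
    ∫ r in Ioc (-R) 0, (1 : ℂ) * Complex.exp (Complex.I * r * t) =
      (1 - Complex.exp (-(Complex.I * R * t))) / (Complex.I * t) := by
  rw [← intervalIntegral.integral_of_le (by linarith)]
  have hne : Complex.I * t ≠ 0 := mul_ne_zero Complex.I_ne_zero ht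
  have := integral_exp_mul_complex (a := -R) (b := 0) hne
  simp only [one_mul]
  have e : ∀ r : ℝ, Complex.I * r * t = Complex.I * t * r := fun r => by ring
  simp only [e, this]
  congr 2
  · simp
  · push_cast; ring_nf

/-- The effect of a shift of the parameter on the polar part of the contour integral. -/
lemma exists_polarPrimitive_shift {a b : ℂ} {Φ : ℂ → ℂ} (hΦ : IsPolarPrimitive a b Φ) {K L : ℂ}
    (hK : Tendsto (fun t => Φ t + Complex.log t)
      (sectorAtInfty (Complex.exp (Complex.I * (-(Real.pi / 2) : ℝ)))) (𝓝 K))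
    (hL : Tendsto (fun t => Φ t + Complex.log t)
      (sectorAtInfty (Complex.exp (Complex.I * (5 * Real.pi / 6 : ℝ)))) (𝓝 L))
    {R : ℝ} (hR : 0 ≤ R) : ∃ (Φ' : ℂ → ℂ) (K' L' : ℂ), IsPolarPrimitive a (b - R) Φ' ∧
      Tendsto (fun t => Φ' t + Complex.log t)
        (sectorAtInfty (Complex.exp (Complex.I * (-(Real.pi / 2) : ℝ)))) (𝓝 K') ∧
      Tendsto (fun t => Φ' t + Complex.log t)
        (sectorAtInfty (Complex.exp (Complex.I * (5 * Real.pi / 6 : ℝ)))) (𝓝 L') ∧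
      L' - K' = L - K - Complex.I * ∫ r in Ioc (-R) 0, cubicIntegral a (b + r) := by
  have hW := phaseWeight_Ioc hR
  set S : ℂ → ℂ := fun t => ∫ r in Ioc (-R) 0, (1 : ℂ) * Complex.exp (Complex.I * r * t) with hS
  obtain ⟨P, k₀, l₀, hP, hP2, hP1, hP3⟩ := hW.exists_primitive a b
  refine ⟨fun t => Φ t - Complex.I * P t, _, _, fun t ht => ?_,
    (hK.sub (hP2.const_mul Complex.I)).congr fun t => by ring,
    (hL.sub (hP1.const_mul Complex.I)).congr fun t => by ring, ?_⟩
  · have h1 := (hΦ t ht).sub ((hP t).const_mul Complex.I)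
    -- Replacing b by b - R multiplies the exponential by e^{-iRt}, and (1 - e^{-iRt})/t is i times
    -- the phase integral S: the pole cancels in the difference.
    have e : (cubicExp a (b - R) t - 1) / t =
        (cubicExp a b t - 1) / t - Complex.I * (S t * cubicExp a b t) := by
      have h2 : cubicExp a (b - R) t = Complex.exp (-(Complex.I * R * t)) * cubicExp a b t := by
        rw [sub_eq_add_neg b, ← cubicExp_mul_exp]; congr 2; ring
      rw [hS]
      beta_reduce
      rw [integral_exp_Ioc hR ht, h2]
      field_simp [Complex.I_ne_zero]
      ring
    rw [e]
    exact h1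
  · simp only [one_mul] at hP3
    rw [← hP3]
    ring

/-- The polar part of the contour integral, in terms of an improper integral. -/
theorem IsPolarPrimitive.tendsto_integral {a b : ℝ} {Φ : ℂ → ℂ} (hΦ : IsPolarPrimitive a b Φ)
    {K L : ℂ} (hK : Tendsto (fun t => Φ t + Complex.log t)
      (sectorAtInfty (Complex.exp (Complex.I * (-(Real.pi / 2) : ℝ)))) (𝓝 K))
    (hL : Tendsto (fun t => Φ t + Complex.log t)
      (sectorAtInfty (Complex.exp (Complex.I * (5 * Real.pi / 6 : ℝ)))) (𝓝 L)) :
    Tendsto (fun R : ℝ => Complex.I * ∫ r in Ioc (-R) 0, cubicIntegral a (b + r)) atTop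
      (𝓝 (L - K - 2 * Real.pi * Complex.I)) := by
  rw [tendsto_iff_norm_sub_tendsto_zero]
  -- The distance from the origin to the left stationary point for b - R; it controls the deviation
  -- of L' - K' from 2πi.
  have hsq : Tendsto (fun R : ℝ => a + √(a ^ 2 - (b - R))) atTop atTop := by
    refine tendsto_atTop_add_const_left _ _ (Real.tendsto_sqrt_atTop.comp ?_)
    have : (fun R : ℝ => a ^ 2 - (b - R)) = fun R => (a ^ 2 - b) + R := by ext R; ring
    rw [this]
    exact tendsto_atTop_add_const_left _ _ tendsto_id
  refine squeeze_zero' (Eventually.of_forall fun _ => norm_nonneg _) ?_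
    (hsq.const_div_atTop 4)
  filter_upwards [eventually_ge_atTop 0, hsq.eventually_gt_atTop 0,
    eventually_ge_atTop b] with R hR hm hRb
  obtain ⟨Φ', K', L', h1, h2, h3, h4⟩ := exists_polarPrimitive_shift hΦ hK hL hR
  rw [← Complex.ofReal_sub] at h1
  have h5 := h1.norm_limit_sub_le (Real.sq_sqrt (by nlinarith)) (Real.sqrt_nonneg _) rfl hm h2 h3
  rw [h4] at h5
  rw [norm_sub_rev]
  refine le_trans (le_of_eq ?_) h5
  congr 1
  ring

/-! ### Rotation of the integral of `A₂/A₁` -/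

lemma differentiable_airyA1 : Differentiable ℂ airyA1 := by
  rw [funext airyA1_def]
  exact (differentiable_airyAi.comp (differentiable_id.const_mul omega)).const_mul omega

lemma differentiable_airyA2 : Differentiable ℂ airyA2 := by
  rw [funext airyA2_def]
  exact (differentiable_airyAi.comp (differentiable_id.const_mul (omega ^ 2))).const_mul _

lemma differentiable_cubicIntegral (a b : ℂ) :
    Differentiable ℂ fun σ => cubicIntegral a (b + σ) := by
  simp only [cubicIntegral_eq]
  have : Differentiable ℂ fun σ => airyA1 (b + σ - a ^ 2) :=
    differentiable_airyA1.comp ((differentiable_id.const_add b).sub_const (a ^ 2))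
  fun_prop

/-- `A₁` has no zeros in a half-plane slightly larger than the left half-plane. -/
lemma exists_airyA1_ne_zero : ∃ ε > 0, ∀ σ : ℂ, σ.re < ε → airyA1 σ ≠ 0 := by
  have h0 : airyA1 0 ≠ 0 := by simpa using ratio₃_props.1 0
  obtain ⟨δ, hδ, hball⟩ := Metric.eventually_nhds_iff.1
    (differentiable_airyA1.continuous.continuousAt.eventually_ne h0)
  refine ⟨δ / 2, by positivity, fun σ hσ hzero => ?_⟩
  have h1 : airyAi (omega * σ) = 0 := by
    rw [airyA1_def] at hzero
    exact (mul_eq_zero.1 hzero).resolve_left omega_ne_zero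
  have h2 : (omega * σ).im = 0 ∧ (omega * σ).re < 0 := by
    by_contra hcon
    refine airyAi_ne_zero ?_ h1
    rw [not_and_or, not_lt] at hcon
    exact hcon
  set s := -(omega * σ).re with hs
  have h3 : omega * σ = -(s : ℂ) := by
    apply Complex.ext
    · simp [hs]
    · simp [h2.1]
  -- A zero of A₁ lies on the ray of direction 1 + ω = e^{iπ/3}, so its real part is half its
  -- modulus. Hence Re σ < δ/2 would force |σ| < δ, where A₁ does not vanish.
  have h4 : σ = s * (1 + omega) := by
    have : σ = omega ^ 2 * (omega * σ) := by
      linear_combination -σ * omega_pow_three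
    rw [this, h3, omega_sq]; ring
  have h5 : ‖σ‖ = s := by
    have : ‖omega * σ‖ = ‖σ‖ := by rw [norm_mul, norm_omega, one_mul]
    rw [← this, h3, norm_neg, Complex.norm_real, Real.norm_of_nonneg (by linarith [h2.2])]
  have h6 : σ.re = s / 2 := by
    rw [h4, Complex.re_ofReal_mul, Complex.add_re, omega_re, Complex.one_re]; ring
  refine hball ?_ hzero
  rw [dist_zero_right, h5]
  linarith

/-- The integrand `(A₂/A₁)(σ) ∫ e^{i(t³/3 + at² + (b + σ)t)} dt`. -/
def rotatedIntegrand (a b : ℝ) (σ : ℂ) : ℂ :=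
  airyA2 σ / airyA1 σ * cubicIntegral a (b + σ)

lemma norm_cubicIntegral_eq (a b : ℝ) (σ : ℂ) : ‖cubicIntegral a (b + σ)‖ =
    2 * Real.pi * Real.exp (a * σ.im) *
      ‖airyAi (omega * σ + -(omega * (a ^ 2 - b : ℝ)))‖ := by
  rw [cubicIntegral_eq, norm_mul, norm_mul, airyA1_def, norm_mul omega, norm_omega, one_mul,
    Complex.norm_exp]
  have e1 : (Complex.I * (2 * (a : ℂ) ^ 3 / 3 - a * (b + σ))).re = a * σ.im := by
    have : Complex.I * (2 * (a : ℂ) ^ 3 / 3 - a * (b + σ)) =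
      ((2 * a ^ 3 / 3 - a * b : ℝ) : ℂ) * Complex.I + ((-a : ℝ) : ℂ) * (Complex.I * σ) := by
      push_cast; ring
    rw [this, Complex.add_re, Complex.re_ofReal_mul, Complex.re_ofReal_mul, Complex.I_re,
      Complex.I_mul_re]
    ring
  have e2 : ‖(2 * Real.pi : ℂ)‖ = 2 * Real.pi := by
    rw [norm_mul]; simp [abs_of_pos Real.pi_pos]
  have e3 : omega * ((b : ℂ) + σ - a ^ 2) = omega * σ + -(omega * (a ^ 2 - b : ℝ)) := by
    push_cast; ring
  rw [e1, e2, e3]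
  ring

/-- The path `-(U - iv)²` joins the negative axis to the ray of direction `e^{2πi/3}`. -/
def rotationPath (U v : ℝ) : ℂ := -(U - v * Complex.I) ^ 2

/-- For w = U - iv and σ = -w² the square roots of ωσ and ω²σ in the right half-plane are
e^{∓iπ/6}w, with cubes ∓iw³. With ρ = Re(iw³), A₂/A₁ contributes e^{-4ρ/3} and the cubic integral
e^{2ρ/3}. Since 3v² ≤ U², ρ = 3U²v - v³ ≥ 8U²v/3, whence the rate 16/9. -/
lemma norm_rotatedIntegrand_le (a b : ℝ) {U v : ℝ} (hU : 4 ≤ U) (hv : 0 ≤ v) (hvU : √3 * v ≤ U) :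
    ‖rotatedIntegrand a b (rotationPath U v)‖ ≤
      16 * (2 * Real.pi) * Real.exp ((a ^ 2 - b) ^ 2) *
        Real.exp (-(16 / 9) * (U ^ 2 * v) + |a ^ 2 - b| * v + 2 * |a| * U * v) := by
  have h3 : √3 ^ 2 = 3 := Real.sq_sqrt (by norm_num)
  have h3C : (√3 : ℂ) ^ 2 = 3 := by rw [← Complex.ofReal_pow, h3]; norm_num
  have h3p : 0 < √3 := by positivity
  have h3l : 17 / 10 ≤ √3 := Real.le_sqrt_of_sq_le (by norm_num)
  set n := a ^ 2 - b
  set w : ℂ := U - v * Complex.I with hw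
  set σ := rotationPath U v with hσ
  have hσw : σ = -w ^ 2 := rfl
  have ho : omega = (-1 + √3 * Complex.I) / 2 := by
    rw [← Complex.re_add_im omega, omega_re, omega_im]; push_cast; ring
  set β₁ : ℂ := (√3 - Complex.I) / 2 * w with hβ₁
  set β₂ : ℂ := (√3 + Complex.I) / 2 * w with hβ₂
  have s1 : β₁ ^ 2 = omega * σ := by
    rw [hβ₁, hσw, ho]
    linear_combination w ^ 2 / 4 * h3C + w ^ 2 / 4 * Complex.I_sq
  have s2 : β₂ ^ 2 = omega ^ 2 * σ := by
    rw [hβ₂, hσw, omega_sq, ho]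
    linear_combination w ^ 2 / 4 * h3C + w ^ 2 / 4 * Complex.I_sq
  have c1 : β₁ ^ 3 = -(Complex.I * w ^ 3) := by
    rw [hβ₁]
    linear_combination (w ^ 3 / 8 * (√3 - 3 * Complex.I)) * h3C +
      (w ^ 3 / 8 * (3 * √3 - Complex.I)) * Complex.I_sq
  have c2 : β₂ ^ 3 = Complex.I * w ^ 3 := by
    rw [hβ₂]
    linear_combination (w ^ 3 / 8 * (√3 + 3 * Complex.I)) * h3C +
      (w ^ 3 / 8 * (3 * √3 + Complex.I)) * Complex.I_sq
  have r1 : β₁.re = (√3 * U - v) / 2 := by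
    have : β₁ = (((√3 * U - v) / 2 : ℝ) : ℂ) + ((-(√3 * v + U) / 2 : ℝ) : ℂ) * Complex.I := by
      rw [hβ₁, hw]; push_cast
      linear_combination (v : ℂ) / 2 * Complex.I_sq
    rw [this]; simp
  have r2 : β₂.re = (√3 * U + v) / 2 := by
    have : β₂ = (((√3 * U + v) / 2 : ℝ) : ℂ) + (((U - √3 * v) / 2 : ℝ) : ℂ) * Complex.I := by
      rw [hβ₂, hw]; push_cast
      linear_combination (-(v : ℂ) / 2) * Complex.I_sq
    rw [this]; simp
  have hwn : ‖w‖ ^ 2 = U ^ 2 + v ^ 2 := by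
    rw [← Complex.normSq_eq_norm_sq, Complex.normSq_apply]
    simp [hw]; ring
  have hw0 := norm_nonneg w
  have hv2 : 3 * v ^ 2 ≤ U ^ 2 := by
    have : (√3 * v) ^ 2 ≤ U ^ 2 := by gcongr
    rwa [mul_pow, h3] at this
  have hβn1 : ‖β₁‖ = ‖w‖ := by
    have : ‖((√3 : ℂ) - Complex.I) / 2‖ = 1 := by
      rw [norm_div, show ((√3 : ℂ) - Complex.I) = ((√3 : ℝ) : ℂ) + ((-1 : ℝ) : ℂ) * Complex.I by
        push_cast; ring, Complex.norm_add_mul_I, h3]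
      norm_num
    rw [hβ₁, norm_mul, this, one_mul]
  have hw4 : U ≤ ‖w‖ := abs_le_of_sq_le_sq' (by rw [hwn]; nlinarith) hw0 |>.2
  have hw2 : ‖w‖ ≤ 2 * β₁.re := by
    rw [r1]
    refine abs_le_of_sq_le_sq' ?_ ?_ |>.2
    · rw [hwn]; nlinarith
    · nlinarith
  have hw3 : ‖w‖ ≤ 4 * β₂.re := by rw [r2]; rw [r1] at hw2; linarith
  have hre1 : 1 ≤ β₁.re := by linarith
  have hre2 : 0 < β₂.re := by linarith
  have hρ : (Complex.I * w ^ 3).re = 3 * U ^ 2 * v - v ^ 3 := by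
    have : Complex.I * w ^ 3 = ((3 * U ^ 2 * v - v ^ 3 : ℝ) : ℂ) +
        ((U ^ 3 - 3 * U * v ^ 2 : ℝ) : ℂ) * Complex.I := by
      rw [hw]; push_cast
      linear_combination (-3 * (U : ℂ) ^ 2 * v + 3 * U * v ^ 2 * Complex.I -
        (v : ℂ) ^ 3 * (Complex.I ^ 2 - 1)) * Complex.I_sq
    rw [this, Complex.add_re, Complex.ofReal_re, Complex.re_ofReal_mul, Complex.I_re, mul_zero,
      add_zero]
  set ρ := 3 * U ^ 2 * v - v ^ 3
  have hρ2 : 8 / 3 * (U ^ 2 * v) ≤ ρ := by simp only [ρ]; nlinarith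
  have b2 : ‖airyA2 σ‖ ≤ 1 / √β₂.re * Real.exp (-(2 / 3 * ρ)) := by
    have := norm_airyAi_le hre2 0
    rw [add_zero, mul_zero, add_zero, s2, c2, norm_zero] at this
    have e : (2 / 3 * (Complex.I * w ^ 3)).re = 2 / 3 * ρ := by
      rw [← hρ, show (2 / 3 : ℂ) = ((2 / 3 : ℝ) : ℂ) by push_cast; rfl, Complex.re_ofReal_mul]
    rw [e] at this
    rw [airyA2_def, norm_mul, norm_pow, norm_omega, one_pow, one_mul]
    simpa using this
  have b1 : 1 / (8 * √‖w‖) * Real.exp (2 / 3 * ρ) ≤ ‖airyA1 σ‖ := by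
    have := le_norm_airyAi (β := β₁) (by rw [hβn1]; exact hw2) (by rw [hβn1]; linarith)
    rw [s1, c1, hβn1] at this
    have e : (2 / 3 * -(Complex.I * w ^ 3)).re = -(2 / 3 * ρ) := by
      rw [← hρ, show (2 / 3 : ℂ) = ((2 / 3 : ℝ) : ℂ) by push_cast; rfl, Complex.re_ofReal_mul,
        Complex.neg_re]
      ring
    rw [e, neg_neg] at this
    rw [airyA1_def, norm_mul, norm_omega, one_mul]
    exact this
  have b3 : ‖cubicIntegral a (b + σ)‖ ≤ 2 * Real.pi * Real.exp (2 * |a| * U * v) *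
      (Real.exp (n ^ 2) * Real.exp (2 / 3 * ρ + |n| * v)) := by
    rw [norm_cubicIntegral_eq]
    have him : σ.im = 2 * U * v := by
      have : σ = ((-(U ^ 2 - v ^ 2) : ℝ) : ℂ) + ((2 * U * v : ℝ) : ℂ) * Complex.I := by
        rw [hσw, hw]; push_cast
        linear_combination (-(v : ℂ) ^ 2) * Complex.I_sq
      rw [this, Complex.add_im, Complex.ofReal_im, Complex.im_ofReal_mul, Complex.I_im, mul_one,
        zero_add]
    have h5 := norm_airyAi_le (β := β₁) (by linarith) (-(omega * (n : ℂ)))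
    rw [s1] at h5
    have e1 : ‖-(omega * (n : ℂ))‖ ^ 2 = n ^ 2 := by
      rw [norm_neg, norm_mul, norm_omega, one_mul, Complex.norm_real, Real.norm_eq_abs, sq_abs]
    have e2 : (2 / 3 * β₁ ^ 3 + β₁ * -(omega * (n : ℂ))).re = -(2 / 3 * ρ) - n * v := by
      have : 2 / 3 * β₁ ^ 3 + β₁ * -(omega * (n : ℂ)) =
          ((-(2 / 3) : ℝ) : ℂ) * (Complex.I * w ^ 3) + ((-n : ℝ) : ℂ) * (Complex.I * w) := by
        rw [c1, hβ₁, ho]; push_cast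
        linear_combination (-(w * n * Complex.I) / 4) * h3C + (w * n * √3 / 4) * Complex.I_sq
      rw [this, Complex.add_re, Complex.re_ofReal_mul, Complex.re_ofReal_mul, hρ, Complex.I_mul_re]
      simp [hw]
      ring
    rw [e1, e2] at h5
    have h6 : Real.exp (n ^ 2 / (2 * β₁.re)) / √β₁.re ≤ Real.exp (n ^ 2) := by
      have h7 : 1 ≤ √β₁.re := Real.one_le_sqrt.2 hre1
      refine (div_le_self (Real.exp_nonneg _) h7).trans (Real.exp_le_exp.2 ?_)
      exact div_le_self (sq_nonneg n) (by linarith)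
    rw [him]
    have h8 : a * (2 * U * v) ≤ 2 * |a| * U * v := by
      have := mul_le_mul_of_nonneg_right (le_abs_self a) (by positivity : 0 ≤ 2 * U * v)
      linarith
    have h9 : -(-(2 / 3 * ρ) - n * v) ≤ 2 / 3 * ρ + |n| * v := by
      have := mul_le_mul_of_nonneg_right (le_abs_self n) hv
      linarith
    gcongr
    refine h5.trans ?_
    gcongr
  have hw' : 0 < √‖w‖ := Real.sqrt_pos.2 (by linarith)
  have hA1 : 0 < ‖airyA1 σ‖ := lt_of_lt_of_le (by positivity) b1
  have hsq : √‖w‖ / √β₂.re ≤ 2 := by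
    rw [div_le_iff₀ (Real.sqrt_pos.2 hre2)]
    calc √‖w‖ ≤ √(2 ^ 2 * β₂.re) := Real.sqrt_le_sqrt (by linarith)
      _ = 2 * √β₂.re := by rw [Real.sqrt_mul (by norm_num), Real.sqrt_sq (by norm_num)]
  have hq : ‖airyA2 σ / airyA1 σ‖ ≤ 16 * Real.exp (-(4 / 3 * ρ)) := by
    rw [norm_div, div_le_iff₀ hA1]
    have hb' : 0 < √β₂.re := Real.sqrt_pos.2 hre2
    calc _ ≤ 1 / √β₂.re * Real.exp (-(2 / 3 * ρ)) := b2
      _ = 8 * (√‖w‖ / √β₂.re) * Real.exp (-(4 / 3 * ρ)) *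
          (1 / (8 * √‖w‖) * Real.exp (2 / 3 * ρ)) := by
        have : Real.exp (-(2 / 3 * ρ)) = Real.exp (-(4 / 3 * ρ)) * Real.exp (2 / 3 * ρ) := by
          rw [← Real.exp_add]; congr 1; ring
        rw [this]; field_simp
      _ ≤ 8 * 2 * Real.exp (-(4 / 3 * ρ)) * ‖airyA1 σ‖ := by gcongr
      _ = _ := by ring
  rw [rotatedIntegrand, norm_mul]
  calc _ ≤ 16 * Real.exp (-(4 / 3 * ρ)) * (2 * Real.pi * Real.exp (2 * |a| * U * v) *
      (Real.exp (n ^ 2) * Real.exp (2 / 3 * ρ + |n| * v))) := by gcongr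
    _ = 16 * (2 * Real.pi) * Real.exp (n ^ 2) * (Real.exp (-(4 / 3 * ρ)) *
        Real.exp (2 * |a| * U * v) * Real.exp (2 / 3 * ρ + |n| * v)) := by ring
    _ ≤ _ := by
      gcongr
      rw [← Real.exp_add, ← Real.exp_add]
      apply Real.exp_le_exp.2
      linarith

/-- The ball contains 0 and the arc but reaches only to real part ε, so for the ε of
`exists_airyA1_ne_zero` the integrand is holomorphic on it and has a primitive. -/
lemma rotationPath_mem_ball {U v ε : ℝ} (hε : 0 < ε) (hvU : 3 * v ^ 2 ≤ U ^ 2) :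
    rotationPath U v ∈ Metric.ball ((-(2 * U ^ 2) : ℝ) : ℂ) (2 * U ^ 2 + ε) := by
  rw [mem_ball_iff_norm]
  refine lt_of_le_of_lt ?_ (lt_add_of_pos_right _ hε)
  refine abs_le_of_sq_le_sq' ?_ (by positivity) |>.2
  have : rotationPath U v - ((-(2 * U ^ 2) : ℝ) : ℂ) =
      ((U ^ 2 + v ^ 2 : ℝ) : ℂ) + ((2 * U * v : ℝ) : ℂ) * Complex.I := by
    rw [rotationPath]; push_cast
    linear_combination (-(v : ℂ) ^ 2) * Complex.I_sq
  rw [this, Complex.norm_add_mul_I, Real.sq_sqrt (by positivity)]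
  nlinarith [sq_nonneg U, sq_nonneg v]

/-- The integral along the negative axis, compared with that along the ray of direction
`e^{2πi/3}`. -/
lemma exists_norm_rotation_le (a b : ℝ) : ∃ C U₀ : ℝ, ∀ U, U₀ ≤ U → 0 < U ∧
    ‖(∫ s in (-U ^ 2)..0, rotatedIntegrand a b s) +
      ∫ r in (0 : ℝ)..(4 / 3 * U ^ 2), rotatedIntegrand a b (r * omega) * omega‖ ≤ C / U := by
  obtain ⟨ε, hε, hne⟩ := exists_airyA1_ne_zero
  set C₀ := 16 * (2 * Real.pi) * Real.exp ((a ^ 2 - b) ^ 2) with hC₀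
  have hC₀p : 0 < C₀ := by positivity
  refine ⟨4 * C₀, 4 + 2 * (|a ^ 2 - b| + 2 * |a|), fun U hU => ?_⟩
  have hn := abs_nonneg (a ^ 2 - b)
  have ha := abs_nonneg a
  have hU4 : 4 ≤ U := by linarith
  have hU0 : 0 < U := by linarith
  refine ⟨hU0, ?_⟩
  have h3 : √3 ^ 2 = 3 := Real.sq_sqrt (by norm_num)
  have h3C : (√3 : ℂ) ^ 2 = 3 := by rw [← Complex.ofReal_pow, h3]; norm_num
  have h3p : 0 < √3 := by positivity
  set B := Metric.ball ((-(2 * U ^ 2) : ℝ) : ℂ) (2 * U ^ 2 + ε) with hB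
  have hneB : ∀ σ ∈ B, airyA1 σ ≠ 0 := by
    intro σ hσ
    rw [hB, mem_ball_iff_norm] at hσ
    have := (Complex.re_le_norm _).trans_lt hσ
    rw [Complex.sub_re, Complex.ofReal_re] at this
    exact hne σ (by linarith)
  have hdiff : DifferentiableOn ℂ (rotatedIntegrand a b) B := fun σ hσ =>
    ((((differentiable_airyA2 σ).div (differentiable_airyA1 σ) (hneB σ hσ)).mul
      (differentiable_cubicIntegral a b σ))).differentiableWithinAt
  obtain ⟨P, hP⟩ := hdiff.isExactOn_ball
  have hconv : Convex ℝ B := convex_ball _ _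
  have m0 : (0 : ℂ) ∈ B := by
    rw [hB, mem_ball_iff_norm, zero_sub, norm_neg, Complex.norm_real, norm_neg,
      Real.norm_of_nonneg (by positivity)]
    linarith
  have m1 : ((-U ^ 2 : ℝ) : ℂ) ∈ B := by
    have := rotationPath_mem_ball (U := U) (v := 0) hε (by nlinarith)
    have e : rotationPath U 0 = ((-U ^ 2 : ℝ) : ℂ) := by simp [rotationPath]
    rwa [e] at this
  -- The arc meets the ray when U - iv has argument -π/6, at squared modulus U² + U²/3.
  have hend : rotationPath U (U / √3) = ((4 / 3 * U ^ 2 : ℝ) : ℂ) * omega := by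
    have ho : omega = (-1 + √3 * Complex.I) / 2 := by
      rw [← Complex.re_add_im omega, omega_re, omega_im]; push_cast; ring
    have hs : (√3 : ℂ) ≠ 0 := by exact_mod_cast h3p.ne'
    have hinv : ((U / √3 : ℝ) : ℂ) = U * √3 / 3 := by
      rw [← h3C]; push_cast; field_simp
    rw [rotationPath, hinv, ho]; push_cast
    linear_combination (-(U : ℂ) ^ 2 * Complex.I ^ 2 / 9) * h3C -
      (U : ℂ) ^ 2 / 3 * Complex.I_sq
  have m2 : ((4 / 3 * U ^ 2 : ℝ) : ℂ) * omega ∈ B := by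
    rw [← hend]
    refine rotationPath_mem_ball hε (le_of_eq ?_)
    rw [div_pow, h3]; ring
  have seg : ∀ {p : ℂ} {s : ℝ}, p ∈ B → 0 ≤ s → s ≤ 1 → (s : ℂ) * p ∈ B := by
    intro p s hp h0 h1
    have := hconv.smul_mem_of_zero_mem m0 hp ⟨h0, h1⟩
    simpa using this
  have i1 : ∫ s in (-U ^ 2)..0, rotatedIntegrand a b s = P 0 - P ((-U ^ 2 : ℝ) : ℂ) := by
    have hmem : ∀ s ∈ uIcc (-U ^ 2) 0, (s : ℂ) ∈ B := by
      intro s hs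
      rw [uIcc_of_le (by nlinarith)] at hs
      have := seg (s := s / (-U ^ 2)) m1 (div_nonneg_of_nonpos hs.2 (by nlinarith))
        ((div_le_one_of_neg (by nlinarith)).2 hs.1)
      have hU2 : (-U ^ 2 : ℝ) ≠ 0 := by nlinarith
      rwa [← Complex.ofReal_mul, div_mul_cancel₀ _ hU2] at this
    have := intervalIntegral.integral_eq_sub_of_hasDerivAt (a := -U ^ 2) (b := 0)
      (f := fun s : ℝ => P s) (f' := fun s : ℝ => rotatedIntegrand a b s)
      (fun s hs => (hP _ (hmem s hs)).comp_ofReal) ?_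
    · rw [this, Complex.ofReal_zero]
    · exact (hdiff.continuousOn.comp Complex.continuous_ofReal.continuousOn
        hmem).intervalIntegrable
  have i2 : ∫ r in (0 : ℝ)..(4 / 3 * U ^ 2), rotatedIntegrand a b (r * omega) * omega =
      P (((4 / 3 * U ^ 2 : ℝ) : ℂ) * omega) - P 0 := by
    have hmem : ∀ s ∈ uIcc (0 : ℝ) (4 / 3 * U ^ 2), (s : ℂ) * omega ∈ B := by
      intro s hs
      rw [uIcc_of_le (by positivity)] at hs
      have := seg (s := s / (4 / 3 * U ^ 2)) m2 (div_nonneg hs.1 (by positivity))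
        ((div_le_one (by positivity)).2 hs.2)
      have hU2 : (4 / 3 * U ^ 2 : ℝ) ≠ 0 := by positivity
      rwa [← mul_assoc, ← Complex.ofReal_mul, div_mul_cancel₀ _ hU2] at this
    have := intervalIntegral.integral_eq_sub_of_hasDerivAt (a := 0) (b := 4 / 3 * U ^ 2)
      (f := fun s : ℝ => P (s * omega))
      (f' := fun s : ℝ => rotatedIntegrand a b (s * omega) * omega) (fun s hs => ?_) ?_
    · rw [this, Complex.ofReal_zero, zero_mul]
    · have hline : HasDerivAt (fun s : ℝ => (s : ℂ) * omega) omega s := by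
        simpa using (Complex.ofRealCLM.hasDerivAt (x := s)).mul_const omega
      exact (hP _ (hmem s hs)).comp s hline
    · exact ((hdiff.continuousOn.comp (by fun_prop) hmem).mul
        continuousOn_const).intervalIntegrable
  have key : ‖P (rotationPath U (U / √3)) - P ((-U ^ 2 : ℝ) : ℂ)‖ ≤ 4 * C₀ / U := by
    set f : ℝ → ℂ := fun v => P (rotationPath U v) - P ((-U ^ 2 : ℝ) : ℂ) with hf
    have hmem : ∀ v ∈ Icc 0 (U / √3), rotationPath U v ∈ B := by
      intro v hv
      refine rotationPath_mem_ball hε ?_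
      have h1 : √3 * v ≤ U := by
        have := hv.2; rw [le_div_iff₀ h3p] at this; linarith
      have : (√3 * v) ^ 2 ≤ U ^ 2 := by have := hv.1; gcongr
      rwa [mul_pow, h3] at this
    have hder : ∀ v ∈ Icc 0 (U / √3), HasDerivAt f (rotatedIntegrand a b (rotationPath U v) *
        (2 * Complex.I * (U - v * Complex.I))) v := by
      intro v hv
      have h1 : HasDerivAt (fun v : ℝ => (U : ℂ) - v * Complex.I) (-Complex.I) v := by
        simpa using ((Complex.ofRealCLM.hasDerivAt (x := v)).mul_const Complex.I).const_sub (U : ℂ)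
      have h2 : HasDerivAt (rotationPath U) (2 * Complex.I * (U - v * Complex.I)) v := by
        have := (h1.pow 2).neg
        have e : -(((2 : ℕ) : ℂ) * ((U : ℂ) - v * Complex.I) ^ (2 - 1) * -Complex.I) =
            2 * Complex.I * (U - v * Complex.I) := by push_cast; ring
        rw [e] at this
        exact this
      exact ((hP _ (hmem v hv)).comp v h2).sub_const _
    have hbd : ∀ v ∈ Icc 0 (U / √3), ‖rotatedIntegrand a b (rotationPath U v) *
        (2 * Complex.I * (U - v * Complex.I))‖ ≤
          4 * C₀ / U * (U ^ 2 * Real.exp (-(U ^ 2 * v))) := by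
      intro v hv
      have hv0 := hv.1
      have h1 : √3 * v ≤ U := by
        have := hv.2; rw [le_div_iff₀ h3p] at this; linarith
      have h2 := norm_rotatedIntegrand_le a b hU4 hv0 h1
      have h4 : ‖2 * Complex.I * ((U : ℂ) - v * Complex.I)‖ ≤ 4 * U := by
        have : ‖(U : ℂ) - v * Complex.I‖ ≤ U + v := by
          refine (_root_.norm_sub_le _ _).trans ?_
          simp [abs_of_pos hU0, abs_of_nonneg hv0]
        have h5 : v ≤ U := hv.2.trans (div_le_self hU0.le (Real.one_le_sqrt.2 (by norm_num)))
        rw [norm_mul, norm_mul, Complex.norm_I, mul_one]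
        norm_num
        linarith
      -- The lower order terms may use 16/9 - 1 = 7/9 of the rate; U ≥ 4 + 2(|a² - b| + 2|a|)
      -- ensures that this suffices.
      have h5 : -(16 / 9) * (U ^ 2 * v) + |a ^ 2 - b| * v + 2 * |a| * U * v ≤ -(U ^ 2 * v) := by
        have h6 : |a ^ 2 - b| + 2 * |a| * U ≤ 7 / 9 * U ^ 2 := by nlinarith
        have := mul_le_mul_of_nonneg_right h6 hv0
        linarith
      rw [norm_mul]
      calc _ ≤ C₀ * Real.exp (-(U ^ 2 * v)) * (4 * U) := by
            gcongr
            refine h2.trans ?_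
            gcongr
        _ = _ := by field_simp
    have hBd : ∀ v : ℝ, HasDerivAt (fun v : ℝ => 4 * C₀ / U * (1 - Real.exp (-(U ^ 2 * v))))
        (4 * C₀ / U * (U ^ 2 * Real.exp (-(U ^ 2 * v)))) v := by
      intro v
      have h1 : HasDerivAt (fun v : ℝ => -(U ^ 2 * v)) (-U ^ 2) v := by
        have := ((hasDerivAt_id v).const_mul (U ^ 2)).neg
        rw [mul_one] at this
        exact this
      have := (h1.exp.const_sub 1).const_mul (4 * C₀ / U)
      have e : 4 * C₀ / U * -(Real.exp (-(U ^ 2 * v)) * -U ^ 2) =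
        4 * C₀ / U * (U ^ 2 * Real.exp (-(U ^ 2 * v))) := by ring
      rw [e] at this
      exact this
    -- The speed 4U of the path against the decay e^{-U²v} integrates to O(1/U) over the arc.
    have h := image_norm_le_of_norm_deriv_right_le_deriv_boundary (a := 0) (b := U / √3)
      (fun u hu => (hder u hu).continuousAt.continuousWithinAt)
      (fun u hu => (hder u (Ico_subset_Icc_self hu)).hasDerivWithinAt)
      (by simp [hf, rotationPath]) hBd (fun u hu => hbd u (Ico_subset_Icc_self hu))
      (right_mem_Icc.2 (by positivity))
    refine h.trans ?_
    have : 0 ≤ 4 * C₀ / U := by positivity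
    nlinarith [Real.exp_pos (-(U ^ 2 * (U / √3)))]
  rw [i1, i2, ← hend]
  convert key using 2
  ring

/-! ### The main theorem -/

lemma integrable_rotatedIntegrand (a b : ℝ) :
    IntegrableOn (fun r : ℝ => rotatedIntegrand a b (r * omega) * omega) (Ioi 0) := by
  obtain ⟨hc2, C2, h2⟩ := ratio₂_props
  exact ((h2.phaseWeight hc2 norm_omega).cubicIntegral_integral a b).1.mul_const omega

/-- The improper integral of `A₂/A₁` along the negative axis. -/
lemma tendsto_rotatedIntegrand (a b : ℝ) :
    Tendsto (fun R : ℝ => ∫ s in (-R)..0, rotatedIntegrand a b s) atTop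
      (𝓝 (-(omega * ∫ r in Ioi (0 : ℝ), ratio₂ r * cubicIntegral a (b + r * omega)))) := by
  have e : omega * ∫ r in Ioi (0 : ℝ), ratio₂ r * cubicIntegral a (b + r * omega) =
      ∫ r in Ioi (0 : ℝ), rotatedIntegrand a b (r * omega) * omega := by
    rw [← integral_const_mul]
    simp only [rotatedIntegrand, ratio₂]
    congr 1; ext r; ring
  rw [e]
  obtain ⟨C, U₀, hC⟩ := exists_norm_rotation_le a b
  have h1 : Tendsto (fun R : ℝ => 4 / 3 * √R ^ 2) atTop atTop :=
    ((tendsto_pow_atTop two_ne_zero).comp Real.tendsto_sqrt_atTop).const_mul_atTop (by norm_num)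
  have h2 := intervalIntegral_tendsto_integral_Ioi 0 (integrable_rotatedIntegrand a b) h1
  have h3 : Tendsto (fun R : ℝ => (∫ s in (-√R ^ 2)..0, rotatedIntegrand a b s) +
      ∫ r in (0 : ℝ)..(4 / 3 * √R ^ 2), rotatedIntegrand a b (r * omega) * omega) atTop (𝓝 0) := by
    refine squeeze_zero_norm' ?_ (Real.tendsto_sqrt_atTop.const_div_atTop C)
    filter_upwards [Real.tendsto_sqrt_atTop.eventually_ge_atTop U₀] with R hR using (hC _ hR).2
  have h4 := h3.sub h2
  rw [zero_sub] at h4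
  refine h4.congr' ?_
  filter_upwards [eventually_ge_atTop 0] with R hR
  rw [add_sub_cancel_right, Real.sq_sqrt hR]

lemma continuous_cubicIntegral (a b : ℂ) : Continuous fun σ : ℝ => cubicIntegral a (b + σ) :=
  (differentiable_cubicIntegral a b).continuous.comp Complex.continuous_ofReal

/-- From A₀ = -A₁ - A₂. On the negative axis the first term leads to the pole of the caret function
and the second can be turned onto l₂. -/
lemma ratio₃_mul_cubicIntegral (a b σ : ℝ) : ratio₃ σ * cubicIntegral a (b + σ) =
    -cubicIntegral a (b + σ) - rotatedIntegrand a b σ := by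
  have h := ratio₃_props.1 σ
  have h1 := airyA0_add_airyA1_add_airyA2 (σ : ℂ)
  rw [ratio₃, rotatedIntegrand]
  field_simp
  linear_combination (cubicIntegral a (b + σ)) * h1

lemma fockIntegrand_eq (x y σ : ℝ) : ratio₃ σ * cubicIntegral (-x / 2 : ℝ) ((-y : ℝ) + σ) =
    2 * Real.pi * Complex.exp (-Complex.I * (x * y / 2 + x ^ 3 / 12)) * fockIntegrand x y σ := by
  have e1 : Complex.exp (Complex.I * (2 * ((-x / 2 : ℝ) : ℂ) ^ 3 / 3 -
      ((-x / 2 : ℝ) : ℂ) * ((-y : ℝ) + σ))) =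
      Complex.exp (-Complex.I * (x * y / 2 + x ^ 3 / 12)) *
        Complex.exp (Complex.I * x * σ / 2) := by
    rw [← Complex.exp_add]
    congr 1; push_cast; ring
  have e2 : ((-y : ℝ) : ℂ) + σ - ((-x / 2 : ℝ) : ℂ) ^ 2 = ((σ - (y + x ^ 2 / 4) : ℝ) : ℂ) := by
    push_cast; ring
  rw [cubicIntegral_eq, e1, e2, fockIntegrand, ratio₃]
  ring

lemma continuous_fockIntegrand (x y : ℝ) : Continuous (fockIntegrand x y) := by
  have h1 : Continuous fun σ : ℝ => airyA1 ((σ - (y + x ^ 2 / 4) : ℝ) : ℂ) :=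
    differentiable_airyA1.continuous.comp (by fun_prop)
  have h2 : Continuous fun σ : ℝ => airyA0 σ / airyA1 σ := ratio₃_props.2.1
  unfold fockIntegrand
  fun_prop

lemma fockTruncated_eq (x y : ℝ) (R : ℝ × ℝ) : fockTruncated x y R =
    -(1 / (2 * Real.pi)) * ∫ σ in R.1..R.2,
      ratio₃ σ * cubicIntegral (-x / 2 : ℝ) ((-y : ℝ) + σ) := by
  have hpi : (Real.pi : ℂ) ≠ 0 := by exact_mod_cast Real.pi_ne_zero
  simp only [fockIntegrand_eq, intervalIntegral.integral_const_mul]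
  rw [fockTruncated]
  field_simp

/-- The limit of the truncated integrals of `A₀/A₁`. -/
lemma tendsto_ratio₃_integral {a b : ℝ} {Φ : ℂ → ℂ} (hΦ : IsPolarPrimitive a b Φ) {K L : ℂ}
    (hK : Tendsto (fun t => Φ t + Complex.log t)
      (sectorAtInfty (Complex.exp (Complex.I * (-(Real.pi / 2) : ℝ)))) (𝓝 K))
    (hL : Tendsto (fun t => Φ t + Complex.log t)
      (sectorAtInfty (Complex.exp (Complex.I * (5 * Real.pi / 6 : ℝ)))) (𝓝 L)) :
    Tendsto (fun R : ℝ × ℝ => ∫ σ in R.1..R.2, ratio₃ σ * cubicIntegral a (b + σ))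
      (atBot ×ˢ atTop) (𝓝 (Complex.I * (L - K - 2 * Real.pi * Complex.I) +
        (omega * ∫ r in Ioi (0 : ℝ), ratio₂ r * cubicIntegral a (b + r * omega)) +
        ∫ r in Ioi (0 : ℝ), ratio₃ r * cubicIntegral a (b + r))) := by
  obtain ⟨-, hc3, C3, h3⟩ := ratio₃_props
  have hcont : Continuous fun σ : ℝ => ratio₃ σ * cubicIntegral a (b + σ) :=
    hc3.mul (continuous_cubicIntegral a b)
  have hpos : Tendsto (fun R : ℝ => ∫ σ in (0 : ℝ)..R, ratio₃ σ * cubicIntegral a (b + σ)) atTop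
      (𝓝 (∫ r in Ioi (0 : ℝ), ratio₃ r * cubicIntegral a (b + r))) := by
    have hi := ((h3.phaseWeight hc3 norm_one).cubicIntegral_integral a b).1
    simp only [mul_one] at hi
    exact intervalIntegral_tendsto_integral_Ioi 0 hi tendsto_id
  have hneg : Tendsto (fun R : ℝ => ∫ σ in (-R)..0, ratio₃ σ * cubicIntegral a (b + σ)) atTop
      (𝓝 (Complex.I * (L - K - 2 * Real.pi * Complex.I) +
        (omega * ∫ r in Ioi (0 : ℝ), ratio₂ r * cubicIntegral a (b + r * omega)))) := by
    -- Neither piece is claimed to be absolutely integrable on the negative axis; both have limits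
    -- over [-R, 0].
    have h1 := ((hΦ.tendsto_integral hK hL).const_mul Complex.I).sub (tendsto_rotatedIntegrand a b)
    rw [sub_neg_eq_add] at h1
    refine h1.congr' ?_
    filter_upwards [eventually_ge_atTop 0] with R hR
    have hi1 : IntervalIntegrable (fun σ : ℝ => -cubicIntegral a (b + σ)) volume (-R) 0 :=
      (continuous_cubicIntegral a b).neg.intervalIntegrable _ _
    have hi2 : IntervalIntegrable (fun σ : ℝ => rotatedIntegrand a b σ) volume (-R) 0 := by
      have : (fun σ : ℝ => rotatedIntegrand a b σ) = fun σ : ℝ =>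
          -cubicIntegral a (b + σ) - ratio₃ σ * cubicIntegral a (b + σ) := by
        ext σ; rw [ratio₃_mul_cubicIntegral]; ring
      rw [this]
      exact hi1.sub (hcont.intervalIntegrable _ _)
    simp only [ratio₃_mul_cubicIntegral]
    rw [intervalIntegral.integral_sub hi1 hi2, intervalIntegral.integral_neg,
      intervalIntegral.integral_of_le (a := -R) (b := 0) (f := fun σ : ℝ => cubicIntegral a (b + σ))
        (by linarith)]
    linear_combination (∫ r in Ioc (-R) 0, cubicIntegral a (b + r)) * Complex.I_sq
  refine ((hneg.comp (tendsto_neg_atBot_atTop.comp tendsto_fst)).add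
    (hpos.comp tendsto_snd)).congr fun R => ?_
  simp only [Function.comp_apply, neg_neg]
  exact intervalIntegral.integral_add_adjacent_intervals (hcont.intervalIntegrable _ _)
    (hcont.intervalIntegrable _ _)

/-- The scattered amplitude exists, and one plus it is the integral along every right contour. -/
theorem scatteredAmplitude_contour (x y : ℝ) :
    Tendsto (fockTruncated x y) (atBot ×ˢ atTop) (𝓝 (scatteredAmplitude x y)) ∧
    ∀ γ : ℝ → ℂ, IsRightContour γ → HasContourIntegral (fun t : ℂ => pekerisCaret t *
      Complex.exp (Complex.I * (-(y * t) - x * t ^ 2 / 2 + t ^ 3 / 3))) γ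
        (totalAmplitude x y) := by
  set a : ℝ := -x / 2 with ha
  set b : ℝ := -y with hb
  have hpi : (Real.pi : ℂ) ≠ 0 := by exact_mod_cast Real.pi_ne_zero
  obtain ⟨G, Φ, hΦ, hG⟩ := exists_polarPrimitive a b
  have hpol : IsPolarPrimitive a b Φ := fun t ht => hG t ht ▸ hΦ t
  obtain ⟨K, hK⟩ := hpol.exists_tendsto (norm_exp_I_mul _) exp_neg_pi_two_pow
    (by rw [exp_neg_pi_two_im]; norm_num)
  obtain ⟨L, hL⟩ := hpol.exists_tendsto (norm_exp_I_mul _) exp_five_pi_six_pow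
    (by rw [exp_five_pi_six_im]; norm_num)
  obtain ⟨hc2, C2, h2⟩ := ratio₂_props
  obtain ⟨-, hc3, C3, h3⟩ := ratio₃_props
  obtain ⟨P₂, k₂, l₂, hP₂, hk₂, hl₂, e₂⟩ := (h2.phaseWeight hc2 norm_omega).exists_primitive a b
  obtain ⟨P₃, k₃, l₃, hP₃, hk₃, hl₃, e₃⟩ := (h3.phaseWeight hc3 norm_one).exists_primitive a b
  set c : ℂ := 1 / (2 * Real.pi * Complex.I) with hc
  have hlim := (tendsto_ratio₃_integral hpol hK hL).const_mul (-(1 / (2 * Real.pi)) : ℂ)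
  simp only [mul_one] at e₃
  rw [← e₂, ← e₃] at hlim
  replace hlim := hlim.congr fun R => (fockTruncated_eq x y R).symm
  have hs := hlim.limUnder_eq
  -- The residue term contributes -(1/2π) · i · (-2πi) = -1, cancelling the incident amplitude, and
  -- i(L - K) becomes c(L - K).
  have hamp : totalAmplitude x y = (c * L + 1 / (2 * Real.pi) * (-(omega * l₂) - l₃)) -
      (c * K + 1 / (2 * Real.pi) * (-(omega * k₂) - k₃)) := by
    rw [totalAmplitude, incidentAmplitude, scatteredAmplitude, hs, hc]
    field_simp [Complex.I_ne_zero]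
    linear_combination (-(L - K) + 2 * Real.pi * Complex.I) * Complex.I_sq
  refine ⟨by rw [scatteredAmplitude, hs]; exact hlim, fun γ hγ => ?_⟩
  rw [hamp]
  refine hasContourIntegral_of_primitive hγ (c := c)
    (G := fun t => c * G t + pekeris t * cubicExp a b t)
    (Φ := fun t => c * Φ t + 1 / (2 * Real.pi) * (-(omega * P₂ t) - P₃ t))
    (fun t ht => ?_) (fun t => ?_) ?_ ?_
  · have e : Complex.exp (Complex.I * (-(y * t) - x * t ^ 2 / 2 + t ^ 3 / 3)) = cubicExp a b t := by
      rw [cubicExp, ha, hb]; congr 1; push_cast; ring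
    rw [e, hG t ht, pekerisCaret, hc]
    field_simp [Complex.I_ne_zero]
    ring
  · have := ((hΦ t).const_mul c).add
      (((((hP₂ t).const_mul omega).neg).sub (hP₃ t)).const_mul (1 / (2 * Real.pi) : ℂ))
    have e : c * G t + pekeris t * cubicExp a b t = c * G t + 1 / (2 * Real.pi) *
        (-(omega * ((∫ r in Ioi (0 : ℝ), ratio₂ r * Complex.exp (Complex.I * (r * omega) * t)) *
          cubicExp a b t)) - (∫ r in Ioi (0 : ℝ), ratio₃ r *
            Complex.exp (Complex.I * (r * 1) * t)) * cubicExp a b t) := by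
      rw [pekeris_eq]; ring
    rw [e]
    exact this
  · refine ((hK.const_mul c).add (((hk₂.const_mul omega).neg.sub hk₃).const_mul
      (1 / (2 * Real.pi) : ℂ))).congr fun t => ?_
    ring
  · refine ((hL.const_mul c).add (((hl₂.const_mul omega).neg.sub hl₃).const_mul
      (1 / (2 * Real.pi) : ℂ))).congr fun t => ?_
    ring

end TangentRay

end

theorem mainTheorem2 :
    -- the integrals defining the Pekeris function converge absolutely, and it is entire
    (∀ t : ℂ, TangentRay.RayIntegrable (2 * Real.pi / 3) (TangentRay.pekerisIntegrand₂ t) ∧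
      TangentRay.RayIntegrable 0 (TangentRay.pekerisIntegrand₃ t)) ∧
    Differentiable ℂ TangentRay.pekeris ∧
    -- the caret function has a simple pole at the origin, with residue `1/(2πi)`
    Tendsto (fun t : ℂ => t * TangentRay.pekerisCaret t) (𝓝[≠] 0)
      (𝓝 (1 / (2 * Real.pi * Complex.I))) ∧
    ∀ x y : ℝ,
      -- the classical improper integral for the scattered amplitude converges
      (∀ a b : ℝ, IntervalIntegrable (TangentRay.fockIntegrand x y) volume a b) ∧
      Tendsto (TangentRay.fockTruncated x y) (atBot ×ˢ atTop)
        (𝓝 (TangentRay.scatteredAmplitude x y)) ∧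
      -- the representation of the total amplitude
      ∀ γ : ℝ → ℂ, TangentRay.IsRightContour γ →
        TangentRay.HasContourIntegral
          (fun t : ℂ => TangentRay.pekerisCaret t *
            Complex.exp (Complex.I * (-(y * t) - x * t ^ 2 / 2 + t ^ 3 / 3)))
          γ (TangentRay.totalAmplitude x y) := by
  refine ⟨TangentRay.rayIntegrable_pekerisIntegrand, TangentRay.differentiable_pekeris,
    TangentRay.tendsto_mul_pekerisCaret, fun x y => ⟨fun a b =>
      (TangentRay.continuous_fockIntegrand x y).intervalIntegrable a b,
      TangentRay.scatteredAmplitude_contour x y⟩⟩
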